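/- Let $\mathcal A$ be the (commutative) Hopf algebra of regular functions on a complex linear algebraic group, with coproduct $\Delta$ and counit $\epsilon$, and let $(\mathcal E,d)$ be its classical bicovariant differential calculus: $\mathcal E$ is the module of Kähler differentials of $\mathcal A$ over $\mathbb C$ with the symmetric bimodule structure $\omega a=a\omega$, $d$ is the universal derivation, and the left and right coactions are $a\,db\mapsto\Delta(a)(\mathrm{id}\otimes d)\Delta(b)$ and $a\,db\mapsto\Delta(a)(d\otimes\mathrm{id})\Delta(b)$. Let $\gamma:\mathcal A\otimes\mathcal A\to\mathbb C$ be a convolution-invertible map (with convolution inverse $\bar\gamma$) such that $\gamma(1\otimes a)=\epsilon(a)=\gamma(a\otimes 1)$ and $$\gamma(a_{(1)}\otimes b_{(1)})\,\gamma(a_{(2)}b_{(2)}\otimes c)=\gamma(b_{(1)}\otimes c_{(1)})\,\gamma(a\otimes b_{(2)}c_{(2)})$$ (for instance $\gamma(a\otimes b)=\Omega(a\otimes b)$ for a normalised dual $2$-cocycle $\Omega\in\widehat{\mathcal A}\otimes\widehat{\mathcal A}$). Let $\mathcal A_\Omega$ be $\mathcal A$ with the same coalgebra structure and the product $a*b=\gamma(a_{(1)}\otimes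 b_{(1)})\,a_{(2)}b_{(2)}\,\bar\gamma(a_{(3)}\otimes b_{(3)})$, and let $(\mathcal E_\Omega,d_\Omega)$ be the bicovariant differential calculus over $\mathcal A_\Omega$ with the same space, coactions and differential as $(\mathcal E,d)$ and with the actions $$a*e=\gamma(a_{(1)}\otimes e_{(-1)})\,a_{(2)}e_{(0)}\,\bar\gamma(a_{(3)}\otimes e_{(1)}),\qquad e*a=\gamma(e_{(-1)}\otimes a_{(1)})\,e_{(0)}a_{(2)}\,\bar\gamma(e_{(1)}\otimes a_{(3)}).$$ Write $B=\mathcal A_\Omega$ and $F=\mathcal E_\Omega$, let $F\otimes_B F$ carry the codiagonal coactions, and let ${}_0F$ be the space of left-invariant elements of $F$; ${}_0F\otimes_{\mathbb C}{}_0F$ is identified with the space of left-invariant elements of $F\otimes_B F$. Let $\sigma:F\otimes_BF\to F\otimes_BF$ be the canonical braiding, i.e. the unique bimodule map with $\sigma(\omega\otimes\eta)=\eta\otimes\omega$ for $\omega$ left-invariant and $\eta$ right-invariant, let ${}_0\sigma$ be its restriction to ${}_0F\otimes_{\mathbb C}{}_0F$, and let ${}_0P_{\mathrm{sym}}$ be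 the idempotent on ${}_0F\otimes_{\mathbb C}{}_0F$ with range $\mathrm{Ker}({}_0\sigma-1)$ and kernel the sum of the eigenspaces of ${}_0\sigma$ for the eigenvalues different from $1$. Let $g'$ be a left $B$-linear bi-invariant pseudo-Riemannian metric on $F$: a left $B$-linear map $g':F\otimes_BF\to B$ with $g'\circ\sigma=g'$, such that $f=0$ whenever $g'(e\otimes f)=0$ for all $e\in F$, and such that $(\mathrm{id}\otimes\epsilon g')\circ\Delta_{F\otimes_B F}=g'$ for the left coaction and $(\epsilon g'\otimes\mathrm{id})\circ{}_{F\otimes_B F}\Delta=g'$ for the right coaction of $F\otimes_BF$. Let $\nabla'$ be a bicovariant left connection on $F$: a $\mathbb C$-linear map $\nabla':F\to F\otimes_BF$ that commutes with both coactions and satisfies $\nabla'(ae)=a\nabla'(e)+da\otimes e$. It restricts to a map ${}_0F\to{}_0F\otimes_{\mathbb C}{}_0F$. Put $$\Pi^0=2\,(g'\otimes\mathrm{id})(\mathrm{id}\otimes\sigma)(\mathrm{id}\otimes\nabla')\,{}_0P_{\mathrm{sym}}\quad\text{on }{}_0F\otimes_{\mathbb C}{}_0F,$$ and let $\Pi:F\otimes_BF\to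 F$ be the map determined by $\Pi(a\,\omega_1\otimes\omega_2)=a\,\Pi^0(\omega_1\otimes\omega_2)+(da)\,g'(\omega_1\otimes\omega_2)$ for $a\in B$ and $\omega_1,\omega_2\in{}_0F$. Then $\nabla'$ is compatible with $g'$ in the sense that $$\Pi(x)=d(g'(x))\quad\text{for all }x\in F\otimes_BF$$ if and only if $\nabla'$ is compatible with $g'$ in the sense of Heckenberger and Schmüdgen, i.e. $$(\mathrm{id}\otimes g')(\nabla'\otimes\mathrm{id})+(g'\otimes\mathrm{id})(\mathrm{id}\otimes\sigma)(\mathrm{id}\otimes\nabla')=0\quad\text{on }{}_0F\otimes_{\mathbb C}{}_0F.$$ -/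

import Mathlib

namespace BicovCalc

open scoped TensorProduct
open Coalgebra TensorProduct

noncomputable section

universe u v w

variable {k : Type u} [CommRing k]

/-- A bicomodule over a coalgebra `C`: commuting left and right coactions `V → C ⊗ V` and
`V → V ⊗ C`, each of them coassociative and counital. -/
structure Bicomodule (k : Type u) [CommRing k] (C : Type v) [AddCommGroup C] [Module k C]
    [Coalgebra k C] (V : Type w) [AddCommGroup V] [Module k V] where
  coactL : V →ₗ[k] C ⊗[k] V
  coactR : V →ₗ[k] V ⊗[k] C
  coassocL : ∀ v, TensorProduct.assoc k C C V ((comul (R := k)).rTensor V (coactL v)) =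
    coactL.lTensor C (coactL v)
  counitL : ∀ v, TensorProduct.lid k V ((counit (R := k)).rTensor V (coactL v)) = v
  coassocR : ∀ v, TensorProduct.assoc k V C C (coactR.rTensor C (coactR v)) =
    (comul (R := k)).lTensor V (coactR v)
  counitR : ∀ v, TensorProduct.rid k V ((counit (R := k)).lTensor V (coactR v)) = v
  coact_comm : ∀ v, TensorProduct.assoc k C V C (coactL.rTensor C (coactR v)) =
    coactR.lTensor C (coactL v)

namespace Bicomodule

variable {C : Type*} [AddCommGroup C] [Module k C] [Coalgebra k C]
  {D : Type*} [AddCommGroup D] [Module k D] [Coalgebra k D]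
  {V : Type*} [AddCommGroup V] [Module k V] {W : Type*} [AddCommGroup W] [Module k W]
  {U : Type*} [AddCommGroup U] [Module k U]

/-- `T` commutes with the left coactions. -/
def IsLeftCovariant (M : Bicomodule k C V) (N : Bicomodule k C W) (T : V →ₗ[k] W) : Prop :=
  ∀ v, T.lTensor C (M.coactL v) = N.coactL (T v)

/-- `T` commutes with the right coactions. -/
def IsRightCovariant (M : Bicomodule k C V) (N : Bicomodule k C W) (T : V →ₗ[k] W) : Prop :=
  ∀ v, T.rTensor C (M.coactR v) = N.coactR (T v)

/-- `T` commutes with both coactions. -/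
def IsBicovariant (M : Bicomodule k C V) (N : Bicomodule k C W) (T : V →ₗ[k] W) : Prop :=
  M.IsLeftCovariant N T ∧ M.IsRightCovariant N T

/-- The coalgebra, as a bicomodule over itself. -/
def regular (k : Type*) [CommRing k] (C : Type*) [AddCommGroup C] [Module k C]
    [Coalgebra k C] : Bicomodule k C C where
  coactL := comul
  coactR := comul
  coassocL := coassoc_apply
  counitL v := by simp
  coassocR := coassoc_apply
  counitR v := by simp
  coact_comm := coassoc_apply

theorem lin_ext {X Y Z : Type*} [AddCommGroup X] [AddCommGroup Y] [AddCommGroup Z] [Module k X]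
    [Module k Y] [Module k Z] (f g : X ⊗[k] Y →ₗ[k] Z) (t : X ⊗[k] Y)
    (h : ∀ x y, f (x ⊗ₜ y) = g (x ⊗ₜ y)) : f t = g t :=
  LinearMap.congr_fun (TensorProduct.ext' h) t

theorem lin_ext4 {X Y Z T S : Type*} [AddCommGroup X] [AddCommGroup Y] [AddCommGroup Z]
    [AddCommGroup T] [AddCommGroup S] [Module k X] [Module k Y] [Module k Z] [Module k T]
    [Module k S] (f g : X ⊗[k] Y ⊗[k] (Z ⊗[k] T) →ₗ[k] S) (a : X ⊗[k] Y) (b : Z ⊗[k] T)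
    (h : ∀ x y z t, f (x ⊗ₜ y ⊗ₜ (z ⊗ₜ t)) = g (x ⊗ₜ y ⊗ₜ (z ⊗ₜ t))) :
    f (a ⊗ₜ b) = g (a ⊗ₜ b) :=
  LinearMap.congr_fun (TensorProduct.ext_fourfold' h) _

/-- The bicomodule over `D` obtained by applying a coalgebra map `C → D`. -/
def push (M : Bicomodule k C V) (f : C →ₗc[k] D) : Bicomodule k D V where
  coactL := f.toLinearMap.rTensor V ∘ₗ M.coactL
  coactR := f.toLinearMap.lTensor V ∘ₗ M.coactR
  coassocL v := by
    let Φ := TensorProduct.map f.toLinearMap (f.toLinearMap.rTensor V)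
    refine (lin_ext ((TensorProduct.assoc k D D V).toLinearMap ∘ₗ (comul (R := k)).rTensor V ∘ₗ
      f.toLinearMap.rTensor V) (Φ ∘ₗ (TensorProduct.assoc k C C V).toLinearMap ∘ₗ
        (comul (R := k)).rTensor V) (M.coactL v) fun c v => ?_).trans
      ((congrArg Φ (M.coassocL v)).trans (lin_ext (Φ ∘ₗ M.coactL.lTensor C)
        ((f.toLinearMap.rTensor V ∘ₗ M.coactL).lTensor D ∘ₗ f.toLinearMap.rTensor V)
          (M.coactL v) fun c v => rfl))
    exact (congrArg (fun z => TensorProduct.assoc k D D V (z ⊗ₜ v))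
      (LinearMap.congr_fun f.map_comp_comul c)).symm.trans
        (lin_ext ((TensorProduct.assoc k D D V).toLinearMap ∘ₗ (TensorProduct.mk k _ V).flip v ∘ₗ
          TensorProduct.map f.toLinearMap f.toLinearMap) (Φ ∘ₗ
            (TensorProduct.assoc k C C V).toLinearMap ∘ₗ (TensorProduct.mk k _ V).flip v)
          (comul c) fun a b => rfl)
  counitL v := by
    conv_rhs => rw [← M.counitL v]
    rw [LinearMap.comp_apply, ← LinearMap.rTensor_comp_apply]
    congr 2
    rw [f.counit_comp]
  coassocR v := by
    let Φ := (TensorProduct.map f.toLinearMap f.toLinearMap).lTensor V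
    refine Eq.trans ?_ ((congrArg Φ (M.coassocR v)).trans (lin_ext (Φ ∘ₗ (comul (R := k)).lTensor V)
      ((comul (R := k)).lTensor V ∘ₗ f.toLinearMap.lTensor V) (M.coactR v) fun v c => ?_))
    · exact lin_ext ((TensorProduct.assoc k V D D).toLinearMap ∘ₗ
        (f.toLinearMap.lTensor V ∘ₗ M.coactR).rTensor D ∘ₗ f.toLinearMap.lTensor V) (Φ ∘ₗ
          (TensorProduct.assoc k V C C).toLinearMap ∘ₗ M.coactR.rTensor C) (M.coactR v)
        fun v c => lin_ext ((TensorProduct.assoc k V D D).toLinearMap ∘ₗ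
          (TensorProduct.mk k _ D).flip (f c) ∘ₗ f.toLinearMap.lTensor V) (Φ ∘ₗ
            (TensorProduct.assoc k V C C).toLinearMap ∘ₗ (TensorProduct.mk k _ C).flip c)
          (M.coactR v) fun a b => rfl
    · exact congrArg (fun z => v ⊗ₜ z) (LinearMap.congr_fun f.map_comp_comul c)
  counitR v := by
    conv_rhs => rw [← M.counitR v]
    rw [LinearMap.comp_apply, ← LinearMap.lTensor_comp_apply]
    congr 2
    rw [f.counit_comp]
  coact_comm v := by
    let Φ := TensorProduct.map f.toLinearMap (f.toLinearMap.lTensor V)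
    refine Eq.trans ?_ ((congrArg Φ (M.coact_comm v)).trans (lin_ext (Φ ∘ₗ M.coactR.lTensor C)
      ((f.toLinearMap.lTensor V ∘ₗ M.coactR).lTensor D ∘ₗ f.toLinearMap.rTensor V)
        (M.coactL v) fun c v => rfl))
    exact lin_ext ((TensorProduct.assoc k D V D).toLinearMap ∘ₗ
        (f.toLinearMap.rTensor V ∘ₗ M.coactL).rTensor D ∘ₗ f.toLinearMap.lTensor V) (Φ ∘ₗ
          (TensorProduct.assoc k C V C).toLinearMap ∘ₗ M.coactL.rTensor C) (M.coactR v)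
        fun v c => lin_ext ((TensorProduct.assoc k D V D).toLinearMap ∘ₗ
          (TensorProduct.mk k _ D).flip (f c) ∘ₗ f.toLinearMap.rTensor V) (Φ ∘ₗ
            (TensorProduct.assoc k C V C).toLinearMap ∘ₗ (TensorProduct.mk k _ C).flip c)
          (M.coactL v) fun a b => rfl

/-- The canonical map `(X ⊗ Y) ⊗ (Z ⊗ T) → (X ⊗ Z) ⊗ (Y ⊗ T)`. -/
abbrev swap (k X Y Z T : Type*) [CommRing k] [AddCommGroup X] [AddCommGroup Y] [AddCommGroup Z]
    [AddCommGroup T] [Module k X] [Module k Y] [Module k Z] [Module k T] :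
    X ⊗[k] Y ⊗[k] (Z ⊗[k] T) →ₗ[k] X ⊗[k] Z ⊗[k] (Y ⊗[k] T) :=
  (tensorTensorTensorComm k X Y Z T).toLinearMap

/-- The tensor product over `k` of a bicomodule over `C` and one over `D`, as a bicomodule over
`C ⊗ D`. -/
def tensor (M : Bicomodule k C V) (N : Bicomodule k D W) :
    Bicomodule k (C ⊗[k] D) (V ⊗[k] W) where
  coactL := swap k C V D W ∘ₗ TensorProduct.map M.coactL N.coactL
  coactR := swap k V C W D ∘ₗ TensorProduct.map M.coactR N.coactR
  coassocL v := by
    let Φ := (swap k C V D W).lTensor (C ⊗[k] D) ∘ₗ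
      swap k C (C ⊗[k] V) D (D ⊗[k] W)
    refine lin_ext ((TensorProduct.assoc k _ _ _).toLinearMap ∘ₗ (comul (R := k)).rTensor _ ∘ₗ
      swap k C V D W ∘ₗ TensorProduct.map M.coactL N.coactL)
      ((swap k C V D W ∘ₗ TensorProduct.map M.coactL N.coactL).lTensor _ ∘ₗ
        swap k C V D W ∘ₗ TensorProduct.map M.coactL N.coactL) v fun m n => ?_
    refine (lin_ext4 ((TensorProduct.assoc k _ _ _).toLinearMap ∘ₗ (comul (R := k)).rTensor _ ∘ₗ
      swap k C V D W) (Φ ∘ₗ TensorProduct.map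
        ((TensorProduct.assoc k C C V).toLinearMap ∘ₗ (comul (R := k)).rTensor V)
        ((TensorProduct.assoc k D D W).toLinearMap ∘ₗ (comul (R := k)).rTensor W))
      (M.coactL m) (N.coactL n) fun c v d w => ?_).trans
      ((congrArg Φ (congrArg₂ (· ⊗ₜ ·) (M.coassocL m) (N.coassocL n))).trans
        (lin_ext4 (Φ ∘ₗ TensorProduct.map (M.coactL.lTensor C) (N.coactL.lTensor D))
          ((swap k C V D W ∘ₗ TensorProduct.map M.coactL N.coactL).lTensor _ ∘ₗ
            swap k C V D W)
          (M.coactL m) (N.coactL n) fun c v d w => rfl))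
    exact lin_ext4 ((TensorProduct.assoc k _ _ _).toLinearMap ∘ₗ
      (TensorProduct.mk k _ _).flip (v ⊗ₜ w) ∘ₗ swap k C C D D)
      (Φ ∘ₗ TensorProduct.map
        ((TensorProduct.assoc k C C V).toLinearMap ∘ₗ (TensorProduct.mk k _ _).flip v)
        ((TensorProduct.assoc k D D W).toLinearMap ∘ₗ (TensorProduct.mk k _ _).flip w))
      (comul c) (comul d) fun a b a' b' => rfl
  counitL v := by
    refine lin_ext ((TensorProduct.lid k _).toLinearMap ∘ₗ (counit (R := k)).rTensor _ ∘ₗ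
      swap k C V D W ∘ₗ TensorProduct.map M.coactL N.coactL)
      LinearMap.id v fun m n => ?_
    refine (lin_ext4 ((TensorProduct.lid k _).toLinearMap ∘ₗ (counit (R := k)).rTensor _ ∘ₗ
      swap k C V D W) (TensorProduct.map
        ((TensorProduct.lid k V).toLinearMap ∘ₗ (counit (R := k)).rTensor V)
        ((TensorProduct.lid k W).toLinearMap ∘ₗ (counit (R := k)).rTensor W))
      (M.coactL m) (N.coactL n) fun c v d w => ?_).trans
      (congrArg₂ (· ⊗ₜ ·) (M.counitL m) (N.counitL n))
    simp [TensorProduct.smul_tmul', smul_smul]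
  coassocR v := by
    let Φ := (swap k C C D D).lTensor (V ⊗[k] W) ∘ₗ
      swap k V (C ⊗[k] C) W (D ⊗[k] D)
    refine lin_ext ((TensorProduct.assoc k _ _ _).toLinearMap ∘ₗ
      (swap k V C W D ∘ₗ TensorProduct.map M.coactR N.coactR).rTensor _ ∘ₗ
      swap k V C W D ∘ₗ TensorProduct.map M.coactR N.coactR)
      ((comul (R := k)).lTensor _ ∘ₗ
        swap k V C W D ∘ₗ TensorProduct.map M.coactR N.coactR) v fun m n => ?_
    refine (lin_ext4 ((TensorProduct.assoc k _ _ _).toLinearMap ∘ₗ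
      (swap k V C W D ∘ₗ TensorProduct.map M.coactR N.coactR).rTensor _ ∘ₗ
      swap k V C W D) (Φ ∘ₗ TensorProduct.map
        ((TensorProduct.assoc k V C C).toLinearMap ∘ₗ M.coactR.rTensor C)
        ((TensorProduct.assoc k W D D).toLinearMap ∘ₗ N.coactR.rTensor D))
      (M.coactR m) (N.coactR n) fun v c w d => ?_).trans
      ((congrArg Φ (congrArg₂ (· ⊗ₜ ·) (M.coassocR m) (N.coassocR n))).trans
        (lin_ext4 (Φ ∘ₗ TensorProduct.map ((comul (R := k)).lTensor V) ((comul (R := k)).lTensor W))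
          ((comul (R := k)).lTensor _ ∘ₗ swap k V C W D)
          (M.coactR m) (N.coactR n) fun v c w d => rfl))
    exact lin_ext4 ((TensorProduct.assoc k _ _ _).toLinearMap ∘ₗ
      (TensorProduct.mk k _ _).flip (c ⊗ₜ d) ∘ₗ swap k V C W D)
      (Φ ∘ₗ TensorProduct.map
        ((TensorProduct.assoc k V C C).toLinearMap ∘ₗ (TensorProduct.mk k _ _).flip c)
        ((TensorProduct.assoc k W D D).toLinearMap ∘ₗ (TensorProduct.mk k _ _).flip d))
      (M.coactR v) (N.coactR w) fun a b a' b' => rfl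
  counitR v := by
    refine lin_ext ((TensorProduct.rid k _).toLinearMap ∘ₗ (counit (R := k)).lTensor _ ∘ₗ
      swap k V C W D ∘ₗ TensorProduct.map M.coactR N.coactR)
      LinearMap.id v fun m n => ?_
    refine (lin_ext4 ((TensorProduct.rid k _).toLinearMap ∘ₗ (counit (R := k)).lTensor _ ∘ₗ
      swap k V C W D) (TensorProduct.map
        ((TensorProduct.rid k V).toLinearMap ∘ₗ (counit (R := k)).lTensor V)
        ((TensorProduct.rid k W).toLinearMap ∘ₗ (counit (R := k)).lTensor W))
      (M.coactR m) (N.coactR n) fun c v d w => ?_).trans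
      (congrArg₂ (· ⊗ₜ ·) (M.counitR m) (N.counitR n))
    simp [TensorProduct.smul_tmul', smul_smul]
  coact_comm v := by
    let Φ := (swap k V C W D).lTensor (C ⊗[k] D) ∘ₗ
      swap k C (V ⊗[k] C) D (W ⊗[k] D)
    refine lin_ext ((TensorProduct.assoc k _ _ _).toLinearMap ∘ₗ
      (swap k C V D W ∘ₗ TensorProduct.map M.coactL N.coactL).rTensor _ ∘ₗ
      swap k V C W D ∘ₗ TensorProduct.map M.coactR N.coactR)
      ((swap k V C W D ∘ₗ TensorProduct.map M.coactR N.coactR).lTensor _ ∘ₗ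
        swap k C V D W ∘ₗ TensorProduct.map M.coactL N.coactL) v fun m n => ?_
    refine (lin_ext4 ((TensorProduct.assoc k _ _ _).toLinearMap ∘ₗ
      (swap k C V D W ∘ₗ TensorProduct.map M.coactL N.coactL).rTensor _ ∘ₗ
      swap k V C W D) (Φ ∘ₗ TensorProduct.map
        ((TensorProduct.assoc k C V C).toLinearMap ∘ₗ M.coactL.rTensor C)
        ((TensorProduct.assoc k D W D).toLinearMap ∘ₗ N.coactL.rTensor D))
      (M.coactR m) (N.coactR n) fun v c w d => ?_).trans
      ((congrArg Φ (congrArg₂ (· ⊗ₜ ·) (M.coact_comm m) (N.coact_comm n))).trans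
        (lin_ext4 (Φ ∘ₗ TensorProduct.map (M.coactR.lTensor C) (N.coactR.lTensor D))
          ((swap k V C W D ∘ₗ TensorProduct.map M.coactR N.coactR).lTensor _ ∘ₗ
            swap k C V D W)
          (M.coactL m) (N.coactL n) fun v c w d => rfl))
    exact lin_ext4 ((TensorProduct.assoc k _ _ _).toLinearMap ∘ₗ
      (TensorProduct.mk k _ _).flip (c ⊗ₜ d) ∘ₗ swap k C V D W)
      (Φ ∘ₗ TensorProduct.map
        ((TensorProduct.assoc k C V C).toLinearMap ∘ₗ (TensorProduct.mk k _ _).flip c)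
        ((TensorProduct.assoc k D W D).toLinearMap ∘ₗ (TensorProduct.mk k _ _).flip d))
      (M.coactL v) (N.coactL w) fun a b a' b' => rfl


/-- A surjective bicovariant map transports the bicomodule axioms. -/
def ofSurjective (M : Bicomodule k C V) (p : V →ₗ[k] W) (hp : Function.Surjective p)
    (cL : W →ₗ[k] C ⊗[k] W) (cR : W →ₗ[k] W ⊗[k] C)
    (hL : ∀ v, cL (p v) = p.lTensor C (M.coactL v))
    (hR : ∀ v, cR (p v) = p.rTensor C (M.coactR v)) : Bicomodule k C W where
  coactL := cL
  coactR := cR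
  coassocL w := by
    obtain ⟨v, rfl⟩ := hp w
    have h := congrArg ((p.lTensor C).lTensor C) (M.coassocL v)
    rw [hL]
    refine (lin_ext ((TensorProduct.assoc k C C W).toLinearMap ∘ₗ (comul (R := k)).rTensor W ∘ₗ
      p.lTensor C) ((p.lTensor C).lTensor C ∘ₗ (TensorProduct.assoc k C C V).toLinearMap ∘ₗ
        (comul (R := k)).rTensor V) (M.coactL v) fun c v => ?_).trans (h.trans ?_)
    · exact lin_ext ((TensorProduct.assoc k C C W).toLinearMap ∘ₗ
        (TensorProduct.mk k _ _).flip (p v)) ((p.lTensor C).lTensor C ∘ₗ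
        (TensorProduct.assoc k C C V).toLinearMap ∘ₗ (TensorProduct.mk k _ _).flip v)
        (comul c) fun a b => rfl
    · exact lin_ext ((p.lTensor C).lTensor C ∘ₗ M.coactL.lTensor C) (cL.lTensor C ∘ₗ p.lTensor C)
        (M.coactL v) fun c v => congrArg (c ⊗ₜ ·) (hL v).symm
  counitL w := by
    obtain ⟨v, rfl⟩ := hp w
    rw [hL]
    exact (lin_ext ((TensorProduct.lid k W).toLinearMap ∘ₗ (counit (R := k)).rTensor W ∘ₗ
      p.lTensor C) (p ∘ₗ (TensorProduct.lid k V).toLinearMap ∘ₗ (counit (R := k)).rTensor V)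
      (M.coactL v) fun c v => by simp).trans (congrArg p (M.counitL v))
  coassocR w := by
    obtain ⟨v, rfl⟩ := hp w
    have h := congrArg (p.rTensor (C ⊗[k] C)) (M.coassocR v)
    rw [hR]
    refine (lin_ext ((TensorProduct.assoc k W C C).toLinearMap ∘ₗ cR.rTensor C ∘ₗ
      p.rTensor C) (p.rTensor (C ⊗[k] C) ∘ₗ (TensorProduct.assoc k V C C).toLinearMap ∘ₗ
        M.coactR.rTensor C) (M.coactR v) fun v c => ?_).trans (h.trans ?_)
    · refine (congrArg (fun z => TensorProduct.assoc k W C C (z ⊗ₜ c)) (hR v)).trans ?_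
      exact lin_ext ((TensorProduct.assoc k W C C).toLinearMap ∘ₗ
        (TensorProduct.mk k _ _).flip c ∘ₗ p.rTensor C) (p.rTensor (C ⊗[k] C) ∘ₗ
        (TensorProduct.assoc k V C C).toLinearMap ∘ₗ (TensorProduct.mk k _ _).flip c)
        (M.coactR v) fun a b => rfl
    · exact lin_ext (p.rTensor (C ⊗[k] C) ∘ₗ (comul (R := k)).lTensor V)
        ((comul (R := k)).lTensor W ∘ₗ p.rTensor C) (M.coactR v) fun v c => rfl
  counitR w := by
    obtain ⟨v, rfl⟩ := hp w
    rw [hR]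
    exact (lin_ext ((TensorProduct.rid k W).toLinearMap ∘ₗ (counit (R := k)).lTensor W ∘ₗ
      p.rTensor C) (p ∘ₗ (TensorProduct.rid k V).toLinearMap ∘ₗ (counit (R := k)).lTensor V)
      (M.coactR v) fun c v => by simp).trans (congrArg p (M.counitR v))
  coact_comm w := by
    obtain ⟨v, rfl⟩ := hp w
    have h := congrArg ((p.rTensor C).lTensor C) (M.coact_comm v)
    rw [hR, hL]
    refine (lin_ext ((TensorProduct.assoc k C W C).toLinearMap ∘ₗ cL.rTensor C ∘ₗ
      p.rTensor C) ((p.rTensor C).lTensor C ∘ₗ (TensorProduct.assoc k C V C).toLinearMap ∘ₗ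
        M.coactL.rTensor C) (M.coactR v) fun v c => ?_).trans (h.trans ?_)
    · refine (congrArg (fun z => TensorProduct.assoc k C W C (z ⊗ₜ c)) (hL v)).trans ?_
      exact lin_ext ((TensorProduct.assoc k C W C).toLinearMap ∘ₗ
        (TensorProduct.mk k _ _).flip c ∘ₗ p.lTensor C) ((p.rTensor C).lTensor C ∘ₗ
        (TensorProduct.assoc k C V C).toLinearMap ∘ₗ (TensorProduct.mk k _ _).flip c)
        (M.coactL v) fun a b => rfl
    · exact lin_ext ((p.rTensor C).lTensor C ∘ₗ M.coactR.lTensor C) (cR.lTensor C ∘ₗ p.lTensor C)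
        (M.coactL v) fun c v => congrArg (c ⊗ₜ ·) (hR v).symm

/-- The operator `v ↦ φ(v₍₋₁₎) v₍₀₎`. -/
def actL (M : Bicomodule k C V) (φ : WithConv (C →ₗ[k] k)) : V →ₗ[k] V :=
  (TensorProduct.lid k V).toLinearMap ∘ₗ φ.ofConv.rTensor V ∘ₗ M.coactL

/-- The operator `v ↦ v₍₀₎ φ(v₍₁₎)`. -/
def actR (M : Bicomodule k C V) (φ : WithConv (C →ₗ[k] k)) : V →ₗ[k] V :=
  (TensorProduct.rid k V).toLinearMap ∘ₗ φ.ofConv.lTensor V ∘ₗ M.coactR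

theorem actL_one (M : Bicomodule k C V) : M.actL 1 = LinearMap.id :=
  LinearMap.ext fun v => M.counitL v

theorem actR_one (M : Bicomodule k C V) : M.actR 1 = LinearMap.id :=
  LinearMap.ext fun v => M.counitR v

theorem coactL_actL (M : Bicomodule k C V) (φ : WithConv (C →ₗ[k] k)) (v : V) :
    M.coactL (M.actL φ v) = ((regular k C).actL φ).rTensor V (M.coactL v) := by
  have h := congrArg ((TensorProduct.lid k (C ⊗[k] V)).toLinearMap ∘ₗ φ.ofConv.rTensor (C ⊗[k] V))
    (M.coassocL v)
  refine Eq.trans ?_ (h.symm.trans ?_)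
  · exact lin_ext (M.coactL ∘ₗ (TensorProduct.lid k V).toLinearMap ∘ₗ φ.ofConv.rTensor V)
      ((TensorProduct.lid k (C ⊗[k] V)).toLinearMap ∘ₗ φ.ofConv.rTensor (C ⊗[k] V) ∘ₗ
        M.coactL.lTensor C) (M.coactL v) fun c v => by simp
  · refine lin_ext ((TensorProduct.lid k (C ⊗[k] V)).toLinearMap ∘ₗ φ.ofConv.rTensor (C ⊗[k] V) ∘ₗ
      (TensorProduct.assoc k C C V).toLinearMap ∘ₗ (comul (R := k)).rTensor V)
      (((regular k C).actL φ).rTensor V) (M.coactL v) fun c v => ?_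
    exact lin_ext ((TensorProduct.lid k (C ⊗[k] V)).toLinearMap ∘ₗ
      φ.ofConv.rTensor (C ⊗[k] V) ∘ₗ (TensorProduct.assoc k C C V).toLinearMap ∘ₗ
      (TensorProduct.mk k _ _).flip v) ((TensorProduct.mk k _ _).flip v ∘ₗ
        (TensorProduct.lid k C).toLinearMap ∘ₗ φ.ofConv.rTensor C) (comul c)
      fun a b => by simp [TensorProduct.smul_tmul']

theorem regular_actR_coactL (M : Bicomodule k C V) (φ : WithConv (C →ₗ[k] k)) (v : V) :
    ((regular k C).actR φ).rTensor V (M.coactL v) = (M.actL φ).lTensor C (M.coactL v) := by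
  let Φ := (((TensorProduct.lid k V).toLinearMap ∘ₗ φ.ofConv.rTensor V)).lTensor C
  refine Eq.trans ?_ ((congrArg Φ (M.coassocL v)).trans ?_)
  · refine lin_ext (((regular k C).actR φ).rTensor V) (Φ ∘ₗ
      (TensorProduct.assoc k C C V).toLinearMap ∘ₗ (comul (R := k)).rTensor V)
      (M.coactL v) fun c v => ?_
    exact lin_ext ((TensorProduct.mk k _ _).flip v ∘ₗ
        (TensorProduct.rid k C).toLinearMap ∘ₗ φ.ofConv.lTensor C)
      (Φ ∘ₗ (TensorProduct.assoc k C C V).toLinearMap ∘ₗ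
      (TensorProduct.mk k _ _).flip v) (comul c)
      fun a b => by simp [Φ, TensorProduct.smul_tmul']
  · exact lin_ext (Φ ∘ₗ M.coactL.lTensor C) ((M.actL φ).lTensor C) (M.coactL v) fun c v => rfl

theorem coactL_actR (M : Bicomodule k C V) (φ : WithConv (C →ₗ[k] k)) (v : V) :
    M.coactL (M.actR φ v) = (M.actR φ).lTensor C (M.coactL v) := by
  let Φ := ((TensorProduct.rid k V).toLinearMap ∘ₗ φ.ofConv.lTensor V).lTensor C
  refine Eq.trans ?_ ((congrArg Φ (M.coact_comm v)).trans ?_)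
  · refine lin_ext (M.coactL ∘ₗ (TensorProduct.rid k V).toLinearMap ∘ₗ φ.ofConv.lTensor V)
      (Φ ∘ₗ (TensorProduct.assoc k C V C).toLinearMap ∘ₗ M.coactL.rTensor C)
      (M.coactR v) fun v c => ?_
    refine Eq.trans (M.coactL.map_smul (φ c) v) ?_
    exact lin_ext (φ c • LinearMap.id) (Φ ∘ₗ (TensorProduct.assoc k C V C).toLinearMap ∘ₗ
      (TensorProduct.mk k _ _).flip c) (M.coactL v) fun a b => by simp [Φ]
  · exact lin_ext (Φ ∘ₗ M.coactR.lTensor C) ((M.actR φ).lTensor C) (M.coactL v) fun c v => rfl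

theorem coactR_actR (M : Bicomodule k C V) (φ : WithConv (C →ₗ[k] k)) (v : V) :
    M.coactR (M.actR φ v) = ((regular k C).actR φ).lTensor V (M.coactR v) := by
  let Φ := ((TensorProduct.rid k C).toLinearMap ∘ₗ φ.ofConv.lTensor C).lTensor V
  refine Eq.trans ?_ ((congrArg Φ (M.coassocR v)).trans ?_)
  · refine lin_ext (M.coactR ∘ₗ (TensorProduct.rid k V).toLinearMap ∘ₗ φ.ofConv.lTensor V)
      (Φ ∘ₗ (TensorProduct.assoc k V C C).toLinearMap ∘ₗ M.coactR.rTensor C)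
      (M.coactR v) fun v c => ?_
    refine Eq.trans (M.coactR.map_smul (φ c) v) ?_
    exact lin_ext (φ c • LinearMap.id) (Φ ∘ₗ (TensorProduct.assoc k V C C).toLinearMap ∘ₗ
      (TensorProduct.mk k _ _).flip c) (M.coactR v) fun a b => by simp [Φ]
  · exact lin_ext (Φ ∘ₗ (comul (R := k)).lTensor V) (((regular k C).actR φ).lTensor V)
      (M.coactR v) fun c v => rfl

theorem regular_actL_coactR (M : Bicomodule k C V) (φ : WithConv (C →ₗ[k] k)) (v : V) :
    ((regular k C).actL φ).lTensor V (M.coactR v) = (M.actR φ).rTensor C (M.coactR v) := by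
  let Φ := ((TensorProduct.lid k C).toLinearMap ∘ₗ φ.ofConv.rTensor C).lTensor V
  refine Eq.trans ?_ ((congrArg Φ (M.coassocR v)).symm.trans ?_)
  · exact lin_ext (((regular k C).actL φ).lTensor V) (Φ ∘ₗ (comul (R := k)).lTensor V)
      (M.coactR v) fun c v => rfl
  · refine lin_ext (Φ ∘ₗ (TensorProduct.assoc k V C C).toLinearMap ∘ₗ M.coactR.rTensor C)
      ((M.actR φ).rTensor C) (M.coactR v) fun v c => ?_
    exact lin_ext (Φ ∘ₗ (TensorProduct.assoc k V C C).toLinearMap ∘ₗ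
      (TensorProduct.mk k _ _).flip c) ((TensorProduct.mk k _ _).flip c ∘ₗ
        (TensorProduct.rid k V).toLinearMap ∘ₗ φ.ofConv.lTensor V) (M.coactR v)
      fun a b => by simp [Φ, TensorProduct.smul_tmul']

theorem coactR_actL (M : Bicomodule k C V) (φ : WithConv (C →ₗ[k] k)) (v : V) :
    M.coactR (M.actL φ v) = (M.actL φ).rTensor C (M.coactR v) := by
  let Φ := (TensorProduct.lid k (V ⊗[k] C)).toLinearMap ∘ₗ φ.ofConv.rTensor (V ⊗[k] C)
  refine Eq.trans ?_ ((congrArg Φ (M.coact_comm v)).symm.trans ?_)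
  · exact lin_ext (M.coactR ∘ₗ (TensorProduct.lid k V).toLinearMap ∘ₗ φ.ofConv.rTensor V)
      (Φ ∘ₗ M.coactR.lTensor C) (M.coactL v) fun c v => by simp [Φ]
  · refine lin_ext (Φ ∘ₗ (TensorProduct.assoc k C V C).toLinearMap ∘ₗ M.coactL.rTensor C)
      ((M.actL φ).rTensor C) (M.coactR v) fun v c => ?_
    exact lin_ext (Φ ∘ₗ (TensorProduct.assoc k C V C).toLinearMap ∘ₗ
      (TensorProduct.mk k _ _).flip c) ((TensorProduct.mk k _ _).flip c ∘ₗ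
        (TensorProduct.lid k V).toLinearMap ∘ₗ φ.ofConv.rTensor V) (M.coactL v)
      fun a b => by simp [Φ, TensorProduct.smul_tmul']

theorem actL_actL (M : Bicomodule k C V) (φ ψ : WithConv (C →ₗ[k] k)) (v : V) :
    M.actL φ (M.actL ψ v) = M.actL (ψ * φ) v := by
  refine (congrArg ((TensorProduct.lid k V).toLinearMap ∘ₗ φ.ofConv.rTensor V)
    (M.coactL_actL ψ v)).trans ?_
  refine lin_ext ((TensorProduct.lid k V).toLinearMap ∘ₗ φ.ofConv.rTensor V ∘ₗ
    ((regular k C).actL ψ).rTensor V) ((TensorProduct.lid k V).toLinearMap ∘ₗ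
      (ψ * φ).ofConv.rTensor V) (M.coactL v) fun c v => ?_
  exact lin_ext ((LinearMap.toSpanSingleton k V v) ∘ₗ φ.ofConv ∘ₗ
    (TensorProduct.lid k C).toLinearMap ∘ₗ ψ.ofConv.rTensor C)
    ((LinearMap.toSpanSingleton k V v) ∘ₗ LinearMap.mul' k k ∘ₗ
      TensorProduct.map ψ.ofConv φ.ofConv) (comul c) fun a b => by simp

theorem actR_actR (M : Bicomodule k C V) (φ ψ : WithConv (C →ₗ[k] k)) (v : V) :
    M.actR φ (M.actR ψ v) = M.actR (φ * ψ) v := by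
  refine (congrArg ((TensorProduct.rid k V).toLinearMap ∘ₗ φ.ofConv.lTensor V)
    (M.coactR_actR ψ v)).trans ?_
  refine lin_ext ((TensorProduct.rid k V).toLinearMap ∘ₗ φ.ofConv.lTensor V ∘ₗ
    ((regular k C).actR ψ).lTensor V) ((TensorProduct.rid k V).toLinearMap ∘ₗ
      (φ * ψ).ofConv.lTensor V) (M.coactR v) fun v c => ?_
  exact lin_ext ((LinearMap.toSpanSingleton k V v) ∘ₗ φ.ofConv ∘ₗ
    (TensorProduct.rid k C).toLinearMap ∘ₗ ψ.ofConv.lTensor C)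
    ((LinearMap.toSpanSingleton k V v) ∘ₗ LinearMap.mul' k k ∘ₗ
      TensorProduct.map φ.ofConv ψ.ofConv) (comul c) fun a b => by simp [mul_comm]

theorem IsLeftCovariant.actL {M : Bicomodule k C V} {N : Bicomodule k C W} {T : V →ₗ[k] W}
    (h : M.IsLeftCovariant N T) (φ : WithConv (C →ₗ[k] k)) (v : V) :
    N.actL φ (T v) = T (M.actL φ v) :=
  (congrArg ((TensorProduct.lid k W).toLinearMap ∘ₗ φ.ofConv.rTensor W) (h v)).symm.trans
    (lin_ext ((TensorProduct.lid k W).toLinearMap ∘ₗ φ.ofConv.rTensor W ∘ₗ T.lTensor C)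
      (T ∘ₗ (TensorProduct.lid k V).toLinearMap ∘ₗ φ.ofConv.rTensor V) (M.coactL v)
      fun a b => by simp)

theorem IsRightCovariant.actR {M : Bicomodule k C V} {N : Bicomodule k C W} {T : V →ₗ[k] W}
    (h : M.IsRightCovariant N T) (φ : WithConv (C →ₗ[k] k)) (v : V) :
    N.actR φ (T v) = T (M.actR φ v) :=
  (congrArg ((TensorProduct.rid k W).toLinearMap ∘ₗ φ.ofConv.lTensor W) (h v)).symm.trans
    (lin_ext ((TensorProduct.rid k W).toLinearMap ∘ₗ φ.ofConv.lTensor W ∘ₗ T.rTensor C)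
      (T ∘ₗ (TensorProduct.rid k V).toLinearMap ∘ₗ φ.ofConv.lTensor V) (M.coactR v)
      fun a b => by simp)

theorem actL_actR (M : Bicomodule k C V) (φ ψ : WithConv (C →ₗ[k] k)) (v : V) :
    M.actL φ (M.actR ψ v) = M.actR ψ (M.actL φ v) :=
  IsLeftCovariant.actL (M := M) (fun v => (M.coactL_actR ψ v).symm) φ v

/-- The operator `v ↦ u(v₍₋₁₎) v₍₀₎ u⁻¹(v₍₁₎)` attached to a convolution-invertible
functional `u`. -/
def twist (M : Bicomodule k C V) (u : (WithConv (C →ₗ[k] k))ˣ) : V →ₗ[k] V :=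
  M.actL u.val ∘ₗ M.actR u⁻¹.val

theorem twist_twist_inv (M : Bicomodule k C V) (u : (WithConv (C →ₗ[k] k))ˣ) (v : V) :
    M.twist u (M.twist u⁻¹ v) = v := by
  simp only [twist, LinearMap.comp_apply]
  rw [← actL_actR, actL_actL, actR_actR]
  simp [actL_one, actR_one]

theorem twist_mul (M : Bicomodule k C V) (u w : (WithConv (C →ₗ[k] k))ˣ) (v : V) :
    M.twist u (M.twist w v) = M.twist (w * u) v := by
  simp only [twist, LinearMap.comp_apply]
  rw [← actL_actR, actL_actL, actR_actR]
  simp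

theorem IsBicovariant.twist {M : Bicomodule k C V} {N : Bicomodule k C W} {T : V →ₗ[k] W}
    (h : M.IsBicovariant N T) (u : (WithConv (C →ₗ[k] k))ˣ) (v : V) :
    N.twist u (T v) = T (M.twist u v) := by
  simp only [Bicomodule.twist, LinearMap.comp_apply]
  rw [h.2.actR, h.1.actL]

theorem coactL_twist (M : Bicomodule k C V) (u : (WithConv (C →ₗ[k] k))ˣ) (v : V) :
    M.coactL (M.twist u v) =
      TensorProduct.map ((regular k C).twist u) (M.twist u) (M.coactL v) := by
  have h : TensorProduct.map ((regular k C).twist u) (M.twist u) =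
      ((regular k C).actL u.val).rTensor V ∘ₗ (M.actL u.val ∘ₗ M.actR u⁻¹.val).lTensor C ∘ₗ
        ((regular k C).actR u⁻¹.val).rTensor V := by
    refine TensorProduct.ext' fun a b => rfl
  have h2 : M.actL u.val ∘ₗ M.actR u⁻¹.val ∘ₗ M.actL u⁻¹.val = M.actR u⁻¹.val := by
    ext x
    simp only [LinearMap.comp_apply]
    rw [← actL_actR, actL_actL]
    simp [actL_one]
  rw [h, LinearMap.comp_apply, LinearMap.comp_apply, regular_actR_coactL,
    ← LinearMap.lTensor_comp_apply, LinearMap.comp_assoc, h2]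
  simp only [twist, LinearMap.comp_apply]
  rw [coactL_actL, coactL_actR]

theorem coactR_twist (M : Bicomodule k C V) (u : (WithConv (C →ₗ[k] k))ˣ) (v : V) :
    M.coactR (M.twist u v) =
      TensorProduct.map (M.twist u) ((regular k C).twist u) (M.coactR v) := by
  have hc : (regular k C).twist u = (regular k C).actR u⁻¹.val ∘ₗ (regular k C).actL u.val :=
    LinearMap.ext fun c => actL_actR _ _ _ c
  have h : TensorProduct.map (M.twist u) ((regular k C).twist u) =
      ((regular k C).actR u⁻¹.val).lTensor V ∘ₗ (M.actL u.val ∘ₗ M.actR u⁻¹.val).rTensor C ∘ₗ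
        ((regular k C).actL u.val).lTensor V := by
    rw [hc]
    refine TensorProduct.ext' fun a b => rfl
  have h2 : M.actL u.val ∘ₗ M.actR u⁻¹.val ∘ₗ M.actR u.val = M.actL u.val := by
    ext x
    simp only [LinearMap.comp_apply]
    rw [actR_actR]
    simp [actR_one]
  rw [h, LinearMap.comp_apply, LinearMap.comp_apply, regular_actL_coactR,
    ← LinearMap.rTensor_comp_apply, LinearMap.comp_assoc, h2]
  simp only [twist, LinearMap.comp_apply]
  rw [actL_actR, coactR_actR, coactR_actL]



@[ext]
theorem ext {M N : Bicomodule k C V} (hL : M.coactL = N.coactL) (hR : M.coactR = N.coactR) :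
    M = N := by
  cases M; cases N; congr

/-- Precomposition with a coalgebra map is multiplicative for convolution. -/
def precomp (f : C →ₗc[k] D) : WithConv (D →ₗ[k] k) →* WithConv (C →ₗ[k] k) where
  toFun φ := WithConv.toConv (φ.ofConv ∘ₗ f.toLinearMap)
  map_one' := by
    refine WithConv.ext (LinearMap.ext fun c => ?_)
    exact LinearMap.congr_fun f.counit_comp c
  map_mul' φ ψ := WithConv.ext (LinearMap.convMul_comp_coalgHom_distrib φ ψ f)

theorem twist_push (M : Bicomodule k C V) (f : C →ₗc[k] D) (u : (WithConv (D →ₗ[k] k))ˣ) :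
    (M.push f).twist u = M.twist (Units.map (precomp f) u) := by
  have h1 : ∀ φ, (M.push f).actL φ = M.actL (precomp f φ) := fun φ => LinearMap.ext fun v =>
    lin_ext ((TensorProduct.lid k V).toLinearMap ∘ₗ φ.ofConv.rTensor V ∘ₗ
      f.toLinearMap.rTensor V) ((TensorProduct.lid k V).toLinearMap ∘ₗ
        (precomp f φ).ofConv.rTensor V) (M.coactL v) fun a b => rfl
  have h2 : ∀ φ, (M.push f).actR φ = M.actR (precomp f φ) := fun φ => LinearMap.ext fun v =>
    lin_ext ((TensorProduct.rid k V).toLinearMap ∘ₗ φ.ofConv.lTensor V ∘ₗ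
      f.toLinearMap.lTensor V) ((TensorProduct.rid k V).toLinearMap ∘ₗ
        (precomp f φ).ofConv.lTensor V) (M.coactR v) fun a b => rfl
  simp only [twist, h1, h2, ← map_inv, Units.coe_map]

/-- The coalgebra map `c ⊗ d ↦ ε(d) c`. -/
def projL (k C D : Type*) [CommRing k] [AddCommGroup C] [Module k C] [Coalgebra k C]
    [AddCommGroup D] [Module k D] [Coalgebra k D] : C ⊗[k] D →ₗc[k] C :=
  (Coalgebra.TensorProduct.rid k k C).toCoalgHom.comp
    (Coalgebra.TensorProduct.map (.id k C) (counitCoalgHom k D))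

/-- The coalgebra map `c ⊗ d ↦ ε(c) d`. -/
def projR (k C D : Type*) [CommRing k] [AddCommGroup C] [Module k C] [Coalgebra k C]
    [AddCommGroup D] [Module k D] [Coalgebra k D] : C ⊗[k] D →ₗc[k] D :=
  (Coalgebra.TensorProduct.lid k D).toCoalgHom.comp
    (Coalgebra.TensorProduct.map (counitCoalgHom k C) (.id k D))

theorem twist_projL (M : Bicomodule k C V) (N : Bicomodule k D W)
    (u : (WithConv (C →ₗ[k] k))ˣ) :
    (M.tensor N).twist (Units.map (precomp (projL k C D)) u) = (M.twist u).rTensor W := by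
  have h1 : ∀ φ, (M.tensor N).actL (precomp (projL k C D) φ) = (M.actL φ).rTensor W := by
    refine fun φ => TensorProduct.ext' fun v w => ?_
    refine (lin_ext4 ((TensorProduct.lid k (V ⊗[k] W)).toLinearMap ∘ₗ
      (precomp (projL k C D) φ).ofConv.rTensor _ ∘ₗ swap k C V D W)
      (TensorProduct.map ((TensorProduct.lid k V).toLinearMap ∘ₗ φ.ofConv.rTensor V)
        ((TensorProduct.lid k W).toLinearMap ∘ₗ (counit (R := k)).rTensor W)) (M.coactL v)
      (N.coactL w) fun a b c d => ?_).trans (congrArg (M.actL φ v ⊗ₜ ·) (N.counitL w))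
    simp [precomp, projL, TensorProduct.smul_tmul', smul_smul]
  have h2 : ∀ φ, (M.tensor N).actR (precomp (projL k C D) φ) = (M.actR φ).rTensor W := by
    refine fun φ => TensorProduct.ext' fun v w => ?_
    refine (lin_ext4 ((TensorProduct.rid k (V ⊗[k] W)).toLinearMap ∘ₗ
      (precomp (projL k C D) φ).ofConv.lTensor _ ∘ₗ swap k V C W D)
      (TensorProduct.map ((TensorProduct.rid k V).toLinearMap ∘ₗ φ.ofConv.lTensor V)
        ((TensorProduct.rid k W).toLinearMap ∘ₗ (counit (R := k)).lTensor W)) (M.coactR v)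
      (N.coactR w) fun a b c d => ?_).trans (congrArg (M.actR φ v ⊗ₜ ·) (N.counitR w))
    simp [precomp, projL, TensorProduct.smul_tmul', smul_smul]
  simp only [twist, ← map_inv, Units.coe_map, LinearMap.rTensor_comp, ← h1, ← h2]

theorem twist_projR (M : Bicomodule k C V) (N : Bicomodule k D W)
    (u : (WithConv (D →ₗ[k] k))ˣ) :
    (M.tensor N).twist (Units.map (precomp (projR k C D)) u) = (N.twist u).lTensor V := by
  have h1 : ∀ φ, (M.tensor N).actL (precomp (projR k C D) φ) = (N.actL φ).lTensor V := by
    refine fun φ => TensorProduct.ext' fun v w => ?_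
    refine (lin_ext4 ((TensorProduct.lid k (V ⊗[k] W)).toLinearMap ∘ₗ
      (precomp (projR k C D) φ).ofConv.rTensor _ ∘ₗ swap k C V D W)
      (TensorProduct.map ((TensorProduct.lid k V).toLinearMap ∘ₗ (counit (R := k)).rTensor V)
        ((TensorProduct.lid k W).toLinearMap ∘ₗ φ.ofConv.rTensor W)) (M.coactL v)
      (N.coactL w) fun a b c d => ?_).trans (congrArg (· ⊗ₜ N.actL φ w) (M.counitL v))
    simp [precomp, projR, TensorProduct.smul_tmul', smul_smul, mul_comm]
  have h2 : ∀ φ, (M.tensor N).actR (precomp (projR k C D) φ) = (N.actR φ).lTensor V := by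
    refine fun φ => TensorProduct.ext' fun v w => ?_
    refine (lin_ext4 ((TensorProduct.rid k (V ⊗[k] W)).toLinearMap ∘ₗ
      (precomp (projR k C D) φ).ofConv.lTensor _ ∘ₗ swap k V C W D)
      (TensorProduct.map ((TensorProduct.rid k V).toLinearMap ∘ₗ (counit (R := k)).lTensor V)
        ((TensorProduct.rid k W).toLinearMap ∘ₗ φ.ofConv.lTensor W)) (M.coactR v)
      (N.coactR w) fun a b c d => ?_).trans (congrArg (· ⊗ₜ N.actR φ w) (M.counitR v))
    simp [precomp, projR, TensorProduct.smul_tmul', smul_smul, mul_comm]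
  simp only [twist, ← map_inv, Units.coe_map, LinearMap.lTensor_comp, ← h1, ← h2]

variable {C' : Type*} [AddCommGroup C'] [Module k C'] [Coalgebra k C']

theorem push_tensor (M : Bicomodule k C V) (N : Bicomodule k D W) (f : C →ₗc[k] C') :
    (M.push f).tensor N = (M.tensor N).push (Coalgebra.TensorProduct.map f (.id k D)) := by
  apply ext
  · exact TensorProduct.ext' fun v w => lin_ext4 (swap k C' V D W ∘ₗ
      (f.toLinearMap.rTensor V).rTensor _) ((Coalgebra.TensorProduct.map f
        (.id k D)).toLinearMap.rTensor _ ∘ₗ swap k C V D W) (M.coactL v) (N.coactL w)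
      fun a b c d => rfl
  · exact TensorProduct.ext' fun v w => lin_ext4 (swap k V C' W D ∘ₗ
      (f.toLinearMap.lTensor V).rTensor _) ((Coalgebra.TensorProduct.map f
        (.id k D)).toLinearMap.lTensor _ ∘ₗ swap k V C W D) (M.coactR v) (N.coactR w)
      fun a b c d => rfl

theorem tensor_push (M : Bicomodule k C V) (N : Bicomodule k D W) (f : D →ₗc[k] C') :
    M.tensor (N.push f) = (M.tensor N).push (Coalgebra.TensorProduct.map (.id k C) f) := by
  apply ext
  · exact TensorProduct.ext' fun v w => lin_ext4 (swap k C V C' W ∘ₗ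
      (f.toLinearMap.rTensor W).lTensor _) ((Coalgebra.TensorProduct.map
        (.id k C) f).toLinearMap.rTensor _ ∘ₗ swap k C V D W) (M.coactL v) (N.coactL w)
      fun a b c d => rfl
  · exact TensorProduct.ext' fun v w => lin_ext4 (swap k V C W C' ∘ₗ
      (f.toLinearMap.lTensor W).lTensor _) ((Coalgebra.TensorProduct.map
        (.id k C) f).toLinearMap.lTensor _ ∘ₗ swap k V C W D) (M.coactR v) (N.coactR w)
      fun a b c d => rfl

/-- The associator is bicovariant. -/
theorem assoc_bicovariant (M : Bicomodule k C V) (N : Bicomodule k D W)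
    (P : Bicomodule k C' U) :
    (((M.tensor N).tensor P).push
      (Coalgebra.TensorProduct.assoc k k C D C').toCoalgHom).IsBicovariant
      (M.tensor (N.tensor P)) (TensorProduct.assoc k V W U).toLinearMap := by
  constructor
  · intro t
    refine LinearMap.congr_fun (f := (TensorProduct.assoc k V W U).toLinearMap.lTensor _ ∘ₗ
      (((M.tensor N).tensor P).push (Coalgebra.TensorProduct.assoc k k C D C').toCoalgHom).coactL)
      (g := (M.tensor (N.tensor P)).coactL ∘ₗ (TensorProduct.assoc k V W U).toLinearMap)
      (TensorProduct.ext_threefold fun v w u => ?_) t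
    have key : ∀ (x : C ⊗[k] V) (y : D ⊗[k] W) (z : C' ⊗[k] U),
        (TensorProduct.assoc k V W U).toLinearMap.lTensor _
          ((TensorProduct.assoc k C D C').toLinearMap.rTensor _ (swap k (C ⊗[k] D) (V ⊗[k] W) C' U
            (swap k C V D W (x ⊗ₜ y) ⊗ₜ z))) =
        swap k C V (D ⊗[k] C') (W ⊗[k] U) (x ⊗ₜ swap k D W C' U (y ⊗ₜ z)) := by
      intro x y z
      induction x with
      | zero => simp only [TensorProduct.zero_tmul, map_zero]
      | add a b ha hb => simp only [TensorProduct.add_tmul, map_add, ha, hb]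
      | tmul a v' =>
        induction y with
        | zero => simp only [TensorProduct.zero_tmul, TensorProduct.tmul_zero, map_zero]
        | add a b ha hb =>
          simp only [TensorProduct.add_tmul, TensorProduct.tmul_add, map_add, ha, hb]
        | tmul b w' =>
          induction z with
          | zero => simp only [TensorProduct.tmul_zero, map_zero]
          | add a b ha hb => simp only [TensorProduct.tmul_add, map_add, ha, hb]
          | tmul c u' => rfl
    exact key (M.coactL v) (N.coactL w) (P.coactL u)
  · intro t
    refine LinearMap.congr_fun (f := (TensorProduct.assoc k V W U).toLinearMap.rTensor _ ∘ₗ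
      (((M.tensor N).tensor P).push (Coalgebra.TensorProduct.assoc k k C D C').toCoalgHom).coactR)
      (g := (M.tensor (N.tensor P)).coactR ∘ₗ (TensorProduct.assoc k V W U).toLinearMap)
      (TensorProduct.ext_threefold fun v w u => ?_) t
    have key : ∀ (x : V ⊗[k] C) (y : W ⊗[k] D) (z : U ⊗[k] C'),
        (TensorProduct.assoc k V W U).toLinearMap.rTensor _
          ((TensorProduct.assoc k C D C').toLinearMap.lTensor _ (swap k (V ⊗[k] W) (C ⊗[k] D) U C'
            (swap k V C W D (x ⊗ₜ y) ⊗ₜ z))) =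
        swap k V C (W ⊗[k] U) (D ⊗[k] C') (x ⊗ₜ swap k W D U C' (y ⊗ₜ z)) := by
      intro x y z
      induction x with
      | zero => simp only [TensorProduct.zero_tmul, map_zero]
      | add a b ha hb => simp only [TensorProduct.add_tmul, map_add, ha, hb]
      | tmul a v' =>
        induction y with
        | zero => simp only [TensorProduct.zero_tmul, TensorProduct.tmul_zero, map_zero]
        | add a b ha hb =>
          simp only [TensorProduct.add_tmul, TensorProduct.tmul_add, map_add, ha, hb]
        | tmul b w' =>
          induction z with
          | zero => simp only [TensorProduct.tmul_zero, map_zero]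
          | add a b ha hb => simp only [TensorProduct.tmul_add, map_add, ha, hb]
          | tmul c u' => rfl
    exact key (M.coactR v) (N.coactR w) (P.coactR u)

theorem IsBicovariant.rTensor {M : Bicomodule k C V} {N : Bicomodule k C W} {T : V →ₗ[k] W}
    (h : M.IsBicovariant N T) (P : Bicomodule k D U) :
    (M.tensor P).IsBicovariant (N.tensor P) (T.rTensor U) := by
  constructor
  · intro t
    refine lin_ext ((T.rTensor U).lTensor _ ∘ₗ (M.tensor P).coactL)
      ((N.tensor P).coactL ∘ₗ T.rTensor U) t fun v u => ?_
    exact (lin_ext4 ((T.rTensor U).lTensor _ ∘ₗ swap k C V D U)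
      (swap k C W D U ∘ₗ (T.lTensor C).rTensor _) (M.coactL v) (P.coactL u)
      fun a b c d => rfl).trans (congrArg (fun z => swap k C W D U (z ⊗ₜ P.coactL u)) (h.1 v))
  · intro t
    refine lin_ext ((T.rTensor U).rTensor _ ∘ₗ (M.tensor P).coactR)
      ((N.tensor P).coactR ∘ₗ T.rTensor U) t fun v u => ?_
    exact (lin_ext4 ((T.rTensor U).rTensor _ ∘ₗ swap k V C U D)
      (swap k W C U D ∘ₗ (T.rTensor C).rTensor _) (M.coactR v) (P.coactR u)
      fun a b c d => rfl).trans (congrArg (fun z => swap k W C U D (z ⊗ₜ P.coactR u)) (h.2 v))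

theorem IsBicovariant.lTensor {M : Bicomodule k C V} {N : Bicomodule k C W} {T : V →ₗ[k] W}
    (h : M.IsBicovariant N T) (P : Bicomodule k D U) :
    (P.tensor M).IsBicovariant (P.tensor N) (T.lTensor U) := by
  constructor
  · intro t
    refine lin_ext ((T.lTensor U).lTensor _ ∘ₗ (P.tensor M).coactL)
      ((P.tensor N).coactL ∘ₗ T.lTensor U) t fun u v => ?_
    exact (lin_ext4 ((T.lTensor U).lTensor _ ∘ₗ swap k D U C V)
      (swap k D U C W ∘ₗ (T.lTensor C).lTensor _) (P.coactL u) (M.coactL v)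
      fun a b c d => rfl).trans (congrArg (fun z => swap k D U C W (P.coactL u ⊗ₜ z)) (h.1 v))
  · intro t
    refine lin_ext ((T.lTensor U).rTensor _ ∘ₗ (P.tensor M).coactR)
      ((P.tensor N).coactR ∘ₗ T.lTensor U) t fun u v => ?_
    exact (lin_ext4 ((T.lTensor U).rTensor _ ∘ₗ swap k U D V C)
      (swap k U D W C ∘ₗ (T.rTensor C).lTensor _) (P.coactR u) (M.coactR v)
      fun a b c d => rfl).trans (congrArg (fun z => swap k U D W C (P.coactR u ⊗ₜ z)) (h.2 v))


end Bicomodule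


section Bialgebra

variable {H : Type*} [Ring H] [Bialgebra k H]
  {V : Type*} [AddCommGroup V] [Module k V] {W : Type*} [AddCommGroup W] [Module k W]
  {U : Type*} [AddCommGroup U] [Module k U] {Q : Type*} [AddCommGroup Q] [Module k Q]
  {S : Type*} [AddCommGroup S] [Module k S] {R : Type*} [AddCommGroup R] [Module k R]

/-- The codiagonal coactions `v ⊗ w ↦ v₍₋₁₎ w₍₋₁₎ ⊗ v₍₀₎ ⊗ w₍₀₎` and
`v ⊗ w ↦ v₍₀₎ ⊗ w₍₀₎ ⊗ v₍₁₎ w₍₁₎` on the tensor product over `k`. -/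
def Bicomodule.codiag (M : Bicomodule k H V) (N : Bicomodule k H W) :
    Bicomodule k H (V ⊗[k] W) :=
  (M.tensor N).push (Bialgebra.mulCoalgHom k H)

/-- A convolution-invertible, normalised 2-cocycle `γ : H ⊗ H → k`. The last condition is
`γ(a₍₁₎ ⊗ b₍₁₎) γ(a₍₂₎ b₍₂₎ ⊗ c) = γ(b₍₁₎ ⊗ c₍₁₎) γ(a ⊗ b₍₂₎ c₍₂₎)`, written in the convolution
algebra of functionals on `H ⊗ H ⊗ H`. -/
structure TwoCocycle (k : Type*) [CommRing k] (H : Type*) [Ring H] [Bialgebra k H] where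
  unit : (WithConv (H ⊗[k] H →ₗ[k] k))ˣ
  one_left : ∀ a : H, unit.val (1 ⊗ₜ[k] a) = counit (R := k) a
  one_right : ∀ a : H, unit.val (a ⊗ₜ[k] 1) = counit (R := k) a
  cocycle :
    (WithConv.toConv (LinearMap.mul' k k ∘ₗ TensorProduct.map unit.val.ofConv (counit (R := k))) :
        WithConv (H ⊗[k] H ⊗[k] H →ₗ[k] k)) *
      WithConv.toConv (unit.val.ofConv ∘ₗ (LinearMap.mul' k H).rTensor H) =
    WithConv.toConv ((LinearMap.mul' k k ∘ₗ TensorProduct.map (counit (R := k)) unit.val.ofConv) ∘ₗ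
        (TensorProduct.assoc k H H H).toLinearMap) *
      WithConv.toConv (unit.val.ofConv ∘ₗ (LinearMap.mul' k H).lTensor H ∘ₗ
        (TensorProduct.assoc k H H H).toLinearMap)

namespace TwoCocycle

variable (γ : TwoCocycle k H)

/-- The deformation `v ⊗ w ↦ μ(γ(v₍₋₁₎ ⊗ w₍₋₁₎) v₍₀₎ ⊗ w₍₀₎ γ⁻¹(v₍₁₎ ⊗ w₍₁₎))` of a
bilinear map `μ`. -/
def deform (M : Bicomodule k H V) (N : Bicomodule k H W) (μ : V ⊗[k] W →ₗ[k] Q) :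
    V ⊗[k] W →ₗ[k] Q :=
  μ ∘ₗ (M.tensor N).twist γ.unit

theorem cocycle_units :
    Units.map (Bicomodule.precomp (Bicomodule.projL k (H ⊗[k] H) H)) γ.unit *
      Units.map (Bicomodule.precomp (Coalgebra.TensorProduct.map (Bialgebra.mulCoalgHom k H)
        (.id k H))) γ.unit =
    Units.map (Bicomodule.precomp (Coalgebra.TensorProduct.assoc k k H H H).toCoalgHom)
      (Units.map (Bicomodule.precomp (Bicomodule.projR k H (H ⊗[k] H))) γ.unit *
      Units.map (Bicomodule.precomp (Coalgebra.TensorProduct.map (.id k H)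
        (Bialgebra.mulCoalgHom k H))) γ.unit) := by
  refine Units.ext ?_
  have h1 : Bicomodule.precomp (Bicomodule.projL k (H ⊗[k] H) H) γ.unit.val =
      WithConv.toConv (LinearMap.mul' k k ∘ₗ
        TensorProduct.map γ.unit.val.ofConv (counit (R := k))) :=
    WithConv.ext (TensorProduct.ext' fun a b => by
      simp [Bicomodule.precomp, Bicomodule.projL, mul_comm])
  have h2 : Bicomodule.precomp (Bicomodule.projR k H (H ⊗[k] H)) γ.unit.val =
      WithConv.toConv (LinearMap.mul' k k ∘ₗ
        TensorProduct.map (counit (R := k)) γ.unit.val.ofConv) :=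
    WithConv.ext (TensorProduct.ext' fun a b => by
      simp [Bicomodule.precomp, Bicomodule.projR])
  rw [map_mul]
  simp only [Units.val_mul, Units.coe_map]
  rw [h1, h2]
  exact γ.cocycle

/-- Associativity passes to deformed multiplications and actions. -/
theorem deform_assoc {M : Bicomodule k H V} {N : Bicomodule k H W} {P : Bicomodule k H U}
    {Q' : Bicomodule k H Q} {S' : Bicomodule k H S} {μ : V ⊗[k] W →ₗ[k] Q}
    (hμ : (M.codiag N).IsBicovariant Q' μ) {μ' : Q ⊗[k] U →ₗ[k] R} {ν : W ⊗[k] U →ₗ[k] S}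
    (hν : (N.codiag P).IsBicovariant S' ν) {ν' : V ⊗[k] S →ₗ[k] R}
    (h : ∀ v w u, μ' (μ (v ⊗ₜ w) ⊗ₜ u) = ν' (v ⊗ₜ ν (w ⊗ₜ u))) (v : V) (w : W) (u : U) :
    γ.deform Q' P μ' (γ.deform M N μ (v ⊗ₜ w) ⊗ₜ u) =
      γ.deform M S' ν' (v ⊗ₜ γ.deform N P ν (w ⊗ₜ u)) := by
  have e1 : γ.deform Q' P μ' (γ.deform M N μ (v ⊗ₜ w) ⊗ₜ u) = μ' (μ.rTensor U
      (((M.tensor N).tensor P).twist (Units.map (Bicomodule.precomp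
        (Bicomodule.projL k (H ⊗[k] H) H)) γ.unit * Units.map (Bicomodule.precomp
          (Coalgebra.TensorProduct.map (Bialgebra.mulCoalgHom k H) (.id k H))) γ.unit)
        (v ⊗ₜ w ⊗ₜ u))) := by
    rw [← Bicomodule.twist_mul, Bicomodule.twist_projL, ← Bicomodule.twist_push,
      ← Bicomodule.push_tensor]
    exact congrArg μ' ((hμ.rTensor P).twist γ.unit ((M.tensor N).twist γ.unit (v ⊗ₜ w) ⊗ₜ u))
  have e2 : γ.deform M S' ν' (v ⊗ₜ γ.deform N P ν (w ⊗ₜ u)) = ν' (ν.lTensor V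
      ((M.tensor (N.tensor P)).twist (Units.map (Bicomodule.precomp
        (Bicomodule.projR k H (H ⊗[k] H))) γ.unit * Units.map (Bicomodule.precomp
          (Coalgebra.TensorProduct.map (.id k H) (Bialgebra.mulCoalgHom k H))) γ.unit)
        (TensorProduct.assoc k V W U (v ⊗ₜ w ⊗ₜ u)))) := by
    rw [← Bicomodule.twist_mul, Bicomodule.twist_projR, ← Bicomodule.twist_push,
      ← Bicomodule.tensor_push]
    exact congrArg ν' ((hν.lTensor M).twist γ.unit (v ⊗ₜ (N.tensor P).twist γ.unit (w ⊗ₜ u)))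
  rw [e1, e2, γ.cocycle_units]
  have e3 := (Bicomodule.assoc_bicovariant M N P).twist (Units.map (Bicomodule.precomp
        (Bicomodule.projR k H (H ⊗[k] H))) γ.unit * Units.map (Bicomodule.precomp
          (Coalgebra.TensorProduct.map (.id k H) (Bialgebra.mulCoalgHom k H))) γ.unit)
        (v ⊗ₜ w ⊗ₜ u)
  rw [Bicomodule.twist_push] at e3
  refine Eq.trans ?_ (congrArg (fun z => ν' (ν.lTensor V z)) e3).symm
  generalize ((M.tensor N).tensor P).twist _ (v ⊗ₜ w ⊗ₜ u) = t
  exact LinearMap.congr_fun (f := μ' ∘ₗ μ.rTensor U) (g := ν' ∘ₗ ν.lTensor V ∘ₗ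
    (TensorProduct.assoc k V W U).toLinearMap) (TensorProduct.ext_threefold h) t

theorem inv_one_left (a : H) : γ.unit⁻¹.val (1 ⊗ₜ[k] a) = counit (R := k) a := by
  let f : H →ₗc[k] H ⊗[k] H :=
    { toLinearMap := TensorProduct.mk k H H 1
      counit_comp := LinearMap.ext fun a => by simp
      map_comp_comul := LinearMap.ext fun a =>
        (Bicomodule.lin_ext (TensorProduct.map (TensorProduct.mk k H H 1)
          (TensorProduct.mk k H H 1)) (Bicomodule.swap k H H H H ∘ₗ
            TensorProduct.mk k _ _ ((1 : H) ⊗ₜ (1 : H))) (comul a) fun x y => rfl).trans (by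
            simp only [LinearMap.comp_apply, TensorProduct.mk_apply, TensorProduct.comul_tmul,
              Bialgebra.comul_one]
            rfl) }
  have h : Units.map (Bicomodule.precomp f) γ.unit = 1 :=
    Units.ext (WithConv.ext (LinearMap.ext fun a => γ.one_left a))
  have h' : Units.map (Bicomodule.precomp f) γ.unit⁻¹ = 1 := by rw [map_inv, h, inv_one]
  exact LinearMap.congr_fun (congrArg WithConv.ofConv (congrArg Units.val h')) a

theorem inv_one_right (a : H) : γ.unit⁻¹.val (a ⊗ₜ[k] 1) = counit (R := k) a := by
  let f : H →ₗc[k] H ⊗[k] H :=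
    { toLinearMap := (TensorProduct.mk k H H).flip 1
      counit_comp := LinearMap.ext fun a => by simp
      map_comp_comul := LinearMap.ext fun a =>
        (Bicomodule.lin_ext (TensorProduct.map ((TensorProduct.mk k H H).flip 1)
          ((TensorProduct.mk k H H).flip 1)) (Bicomodule.swap k H H H H ∘ₗ
            (TensorProduct.mk k _ _).flip ((1 : H) ⊗ₜ (1 : H))) (comul a) fun x y => rfl).trans (by
            simp only [LinearMap.comp_apply, LinearMap.flip_apply, TensorProduct.mk_apply,
              TensorProduct.comul_tmul, Bialgebra.comul_one]
            rfl) }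
  have h : Units.map (Bicomodule.precomp f) γ.unit = 1 :=
    Units.ext (WithConv.ext (LinearMap.ext fun a => γ.one_right a))
  have h' : Units.map (Bicomodule.precomp f) γ.unit⁻¹ = 1 := by rw [map_inv, h, inv_one]
  exact LinearMap.congr_fun (congrArg WithConv.ofConv (congrArg Units.val h')) a

theorem twist_one_left (M : Bicomodule k H V) (v : V) :
    ((Bicomodule.regular k H).tensor M).twist γ.unit (1 ⊗ₜ v) = 1 ⊗ₜ v := by
  have hL : ∀ φ : WithConv (H ⊗[k] H →ₗ[k] k), (∀ a, φ (1 ⊗ₜ a) = counit (R := k) a) →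
      ((Bicomodule.regular k H).tensor M).actL φ (1 ⊗ₜ v) = 1 ⊗ₜ v := by
    intro φ hφ
    refine (congrArg (fun z => TensorProduct.lid k _ (φ.ofConv.rTensor _ (Bicomodule.swap k H H H V
      (z ⊗ₜ M.coactL v)))) Bialgebra.comul_one).trans (Eq.trans ?_
        (congrArg ((1 : H) ⊗ₜ ·) (M.counitL v)))
    exact Bicomodule.lin_ext ((TensorProduct.lid k _).toLinearMap ∘ₗ φ.ofConv.rTensor _ ∘ₗ
      Bicomodule.swap k H H H V ∘ₗ TensorProduct.mk k _ _ 1) (TensorProduct.mk k _ _ 1 ∘ₗ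
        (TensorProduct.lid k _).toLinearMap ∘ₗ (counit (R := k)).rTensor V) (M.coactL v)
      fun a b => by simp [Algebra.TensorProduct.one_def, hφ]
  have hR : ∀ φ : WithConv (H ⊗[k] H →ₗ[k] k), (∀ a, φ (1 ⊗ₜ a) = counit (R := k) a) →
      ((Bicomodule.regular k H).tensor M).actR φ (1 ⊗ₜ v) = 1 ⊗ₜ v := by
    intro φ hφ
    refine (congrArg (fun z => TensorProduct.rid k _ (φ.ofConv.lTensor _ (Bicomodule.swap k H H V H
      (z ⊗ₜ M.coactR v)))) Bialgebra.comul_one).trans (Eq.trans ?_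
        (congrArg ((1 : H) ⊗ₜ ·) (M.counitR v)))
    exact Bicomodule.lin_ext ((TensorProduct.rid k _).toLinearMap ∘ₗ φ.ofConv.lTensor _ ∘ₗ
      Bicomodule.swap k H H V H ∘ₗ TensorProduct.mk k _ _ 1) (TensorProduct.mk k _ _ 1 ∘ₗ
        (TensorProduct.rid k _).toLinearMap ∘ₗ (counit (R := k)).lTensor V) (M.coactR v)
      fun a b => by simp [Algebra.TensorProduct.one_def, hφ]
  rw [Bicomodule.twist, LinearMap.comp_apply, hR _ γ.inv_one_left, hL _ γ.one_left]

theorem twist_one_right (M : Bicomodule k H V) (v : V) :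
    (M.tensor (Bicomodule.regular k H)).twist γ.unit (v ⊗ₜ 1) = v ⊗ₜ 1 := by
  have hL : ∀ φ : WithConv (H ⊗[k] H →ₗ[k] k), (∀ a, φ (a ⊗ₜ 1) = counit (R := k) a) →
      (M.tensor (Bicomodule.regular k H)).actL φ (v ⊗ₜ 1) = v ⊗ₜ 1 := by
    intro φ hφ
    refine (congrArg (fun z => TensorProduct.lid k _ (φ.ofConv.rTensor _ (Bicomodule.swap k H V H H
      (M.coactL v ⊗ₜ z)))) Bialgebra.comul_one).trans (Eq.trans ?_
        (congrArg (· ⊗ₜ (1 : H)) (M.counitL v)))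
    exact Bicomodule.lin_ext ((TensorProduct.lid k _).toLinearMap ∘ₗ φ.ofConv.rTensor _ ∘ₗ
      Bicomodule.swap k H V H H ∘ₗ (TensorProduct.mk k _ _).flip 1)
      ((TensorProduct.mk k _ _).flip 1 ∘ₗ
        (TensorProduct.lid k _).toLinearMap ∘ₗ (counit (R := k)).rTensor V) (M.coactL v)
      fun a b => by simp [Algebra.TensorProduct.one_def, hφ, TensorProduct.smul_tmul']
  have hR : ∀ φ : WithConv (H ⊗[k] H →ₗ[k] k), (∀ a, φ (a ⊗ₜ 1) = counit (R := k) a) →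
      (M.tensor (Bicomodule.regular k H)).actR φ (v ⊗ₜ 1) = v ⊗ₜ 1 := by
    intro φ hφ
    refine (congrArg (fun z => TensorProduct.rid k _ (φ.ofConv.lTensor _ (Bicomodule.swap k V H H H
      (M.coactR v ⊗ₜ z)))) Bialgebra.comul_one).trans (Eq.trans ?_
        (congrArg (· ⊗ₜ (1 : H)) (M.counitR v)))
    exact Bicomodule.lin_ext ((TensorProduct.rid k _).toLinearMap ∘ₗ φ.ofConv.lTensor _ ∘ₗ
      Bicomodule.swap k V H H H ∘ₗ (TensorProduct.mk k _ _).flip 1)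
      ((TensorProduct.mk k _ _).flip 1 ∘ₗ
        (TensorProduct.rid k _).toLinearMap ∘ₗ (counit (R := k)).lTensor V) (M.coactR v)
      fun a b => by simp [Algebra.TensorProduct.one_def, hφ, TensorProduct.smul_tmul']
  rw [Bicomodule.twist, LinearMap.comp_apply, hR _ γ.inv_one_right, hL _ γ.one_right]

/-- The deformed multiplication `a ⊗ b ↦ γ(a₍₁₎ ⊗ b₍₁₎) a₍₂₎ b₍₂₎ γ⁻¹(a₍₃₎ ⊗ b₍₃₎)` of `H`. -/
def mul : H ⊗[k] H →ₗ[k] H :=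
  γ.deform (Bicomodule.regular k H) (Bicomodule.regular k H) (LinearMap.mul' k H)

theorem regular_tensor_regular :
    (Bicomodule.regular k H).tensor (Bicomodule.regular k H) =
      Bicomodule.regular k (H ⊗[k] H) :=
  Bicomodule.ext (TensorProduct.ext' fun _ _ => rfl) (TensorProduct.ext' fun _ _ => rfl)

theorem mul'_bicovariant : ((Bicomodule.regular k H).codiag
    (Bicomodule.regular k H)).IsBicovariant (Bicomodule.regular k H) (LinearMap.mul' k H) := by
  have h := fun t => LinearMap.congr_fun (Bialgebra.mulCoalgHom k H).map_comp_comul t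
  rw [Bicomodule.codiag, regular_tensor_regular]
  constructor
  · intro t
    refine Eq.trans ?_ (h t)
    exact Bicomodule.lin_ext ((LinearMap.mul' k H).lTensor H ∘ₗ (LinearMap.mul' k H).rTensor _)
      (TensorProduct.map (LinearMap.mul' k H) (LinearMap.mul' k H)) (comul t) fun a b => rfl
  · intro t
    refine Eq.trans ?_ (h t)
    exact Bicomodule.lin_ext ((LinearMap.mul' k H).rTensor H ∘ₗ (LinearMap.mul' k H).lTensor _)
      (TensorProduct.map (LinearMap.mul' k H) (LinearMap.mul' k H)) (comul t) fun a b => rfl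

theorem deform_coactL {M : Bicomodule k H V} {N : Bicomodule k H W} {Q' : Bicomodule k H Q}
    {μ : V ⊗[k] W →ₗ[k] Q} (hμ : (M.codiag N).IsBicovariant Q' μ) (t : V ⊗[k] W) :
    Q'.coactL (γ.deform M N μ t) =
      TensorProduct.map γ.mul (γ.deform M N μ) ((M.tensor N).coactL t) := by
  refine (hμ.1 _).symm.trans ?_
  rw [mul, deform, deform, regular_tensor_regular, TensorProduct.map_comp, LinearMap.comp_apply,
    ← Bicomodule.coactL_twist]
  exact Bicomodule.lin_ext (μ.lTensor H ∘ₗ (LinearMap.mul' k H).rTensor _)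
    (TensorProduct.map (LinearMap.mul' k H) μ) _ fun a b => rfl

theorem deform_coactR {M : Bicomodule k H V} {N : Bicomodule k H W} {Q' : Bicomodule k H Q}
    {μ : V ⊗[k] W →ₗ[k] Q} (hμ : (M.codiag N).IsBicovariant Q' μ) (t : V ⊗[k] W) :
    Q'.coactR (γ.deform M N μ t) =
      TensorProduct.map (γ.deform M N μ) γ.mul ((M.tensor N).coactR t) := by
  refine (hμ.2 _).symm.trans ?_
  rw [mul, deform, deform, regular_tensor_regular, TensorProduct.map_comp, LinearMap.comp_apply,
    ← Bicomodule.coactR_twist]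
  exact Bicomodule.lin_ext (μ.rTensor H ∘ₗ (LinearMap.mul' k H).lTensor _)
    (TensorProduct.map μ (LinearMap.mul' k H)) _ fun a b => rfl

theorem counit_mul (t : H ⊗[k] H) :
    counit (R := k) (γ.mul t) = counit (R := k) t := by
  rw [mul, deform, regular_tensor_regular]
  refine (LinearMap.congr_fun (Bialgebra.mulCoalgHom k H).counit_comp _).trans ?_
  have h1 : ∀ (φ : WithConv (H ⊗[k] H →ₗ[k] k)) (c : H ⊗[k] H), counit (R := k)
      ((Bicomodule.regular k (H ⊗[k] H)).actL φ c) = φ c := by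
    intro φ c
    refine (Bicomodule.lin_ext (counit (R := k) ∘ₗ (TensorProduct.lid k _).toLinearMap ∘ₗ
      φ.ofConv.rTensor _) (φ.ofConv ∘ₗ (TensorProduct.rid k _).toLinearMap ∘ₗ
        (counit (R := k)).lTensor _) (comul c) fun a b => by
          simp only [LinearMap.comp_apply, LinearMap.rTensor_tmul, LinearMap.lTensor_tmul,
            LinearEquiv.coe_coe, TensorProduct.lid_tmul, TensorProduct.rid_tmul, map_smul,
            smul_eq_mul, mul_comm]).trans ?_
    exact congrArg φ.ofConv ((Bicomodule.regular k (H ⊗[k] H)).counitR c)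
  rw [Bicomodule.twist, LinearMap.comp_apply, h1]
  refine Eq.trans ?_ (LinearMap.congr_fun (congrArg WithConv.ofConv γ.unit.mul_inv) t)
  exact Bicomodule.lin_ext (γ.unit.val.ofConv ∘ₗ (TensorProduct.rid k _).toLinearMap ∘ₗ
    γ.unit⁻¹.val.ofConv.lTensor _) (LinearMap.mul' k k ∘ₗ TensorProduct.map γ.unit.val.ofConv
      γ.unit⁻¹.val.ofConv) (comul t) fun a b => by
        simp only [LinearMap.comp_apply, LinearMap.lTensor_tmul, TensorProduct.map_tmul,
            LinearEquiv.coe_coe, TensorProduct.rid_tmul, map_smul,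
            smul_eq_mul, mul_comm, LinearMap.mul'_apply]

theorem mul_assoc (a b c : H) :
    γ.mul (γ.mul (a ⊗ₜ b) ⊗ₜ c) = γ.mul (a ⊗ₜ γ.mul (b ⊗ₜ c)) :=
  γ.deform_assoc mul'_bicovariant mul'_bicovariant (fun a b c => _root_.mul_assoc a b c) a b c

end TwoCocycle

/-- The deformation of `H` by the 2-cocycle `γ`: the same coalgebra and the same unit, with the
product `γ(a₍₁₎ ⊗ b₍₁₎) a₍₂₎ b₍₂₎ γ⁻¹(a₍₃₎ ⊗ b₍₃₎)`. -/
def CocycleTwist (_γ : TwoCocycle k H) : Type _ := H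

namespace CocycleTwist

variable (γ : TwoCocycle k H)

instance : Ring (CocycleTwist γ) where
  __ := (inferInstance : AddCommGroup H)
  mul a b := γ.mul ((show H from a) ⊗ₜ[k] (show H from b))
  one := (1 : H)
  left_distrib a b c := by
    exact (congrArg γ.mul (TensorProduct.tmul_add (R := k) (M := H) (N := H) a b c)).trans
      (map_add _ _ _)
  right_distrib a b c := by
    exact (congrArg γ.mul (TensorProduct.add_tmul (R := k) (M := H) (N := H) a b c)).trans
      (map_add _ _ _)
  zero_mul a := by
    exact (congrArg γ.mul (TensorProduct.zero_tmul (R := k) H (show H from a))).trans (map_zero _)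
  mul_zero a := by
    exact (congrArg γ.mul (TensorProduct.tmul_zero (R := k) H (show H from a))).trans (map_zero _)
  mul_assoc a b c := γ.mul_assoc a b c
  one_mul a := (congrArg (LinearMap.mul' k H)
    (γ.twist_one_left (Bicomodule.regular k H) a)).trans (one_mul (M := H) a)
  mul_one a := (congrArg (LinearMap.mul' k H)
    (γ.twist_one_right (Bicomodule.regular k H) a)).trans (mul_one (M := H) a)

instance : Algebra k (CocycleTwist γ) :=
  letI : Module k (CocycleTwist γ) := inferInstanceAs (Module k H)
  Algebra.ofModule
    (fun r a b => by
      exact (congrArg γ.mul (TensorProduct.smul_tmul' (R := k) (M := H) (N := H) r a b)).symm.trans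
        (map_smul γ.mul _ _))
    (fun r a b => by
      exact (congrArg γ.mul (TensorProduct.tmul_smul (R := k) (M := H) (N := H) r a b)).trans
        (map_smul γ.mul _ _))

instance : Coalgebra k (CocycleTwist γ) := inferInstanceAs (Coalgebra k H)

instance : Bialgebra k (CocycleTwist γ) :=
  Bialgebra.mk' k (CocycleTwist γ)
    (Bialgebra.counit_one (R := k) (A := H))
    (fun {a b} => (γ.counit_mul ((show H from a) ⊗ₜ[k] (show H from b))).trans (by
      exact mul_comm _ _))
    (Bialgebra.comul_one (R := k) (A := H))
    (fun {a b} => by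
      refine (γ.deform_coactL TwoCocycle.mul'_bicovariant
        ((show H from a) ⊗ₜ[k] (show H from b))).trans ?_
      exact Bicomodule.lin_ext4 (TensorProduct.map γ.mul γ.mul ∘ₗ Bicomodule.swap k H H H H)
        (LinearMap.mul' k (CocycleTwist γ ⊗[k] CocycleTwist γ)) (comul (R := k) (A := H) a)
        (comul (R := k) (A := H) b) fun x y z t =>
          (Algebra.TensorProduct.tmul_mul_tmul (R := k) (A := CocycleTwist γ)
            (B := CocycleTwist γ) x z y t).symm)

end CocycleTwist
end Bialgebra


section Bimodule

variable {H : Type*} [Ring H] [Bialgebra k H]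
  {V : Type*} [AddCommGroup V] [Module k V] {W : Type*} [AddCommGroup W] [Module k W]
  {U : Type*} [AddCommGroup U] [Module k U]

namespace Bicomodule

section
variable {C : Type*} [AddCommGroup C] [Module k C] [Coalgebra k C]
  {D : Type*} [AddCommGroup D] [Module k D] [Coalgebra k D]
  {X : Bicomodule k C V} {Y : Bicomodule k C W} {Z : Bicomodule k C U}

theorem IsBicovariant.comp {S : W →ₗ[k] U} {T : V →ₗ[k] W} (hS : Y.IsBicovariant Z S)
    (hT : X.IsBicovariant Y T) : X.IsBicovariant Z (S ∘ₗ T) := by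
  constructor <;> intro v
  · rw [LinearMap.lTensor_comp_apply, hT.1, hS.1, LinearMap.comp_apply]
  · rw [LinearMap.rTensor_comp_apply, hT.2, hS.2, LinearMap.comp_apply]

theorem IsBicovariant.of_surjective {S : W →ₗ[k] U} {T : V →ₗ[k] W} (hT : X.IsBicovariant Y T)
    (hs : Function.Surjective T) (h : X.IsBicovariant Z (S ∘ₗ T)) : Y.IsBicovariant Z S := by
  constructor <;> intro w <;> obtain ⟨v, rfl⟩ := hs w
  · rw [← hT.1, ← LinearMap.lTensor_comp_apply, h.1, LinearMap.comp_apply]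
  · rw [← hT.2, ← LinearMap.rTensor_comp_apply, h.2, LinearMap.comp_apply]

theorem IsBicovariant.push {T : V →ₗ[k] W} (hT : X.IsBicovariant Y T) (f : C →ₗc[k] D) :
    (X.push f).IsBicovariant (Y.push f) T := by
  constructor <;> intro v
  · refine Eq.trans ?_ (congrArg (f.toLinearMap.rTensor W) (hT.1 v))
    exact lin_ext (T.lTensor D ∘ₗ f.toLinearMap.rTensor V) (f.toLinearMap.rTensor W ∘ₗ T.lTensor C)
      (X.coactL v) fun a b => rfl
  · refine Eq.trans ?_ (congrArg (f.toLinearMap.lTensor W) (hT.2 v))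
    exact lin_ext (T.rTensor D ∘ₗ f.toLinearMap.lTensor V) (f.toLinearMap.lTensor W ∘ₗ T.rTensor C)
      (X.coactR v) fun a b => rfl

theorem push_push {D' : Type*} [AddCommGroup D'] [Module k D'] [Coalgebra k D']
    (X : Bicomodule k C V) (f : C →ₗc[k] D) (g : D →ₗc[k] D') :
    (X.push f).push g = X.push (g.comp f) :=
  ext (LinearMap.ext fun v => lin_ext (g.toLinearMap.rTensor V ∘ₗ f.toLinearMap.rTensor V)
      ((g.comp f).toLinearMap.rTensor V) (X.coactL v) fun _ _ => rfl)
    (LinearMap.ext fun v => lin_ext (g.toLinearMap.lTensor V ∘ₗ f.toLinearMap.lTensor V)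
      ((g.comp f).toLinearMap.lTensor V) (X.coactR v) fun _ _ => rfl)

end

theorem codiag_assoc (M : Bicomodule k H V) (N : Bicomodule k H W) (P : Bicomodule k H U) :
    ((M.codiag N).codiag P).IsBicovariant (M.codiag (N.codiag P))
      (TensorProduct.assoc k V W U).toLinearMap := by
  have h := (assoc_bicovariant M N P).push ((Bialgebra.mulCoalgHom k H).comp
    (Coalgebra.TensorProduct.map (.id k H) (Bialgebra.mulCoalgHom k H)))
  rw [← push_push (M.tensor (N.tensor P)), ← tensor_push, push_push] at h
  rw [codiag, codiag, codiag, codiag, push_tensor, push_push]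
  convert h using 2
  exact CoalgHom.ext (LinearMap.congr_fun <|
    TensorProduct.ext_threefold fun a b c => mul_assoc a b c)

theorem codiag_assoc_symm (M : Bicomodule k H V) (N : Bicomodule k H W)
    (P : Bicomodule k H U) :
    (M.codiag (N.codiag P)).IsBicovariant ((M.codiag N).codiag P)
      (TensorProduct.assoc k V W U).symm.toLinearMap := by
  refine (codiag_assoc M N P).of_surjective (TensorProduct.assoc k V W U).surjective ?_
  have : (TensorProduct.assoc k V W U).symm.toLinearMap ∘ₗ
    (TensorProduct.assoc k V W U).toLinearMap = LinearMap.id := by ext; rfl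
  rw [this]
  constructor <;> intro t <;> simp

end Bicomodule

/-- A bicovariant bimodule over the bialgebra `H`: an `H`-bimodule with two commuting coactions
such that the left and right actions `H ⊗ E → E`, `E ⊗ H → E` are compatible with both coactions,
i.e. `Δ_E(a e) = Δ(a) Δ_E(e)`, `Δ_E(e a) = Δ_E(e) Δ(a)` and the same for the right coaction. -/
structure BicovariantBimodule (k : Type u) [CommRing k] (H : Type v) [Ring H] [Bialgebra k H]
    (E : Type w) [AddCommGroup E] [Module k E] extends Bicomodule k H E where
  lact : H ⊗[k] E →ₗ[k] E
  ract : E ⊗[k] H →ₗ[k] E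
  one_lact : ∀ e, lact (1 ⊗ₜ e) = e
  mul_lact : ∀ a b e, lact ((a * b) ⊗ₜ e) = lact (a ⊗ₜ lact (b ⊗ₜ e))
  ract_one : ∀ e, ract (e ⊗ₜ 1) = e
  ract_mul : ∀ e a b, ract (e ⊗ₜ (a * b)) = ract (ract (e ⊗ₜ a) ⊗ₜ b)
  lact_ract : ∀ a e b, ract (lact (a ⊗ₜ e) ⊗ₜ b) = lact (a ⊗ₜ ract (e ⊗ₜ b))
  lact_covariant :
    ((Bicomodule.regular k H).codiag toBicomodule).IsBicovariant toBicomodule lact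
  ract_covariant :
    (toBicomodule.codiag (Bicomodule.regular k H)).IsBicovariant toBicomodule ract

namespace BicovariantBimodule

/-- The submodule generated by the elements `(v a) ⊗ w - v ⊗ (a w)`. -/
def balancing (M : BicovariantBimodule k H V) (N : BicovariantBimodule k H W) :
    Submodule k (V ⊗[k] W) :=
  LinearMap.range (M.ract.rTensor W - N.lact.lTensor V ∘ₗ
    (TensorProduct.assoc k V H W).toLinearMap)

/-- The tensor product over `H`. -/
abbrev TensorOver (M : BicovariantBimodule k H V) (N : BicovariantBimodule k H W) : Type _ :=
  (V ⊗[k] W) ⧸ balancing M N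

variable (M : BicovariantBimodule k H V) (N : BicovariantBimodule k H W)

/-- The canonical map `V ⊗ W → V ⊗_H W`. -/
abbrev proj : V ⊗[k] W →ₗ[k] TensorOver M N := (balancing M N).mkQ

theorem proj_comp : proj M N ∘ₗ (M.ract.rTensor W - N.lact.lTensor V ∘ₗ
    (TensorProduct.assoc k V H W).toLinearMap) = 0 :=
  LinearMap.range_le_ker_iff.mp (by rw [proj, Submodule.ker_mkQ, balancing])

theorem proj_balanced (v : V) (a : H) (w : W) :
    proj M N (M.ract (v ⊗ₜ a) ⊗ₜ w) = proj M N (v ⊗ₜ N.lact (a ⊗ₜ w)) := by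
  have h := LinearMap.congr_fun (proj_comp M N) (v ⊗ₜ a ⊗ₜ w)
  simpa [sub_eq_zero] using h

theorem balancing_le {X : Type*} [AddCommGroup X] [Module k X] (f : V ⊗[k] W →ₗ[k] X)
    (h : ∀ v a w, f (M.ract (v ⊗ₜ a) ⊗ₜ w) = f (v ⊗ₜ N.lact (a ⊗ₜ w))) :
    balancing M N ≤ LinearMap.ker f := by
  rw [balancing, LinearMap.range_le_ker_iff]
  exact TensorProduct.ext_threefold fun v a w => by simp [h]

theorem codiag_coactL_balancing : balancing M N ≤ LinearMap.ker ((proj M N).lTensor H ∘ₗ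
    (M.toBicomodule.codiag N.toBicomodule).coactL) := by
  refine LinearMap.range_le_ker_iff.mpr (LinearMap.ext fun t => ?_)
  have h1 := ((M.ract_covariant.rTensor N.toBicomodule).push (Bialgebra.mulCoalgHom k H)).1 t
  have h2 := (((N.lact_covariant.lTensor M.toBicomodule).push (Bialgebra.mulCoalgHom k H)).comp
    (Bicomodule.codiag_assoc M.toBicomodule (Bicomodule.regular k H) N.toBicomodule)).1 t
  have h3 := congrArg (fun f => LinearMap.lTensor H f
    (((M.toBicomodule.codiag (Bicomodule.regular k H)).codiag N.toBicomodule).coactL t))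
      (proj_comp M N)
  simp only [LinearMap.lTensor_comp_apply, LinearMap.lTensor_sub, LinearMap.sub_apply,
    LinearMap.lTensor_zero, LinearMap.zero_apply] at h3
  rw [LinearMap.comp_apply, LinearMap.comp_apply, LinearMap.sub_apply, map_sub]
  refine Eq.trans ?_ h3
  rw [← LinearMap.lTensor_comp_apply H (LinearMap.lTensor V N.lact)]
  exact congrArg ((proj M N).lTensor H) (congrArg₂ (· - ·) h1.symm h2.symm)

theorem codiag_coactR_balancing : balancing M N ≤ LinearMap.ker ((proj M N).rTensor H ∘ₗ
    (M.toBicomodule.codiag N.toBicomodule).coactR) := by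
  refine LinearMap.range_le_ker_iff.mpr (LinearMap.ext fun t => ?_)
  have h1 := ((M.ract_covariant.rTensor N.toBicomodule).push (Bialgebra.mulCoalgHom k H)).2 t
  have h2 := (((N.lact_covariant.lTensor M.toBicomodule).push (Bialgebra.mulCoalgHom k H)).comp
    (Bicomodule.codiag_assoc M.toBicomodule (Bicomodule.regular k H) N.toBicomodule)).2 t
  have h3 := congrArg (fun f => LinearMap.rTensor H f
    (((M.toBicomodule.codiag (Bicomodule.regular k H)).codiag N.toBicomodule).coactR t))
      (proj_comp M N)
  simp only [LinearMap.rTensor_comp_apply, LinearMap.rTensor_sub, LinearMap.sub_apply,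
    LinearMap.rTensor_zero, LinearMap.zero_apply] at h3
  rw [LinearMap.comp_apply, LinearMap.comp_apply, LinearMap.sub_apply, map_sub]
  refine Eq.trans ?_ h3
  rw [← LinearMap.rTensor_comp_apply H (LinearMap.lTensor V N.lact)]
  exact congrArg ((proj M N).rTensor H) (congrArg₂ (· - ·) h1.symm h2.symm)

/-- The bicomodule `V ⊗_H W`. -/
def tensorBicomodule : Bicomodule k H (TensorOver M N) :=
  (M.toBicomodule.codiag N.toBicomodule).ofSurjective (proj M N) (Submodule.mkQ_surjective _)
    ((balancing M N).liftQ ((proj M N).lTensor H ∘ₗ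
      (M.toBicomodule.codiag N.toBicomodule).coactL) (codiag_coactL_balancing M N))
    ((balancing M N).liftQ ((proj M N).rTensor H ∘ₗ
      (M.toBicomodule.codiag N.toBicomodule).coactR) (codiag_coactR_balancing M N))
    (fun _ => rfl) (fun _ => rfl)

theorem proj_bicovariant : (M.toBicomodule.codiag N.toBicomodule).IsBicovariant
    (tensorBicomodule M N) (proj M N) :=
  ⟨fun _ => rfl, fun _ => rfl⟩

/-- The left action `a (v ⊗ w) = (a v) ⊗ w`. -/
def tensorLact : H ⊗[k] TensorOver M N →ₗ[k] TensorOver M N :=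
  TensorProduct.lift ((balancing M N).liftQ (TensorProduct.curry (proj M N ∘ₗ M.lact.rTensor W ∘ₗ
    (TensorProduct.assoc k H V W).symm.toLinearMap)).flip (balancing_le M N _ fun v a w => by
      ext b
      refine (congrArg (fun z => proj M N (z ⊗ₜ w)) (M.lact_ract b v a)).symm.trans ?_
      exact proj_balanced M N _ a w)).flip

/-- The right action `(v ⊗ w) a = v ⊗ (w a)`. -/
def tensorRact : TensorOver M N ⊗[k] H →ₗ[k] TensorOver M N :=
  TensorProduct.lift ((balancing M N).liftQ (TensorProduct.curry (proj M N ∘ₗ N.ract.lTensor V ∘ₗ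
    (TensorProduct.assoc k V W H).toLinearMap)) (balancing_le M N _ fun v a w => by
      ext b
      refine Eq.trans ?_ (congrArg (fun z => proj M N (v ⊗ₜ z)) (N.lact_ract a w b)).symm
      exact proj_balanced M N v a _))

theorem hom_ext {X : Type*} [AddCommGroup X] [Module k X] (f g : TensorOver M N →ₗ[k] X)
    (t : TensorOver M N) (h : ∀ v w, f (proj M N (v ⊗ₜ w)) = g (proj M N (v ⊗ₜ w))) :
    f t = g t :=
  LinearMap.congr_fun (Submodule.linearMap_qext _ (TensorProduct.ext' h)) t

/-- The bicovariant bimodule `V ⊗_H W`. -/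
def tensor : BicovariantBimodule k H (TensorOver M N) where
  toBicomodule := tensorBicomodule M N
  lact := tensorLact M N
  ract := tensorRact M N
  one_lact e := hom_ext M N (tensorLact M N ∘ₗ TensorProduct.mk k _ _ 1) LinearMap.id e
    fun v w => congrArg (fun z => proj M N (z ⊗ₜ w)) (M.one_lact v)
  mul_lact a b e := hom_ext M N (tensorLact M N ∘ₗ TensorProduct.mk k _ _ (a * b))
    (tensorLact M N ∘ₗ TensorProduct.mk k _ _ a ∘ₗ tensorLact M N ∘ₗ TensorProduct.mk k _ _ b) e
    fun v w => congrArg (fun z => proj M N (z ⊗ₜ w)) (M.mul_lact a b v)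
  ract_one e := hom_ext M N (tensorRact M N ∘ₗ (TensorProduct.mk k _ _).flip 1) LinearMap.id e
    fun v w => congrArg (fun z => proj M N (v ⊗ₜ z)) (N.ract_one w)
  ract_mul e a b := hom_ext M N (tensorRact M N ∘ₗ (TensorProduct.mk k _ _).flip (a * b))
    (tensorRact M N ∘ₗ (TensorProduct.mk k _ _).flip b ∘ₗ tensorRact M N ∘ₗ
      (TensorProduct.mk k _ _).flip a) e
    fun v w => congrArg (fun z => proj M N (v ⊗ₜ z)) (N.ract_mul w a b)
  lact_ract a e b := hom_ext M N (tensorRact M N ∘ₗ (TensorProduct.mk k _ _).flip b ∘ₗ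
      tensorLact M N ∘ₗ TensorProduct.mk k _ _ a) (tensorLact M N ∘ₗ TensorProduct.mk k _ _ a ∘ₗ
        tensorRact M N ∘ₗ (TensorProduct.mk k _ _).flip b) e fun v w => rfl
  lact_covariant := by
    refine (((proj_bicovariant M N).lTensor (Bicomodule.regular k H)).push
      (Bialgebra.mulCoalgHom k H)).of_surjective
        (LinearMap.lTensor_surjective H (Submodule.mkQ_surjective _)) ?_
    have h := (proj_bicovariant M N).comp (((M.lact_covariant.rTensor N.toBicomodule).push
      (Bialgebra.mulCoalgHom k H)).comp (Bicomodule.codiag_assoc_symm (Bicomodule.regular k H)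
        M.toBicomodule N.toBicomodule))
    have e : tensorLact M N ∘ₗ (proj M N).lTensor H = proj M N ∘ₗ M.lact.rTensor W ∘ₗ
        (TensorProduct.assoc k H V W).symm.toLinearMap := TensorProduct.ext' fun a t => rfl
    rw [e]
    exact h
  ract_covariant := by
    refine (((proj_bicovariant M N).rTensor (Bicomodule.regular k H)).push
      (Bialgebra.mulCoalgHom k H)).of_surjective
        (LinearMap.rTensor_surjective H (Submodule.mkQ_surjective _)) ?_
    have h := (proj_bicovariant M N).comp (((N.ract_covariant.lTensor M.toBicomodule).push
      (Bialgebra.mulCoalgHom k H)).comp (Bicomodule.codiag_assoc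
        M.toBicomodule N.toBicomodule (Bicomodule.regular k H)))
    have e : tensorRact M N ∘ₗ (proj M N).rTensor H = proj M N ∘ₗ N.ract.lTensor V ∘ₗ
        (TensorProduct.assoc k V W H).toLinearMap := TensorProduct.ext' fun a t => rfl
    rw [e]
    exact h

end BicovariantBimodule
end Bimodule

section Deformation

variable {H : Type*} [Ring H] [Bialgebra k H]
  {V : Type*} [AddCommGroup V] [Module k V] {W : Type*} [AddCommGroup W] [Module k W]
  {U : Type*} [AddCommGroup U] [Module k U]

/-- The same coactions, regarded as coactions of the deformed bialgebra. -/
def Bicomodule.toTwist (M : Bicomodule k H V) (γ : TwoCocycle k H) :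
    Bicomodule k (CocycleTwist γ) V :=
  (M : Bicomodule k H V)

theorem CocycleTwist.mul_eq (γ : TwoCocycle k H) :
    LinearMap.mul' k (CocycleTwist γ) = γ.mul :=
  TensorProduct.ext' fun _ _ => rfl

theorem TwoCocycle.deform_bicovariant (γ : TwoCocycle k H)
    {M : Bicomodule k H V} {N : Bicomodule k H W} {Q : Bicomodule k H U}
    {μ : V ⊗[k] W →ₗ[k] U} (hμ : (M.codiag N).IsBicovariant Q μ) :
    ((M.toTwist γ).codiag (N.toTwist γ)).IsBicovariant (Q.toTwist γ) (γ.deform M N μ) := by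
  constructor
  · intro t
    refine (Bicomodule.lin_ext (X := CocycleTwist γ ⊗[k] CocycleTwist γ)
      ((γ.deform M N μ).lTensor (CocycleTwist γ) ∘ₗ
        (LinearMap.mul' k (CocycleTwist γ)).rTensor _)
      (TensorProduct.map (LinearMap.mul' k (CocycleTwist γ)) (γ.deform M N μ))
      (((M.toTwist γ).tensor (N.toTwist γ)).coactL t) fun a b => rfl).trans ?_
    rw [CocycleTwist.mul_eq]
    exact (γ.deform_coactL hμ t).symm
  · intro t
    refine (Bicomodule.lin_ext (Y := CocycleTwist γ ⊗[k] CocycleTwist γ)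
      ((γ.deform M N μ).rTensor (CocycleTwist γ) ∘ₗ
        (LinearMap.mul' k (CocycleTwist γ)).lTensor _)
      (TensorProduct.map (γ.deform M N μ) (LinearMap.mul' k (CocycleTwist γ)))
      (((M.toTwist γ).tensor (N.toTwist γ)).coactR t) fun a b => rfl).trans ?_
    rw [CocycleTwist.mul_eq]
    exact (γ.deform_coactR hμ t).symm

namespace BicovariantBimodule

variable (M : BicovariantBimodule k H V) (γ : TwoCocycle k H)

/-- The deformed left action `γ(a₍₁₎ ⊗ e₍₋₁₎) a₍₂₎ e₍₀₎ γ⁻¹(a₍₃₎ ⊗ e₍₁₎)`. -/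
def deformLact : H ⊗[k] V →ₗ[k] V := γ.deform (Bicomodule.regular k H) M.toBicomodule M.lact

/-- The deformed right action `γ(e₍₋₁₎ ⊗ a₍₁₎) e₍₀₎ a₍₂₎ γ⁻¹(e₍₁₎ ⊗ a₍₃₎)`. -/
def deformRact : V ⊗[k] H →ₗ[k] V := γ.deform M.toBicomodule (Bicomodule.regular k H) M.ract

theorem deformLact_mul (a b : H) (e : V) : M.deformLact γ (γ.mul (a ⊗ₜ b) ⊗ₜ e) =
    M.deformLact γ (a ⊗ₜ M.deformLact γ (b ⊗ₜ e)) :=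
  γ.deform_assoc TwoCocycle.mul'_bicovariant M.lact_covariant M.mul_lact a b e

theorem deformRact_mul (e : V) (a b : H) : M.deformRact γ (e ⊗ₜ γ.mul (a ⊗ₜ b)) =
    M.deformRact γ (M.deformRact γ (e ⊗ₜ a) ⊗ₜ b) :=
  (γ.deform_assoc M.ract_covariant TwoCocycle.mul'_bicovariant
    (fun e a b => (M.ract_mul e a b).symm) e a b).symm

theorem deformLact_deformRact (a : H) (e : V) (b : H) :
    M.deformRact γ (M.deformLact γ (a ⊗ₜ e) ⊗ₜ b) =
      M.deformLact γ (a ⊗ₜ M.deformRact γ (e ⊗ₜ b)) :=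
  γ.deform_assoc M.lact_covariant M.ract_covariant M.lact_ract a e b

/-- The cocycle deformation of a bicovariant bimodule: the same coactions, with the deformed
actions. -/
def deform : BicovariantBimodule k (CocycleTwist γ) V where
  toBicomodule := M.toBicomodule.toTwist γ
  lact := M.deformLact γ
  ract := M.deformRact γ
  one_lact e := by
    exact (congrArg M.lact (γ.twist_one_left M.toBicomodule e)).trans (M.one_lact e)
  mul_lact a b e := by exact M.deformLact_mul γ a b e
  ract_one e := by
    exact (congrArg M.ract (γ.twist_one_right M.toBicomodule e)).trans (M.ract_one e)
  ract_mul e a b := by exact M.deformRact_mul γ e a b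
  lact_ract a e b := by exact M.deformLact_deformRact γ a e b
  lact_covariant := by exact γ.deform_bicovariant M.lact_covariant
  ract_covariant := by exact γ.deform_bicovariant M.ract_covariant

end BicovariantBimodule

end Deformation

/-- A bicovariant first order differential calculus over `H`: a bicovariant bimodule `E` with a
derivation `d : H → E`, compatible with both coactions, such that every element of `E` is a sum of
elements `a db`. -/
structure BicovariantCalculus (k : Type u) [CommRing k] (H : Type v) [Ring H] [Bialgebra k H]
    (E : Type w) [AddCommGroup E] [Module k E] extends BicovariantBimodule k H E where
  d : H →ₗ[k] E
  leibniz : ∀ a b, d (a * b) = ract (d a ⊗ₜ b) + lact (a ⊗ₜ d b)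
  range_eq_top : LinearMap.range (lact ∘ₗ d.lTensor H) = ⊤
  d_covariant : (Bicomodule.regular k H).IsBicovariant toBicomodule d

section DeformedCalculus

variable {H : Type*} [Ring H] [Bialgebra k H] {E : Type*} [AddCommGroup E] [Module k E]

theorem BicovariantCalculus.deform_leibniz (C : BicovariantCalculus k H E) (γ : TwoCocycle k H)
    (t : H ⊗[k] H) : C.d (γ.mul t) =
      C.deformRact γ (C.d.rTensor H t) + C.deformLact γ (C.d.lTensor H t) := by
  have h : ∀ s : H ⊗[k] H, C.d (LinearMap.mul' k H s) =
      C.ract (C.d.rTensor H s) + C.lact (C.d.lTensor H s) := fun s =>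
    Bicomodule.lin_ext (C.d ∘ₗ LinearMap.mul' k H)
      (C.ract ∘ₗ C.d.rTensor H + C.lact ∘ₗ C.d.lTensor H) s C.leibniz
  refine (h _).trans ?_
  rw [← (C.d_covariant.rTensor (Bicomodule.regular k H)).twist,
    ← (C.d_covariant.lTensor (Bicomodule.regular k H)).twist]
  rfl

theorem BicovariantCalculus.deform_surjective (C : BicovariantCalculus k H E)
    (γ : TwoCocycle k H) (e : E) :
    ∃ t : H ⊗[k] H, C.deformLact γ (C.d.lTensor H t) = e := by
  obtain ⟨s, hs⟩ := LinearMap.range_eq_top.mp C.range_eq_top e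
  refine ⟨((Bicomodule.regular k H).tensor (Bicomodule.regular k H)).twist γ.unit⁻¹ s, ?_⟩
  refine Eq.trans ?_ hs
  refine congrArg C.lact ?_
  rw [(C.d_covariant.lTensor (Bicomodule.regular k H)).twist, Bicomodule.twist_twist_inv]

/-- The deformed calculus `(E_Ω, d_Ω)` over the deformed algebra: the vector space `E`, its
coactions and the differential `d` are unchanged, the two actions are deformed. -/
def BicovariantCalculus.deform (C : BicovariantCalculus k H E) (γ : TwoCocycle k H) :
    BicovariantCalculus k (CocycleTwist γ) E where
  toBicovariantBimodule := C.toBicovariantBimodule.deform γ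
  d := C.d
  leibniz a b := C.deform_leibniz γ ((show H from a) ⊗ₜ[k] (show H from b))
  range_eq_top := LinearMap.range_eq_top.mpr (C.deform_surjective γ)
  d_covariant := C.d_covariant

end DeformedCalculus

section Classical

variable {A : Type*} [CommRing A] [Bialgebra k A]

/-- The vector space `X` with the `A`-module structure given by `f`. -/
def ViaEnd {X : Type*} [AddCommGroup X] [Module k X] (_f : A →ₐ[k] Module.End k X) : Type _ := X

section ViaEnd
variable {X : Type*} [AddCommGroup X] [Module k X] (f : A →ₐ[k] Module.End k X)

instance : AddCommGroup (ViaEnd f) := inferInstanceAs (AddCommGroup X)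
instance : Module k (ViaEnd f) := inferInstanceAs (Module k X)
instance : Module A (ViaEnd f) := Module.compHom X f.toRingHom
instance : IsScalarTower k A (ViaEnd f) where
  smul_assoc r a x := LinearMap.congr_fun (map_smul f r a) x

/-- The universal property of Kähler differentials: the map `Ω → X` with `D a ↦ δ a` and
`a ω ↦ f a (ω)`. -/
def kaehlerLift (δ : A →ₗ[k] X) (h : ∀ a b, δ (a * b) = f a (δ b) + f b (δ a)) :
    Ω[A⁄k] →ₗ[k] X :=
  ((Derivation.mk' (show A →ₗ[k] ViaEnd f from δ) h).liftKaehlerDifferential).restrictScalars k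

theorem kaehlerLift_D (δ : A →ₗ[k] X) (h : ∀ a b, δ (a * b) = f a (δ b) + f b (δ a)) (a b : A) :
    kaehlerLift f δ h (a • KaehlerDifferential.D k A b) = f a (δ b) :=
  (map_smul ((Derivation.mk' (show A →ₗ[k] ViaEnd f from δ) h).liftKaehlerDifferential) a _).trans
    (congrArg (f a) (Derivation.liftKaehlerDifferential_comp_D
      (Derivation.mk' (show A →ₗ[k] ViaEnd f from δ) h) b))

end ViaEnd

variable (k A)

/-- The algebra map by which `A ⊗ A` acts on `A ⊗ Ω`. -/
def actionL : A ⊗[k] A →ₐ[k] Module.End k (A ⊗[k] Ω[A⁄k]) :=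
  (Module.endTensorEndAlgHom (R := k) (S := k) (A := k) (M := A) (N := Ω[A⁄k])).comp
    (Algebra.TensorProduct.map (Algebra.lsmul k k A) (Algebra.lsmul k k Ω[A⁄k]))

/-- The algebra map by which `A ⊗ A` acts on `Ω ⊗ A`. -/
def actionR : A ⊗[k] A →ₐ[k] Module.End k (Ω[A⁄k] ⊗[k] A) :=
  (Module.endTensorEndAlgHom (R := k) (S := k) (A := k) (M := Ω[A⁄k]) (N := A)).comp
    (Algebra.TensorProduct.map (Algebra.lsmul k k Ω[A⁄k]) (Algebra.lsmul k k A))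

theorem actionL_tmul (a b c : A) (ω : Ω[A⁄k]) :
    actionL k A (a ⊗ₜ b) (c ⊗ₜ ω) = (a * c) ⊗ₜ (b • ω) := rfl

theorem actionR_tmul (a b c : A) (ω : Ω[A⁄k]) :
    actionR k A (a ⊗ₜ b) (ω ⊗ₜ c) = (a • ω) ⊗ₜ (b * c) := rfl

/-- The universal derivation `D : A → Ω` as a linear map. -/
abbrev kaehlerD : A →ₗ[k] Ω[A⁄k] := (KaehlerDifferential.D k A).toLinearMap

theorem actionL_leibniz (s t : A ⊗[k] A) : (kaehlerD k A).lTensor A (s * t) =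
    actionL k A s ((kaehlerD k A).lTensor A t) + actionL k A t ((kaehlerD k A).lTensor A s) := by
  induction s with
  | zero => simp
  | add x y hx hy => simp only [add_mul, map_add, hx, hy, LinearMap.add_apply]; abel
  | tmul a b =>
    induction t with
    | zero => simp
    | add x y hx hy => simp only [mul_add, map_add, hx, hy, LinearMap.add_apply]; abel
    | tmul c e => simp [actionL_tmul, TensorProduct.tmul_add, mul_comm a c]

theorem actionR_leibniz (s t : A ⊗[k] A) : (kaehlerD k A).rTensor A (s * t) =
    actionR k A s ((kaehlerD k A).rTensor A t) + actionR k A t ((kaehlerD k A).rTensor A s) := by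
  induction s with
  | zero => simp
  | add x y hx hy => simp only [add_mul, map_add, hx, hy, LinearMap.add_apply]; abel
  | tmul a b =>
    induction t with
    | zero => simp
    | add x y hx hy => simp only [mul_add, map_add, hx, hy, LinearMap.add_apply]; abel
    | tmul c e => simp [actionR_tmul, TensorProduct.add_tmul, mul_comm b e]

/-- The left coaction `a db ↦ a₍₁₎ b₍₁₎ ⊗ a₍₂₎ db₍₂₎` on Kähler differentials. -/
def kaehlerCoactL : Ω[A⁄k] →ₗ[k] A ⊗[k] Ω[A⁄k] :=
  kaehlerLift ((actionL k A).comp (Bialgebra.comulAlgHom k A))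
    ((kaehlerD k A).lTensor A ∘ₗ comul) fun a b => by
      simp only [LinearMap.comp_apply, Bialgebra.comul_mul, actionL_leibniz]
      rfl

/-- The right coaction `a db ↦ a₍₁₎ db₍₁₎ ⊗ a₍₂₎ b₍₂₎` on Kähler differentials. -/
def kaehlerCoactR : Ω[A⁄k] →ₗ[k] Ω[A⁄k] ⊗[k] A :=
  kaehlerLift ((actionR k A).comp (Bialgebra.comulAlgHom k A))
    ((kaehlerD k A).rTensor A ∘ₗ comul) fun a b => by
      simp only [LinearMap.comp_apply, Bialgebra.comul_mul, actionR_leibniz]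
      rfl

/-- The action `a ⊗ ω ↦ a ω`. -/
def kaehlerAct : A ⊗[k] Ω[A⁄k] →ₗ[k] Ω[A⁄k] :=
  TensorProduct.lift (Algebra.lsmul k k Ω[A⁄k]).toLinearMap

/-- The surjection `a ⊗ b ↦ a db`. -/
def kaehlerProj : A ⊗[k] A →ₗ[k] Ω[A⁄k] := kaehlerAct k A ∘ₗ (kaehlerD k A).lTensor A

theorem kaehlerProj_surjective : Function.Surjective (kaehlerProj k A) := by
  intro ω
  have h : ω ∈ Submodule.span A (Set.range (KaehlerDifferential.D k A)) := by
    rw [KaehlerDifferential.span_range_derivation]; trivial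
  induction h using Submodule.span_induction with
  | mem x hx =>
    obtain ⟨b, rfl⟩ := hx
    exact ⟨1 ⊗ₜ b, by simp [kaehlerProj, kaehlerAct]⟩
  | zero => exact ⟨0, map_zero _⟩
  | add x y _ _ hx hy =>
    obtain ⟨s, rfl⟩ := hx
    obtain ⟨t, rfl⟩ := hy
    exact ⟨s + t, map_add _ _ _⟩
  | smul a x _ hx =>
    obtain ⟨s, rfl⟩ := hx
    refine ⟨(LinearMap.mulLeft k a).rTensor A s, ?_⟩
    exact Bicomodule.lin_ext (kaehlerProj k A ∘ₗ (LinearMap.mulLeft k a).rTensor A)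
      (Algebra.lsmul k k Ω[A⁄k] a ∘ₗ kaehlerProj k A) s fun x y => by
        simp [kaehlerProj, kaehlerAct]

theorem kaehlerCoactL_proj (t : A ⊗[k] A) : kaehlerCoactL k A (kaehlerProj k A t) =
    (kaehlerProj k A).lTensor A
      (((Bicomodule.regular k A).codiag (Bicomodule.regular k A)).coactL t) := by
  refine Bicomodule.lin_ext (kaehlerCoactL k A ∘ₗ kaehlerProj k A)
    ((kaehlerProj k A).lTensor A ∘ₗ
      ((Bicomodule.regular k A).codiag (Bicomodule.regular k A)).coactL) t fun a b => ?_
  refine (kaehlerLift_D _ _ _ a b).trans ?_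
  exact Bicomodule.lin_ext4 (TensorProduct.lift ((actionL k A).toLinearMap.compr₂
      (LinearMap.id)) ∘ₗ ((kaehlerD k A).lTensor A).lTensor (A ⊗[k] A))
    ((kaehlerProj k A).lTensor A ∘ₗ (LinearMap.mul' k A).rTensor (A ⊗[k] A) ∘ₗ
      Bicomodule.swap k A A A A) (comul a) (comul b)
    fun x y z t => by simp [actionL_tmul, kaehlerProj, kaehlerAct]

theorem kaehlerCoactR_proj (t : A ⊗[k] A) : kaehlerCoactR k A (kaehlerProj k A t) =
    (kaehlerProj k A).rTensor A
      (((Bicomodule.regular k A).codiag (Bicomodule.regular k A)).coactR t) := by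
  refine Bicomodule.lin_ext (kaehlerCoactR k A ∘ₗ kaehlerProj k A)
    ((kaehlerProj k A).rTensor A ∘ₗ
      ((Bicomodule.regular k A).codiag (Bicomodule.regular k A)).coactR) t fun a b => ?_
  refine (kaehlerLift_D _ _ _ a b).trans ?_
  exact Bicomodule.lin_ext4 (TensorProduct.lift ((actionR k A).toLinearMap.compr₂
      (LinearMap.id)) ∘ₗ ((kaehlerD k A).rTensor A).lTensor (A ⊗[k] A))
    ((kaehlerProj k A).rTensor A ∘ₗ (LinearMap.mul' k A).lTensor (A ⊗[k] A) ∘ₗ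
      Bicomodule.swap k A A A A) (comul a) (comul b)
    fun x y z t => by simp [actionR_tmul, kaehlerProj, kaehlerAct]

/-- Kähler differentials as a bicomodule. -/
def kaehlerBicomodule : Bicomodule k A Ω[A⁄k] :=
  ((Bicomodule.regular k A).codiag (Bicomodule.regular k A)).ofSurjective (kaehlerProj k A)
    (kaehlerProj_surjective k A) (kaehlerCoactL k A) (kaehlerCoactR k A)
    (kaehlerCoactL_proj k A) (kaehlerCoactR_proj k A)

theorem kaehlerProj_bicovariant : ((Bicomodule.regular k A).codiag
    (Bicomodule.regular k A)).IsBicovariant (kaehlerBicomodule k A) (kaehlerProj k A) :=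
  ⟨fun t => (kaehlerCoactL_proj k A t).symm, fun t => (kaehlerCoactR_proj k A t).symm⟩

theorem kaehlerAct_bicovariant : ((Bicomodule.regular k A).codiag
    (kaehlerBicomodule k A)).IsBicovariant (kaehlerBicomodule k A) (kaehlerAct k A) := by
  refine (((kaehlerProj_bicovariant k A).lTensor (Bicomodule.regular k A)).push
    (Bialgebra.mulCoalgHom k A)).of_surjective
      (LinearMap.lTensor_surjective A (kaehlerProj_surjective k A)) ?_
  have h := (kaehlerProj_bicovariant k A).comp
    (((TwoCocycle.mul'_bicovariant (k := k) (H := A)).rTensor (Bicomodule.regular k A)).push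
      (Bialgebra.mulCoalgHom k A) |>.comp (Bicomodule.codiag_assoc_symm (Bicomodule.regular k A)
        (Bicomodule.regular k A) (Bicomodule.regular k A)))
  have e : kaehlerAct k A ∘ₗ (kaehlerProj k A).lTensor A = kaehlerProj k A ∘ₗ
      (LinearMap.mul' k A).rTensor A ∘ₗ (TensorProduct.assoc k A A A).symm.toLinearMap := by
    refine TensorProduct.ext' fun a t => ?_
    exact Bicomodule.lin_ext (kaehlerAct k A ∘ₗ (kaehlerProj k A).lTensor A ∘ₗ
      TensorProduct.mk k _ _ a) (kaehlerProj k A ∘ₗ (LinearMap.mul' k A).rTensor A ∘ₗ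
        (TensorProduct.assoc k A A A).symm.toLinearMap ∘ₗ TensorProduct.mk k _ _ a) t
      fun b c => by simp [kaehlerProj, kaehlerAct]
  rw [e]
  exact h

theorem Bicomodule.codiag_comm {k A : Type*} [CommRing k] [CommRing A] [Bialgebra k A]
    {V : Type*} [AddCommGroup V] [Module k V]
    {W : Type*} [AddCommGroup W] [Module k W] (M : Bicomodule k A V) (N : Bicomodule k A W) :
    (M.codiag N).IsBicovariant (N.codiag M) (TensorProduct.comm k V W).toLinearMap := by
  constructor
  · intro t
    refine lin_ext ((TensorProduct.comm k V W).toLinearMap.lTensor A ∘ₗ (M.codiag N).coactL)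
      ((N.codiag M).coactL ∘ₗ (TensorProduct.comm k V W).toLinearMap) t fun v w => ?_
    exact lin_ext4 ((TensorProduct.comm k V W).toLinearMap.lTensor A ∘ₗ
        (LinearMap.mul' k A).rTensor _ ∘ₗ swap k A V A W)
      ((LinearMap.mul' k A).rTensor _ ∘ₗ swap k A W A V ∘ₗ
        (TensorProduct.comm k _ _).toLinearMap) (M.coactL v) (N.coactL w)
      fun a x b y => by simp [mul_comm a b]
  · intro t
    refine lin_ext ((TensorProduct.comm k V W).toLinearMap.rTensor A ∘ₗ (M.codiag N).coactR)
      ((N.codiag M).coactR ∘ₗ (TensorProduct.comm k V W).toLinearMap) t fun v w => ?_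
    exact lin_ext4 ((TensorProduct.comm k V W).toLinearMap.rTensor A ∘ₗ
        (LinearMap.mul' k A).lTensor _ ∘ₗ swap k V A W A)
      ((LinearMap.mul' k A).lTensor _ ∘ₗ swap k W A V A ∘ₗ
        (TensorProduct.comm k _ _).toLinearMap) (M.coactR v) (N.coactR w)
      fun x a y b => by simp [mul_comm a b]

/-- The classical calculus of a commutative bialgebra: Kähler differentials with the symmetric
bimodule structure `ω a = a ω`. -/
def classicalCalculus : BicovariantCalculus k A Ω[A⁄k] where
  toBicomodule := kaehlerBicomodule k A
  lact := kaehlerAct k A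
  ract := kaehlerAct k A ∘ₗ (TensorProduct.comm k Ω[A⁄k] A).toLinearMap
  one_lact e := one_smul A e
  mul_lact a b e := mul_smul a b e
  ract_one e := one_smul A e
  ract_mul e a b := (congrArg (· • e) (mul_comm a b)).trans (mul_smul b a e)
  lact_ract a e b := smul_comm b a e
  lact_covariant := kaehlerAct_bicovariant k A
  ract_covariant := (kaehlerAct_bicovariant k A).comp (Bicomodule.codiag_comm _ _)
  d := kaehlerD k A
  leibniz a b := ((KaehlerDifferential.D k A).leibniz a b).trans (add_comm _ _)
  range_eq_top := LinearMap.range_eq_top.mpr (kaehlerProj_surjective k A)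
  d_covariant := by
    constructor
    · intro b
      refine Eq.trans ?_ (congrArg (kaehlerCoactL k A) (one_smul A (kaehlerD k A b)))
      refine Eq.trans ?_ (kaehlerLift_D _ _ _ 1 b).symm
      rw [map_one]; rfl
    · intro b
      refine Eq.trans ?_ (congrArg (kaehlerCoactR k A) (one_smul A (kaehlerD k A b)))
      refine Eq.trans ?_ (kaehlerLift_D _ _ _ 1 b).symm
      rw [map_one]; rfl

end Classical

section Connections

/-- The unique linear map with the property `P`; it is `0` by convention where no map or more than
one map has the property, which does not happen in the uses below. -/
def theMap {V : Type*} [AddCommGroup V] [Module k V] {W : Type*} [AddCommGroup W] [Module k W]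
    (P : (V →ₗ[k] W) → Prop) : V →ₗ[k] W :=
  open Classical in if h : ∃! f, P f then h.choose else 0

variable {H : Type*} [Ring H] [Bialgebra k H] {E : Type*} [AddCommGroup E] [Module k E]

/-- The left-invariant elements, `Δ_E(e) = 1 ⊗ e`. -/
def Bicomodule.leftInv (M : Bicomodule k H E) : Submodule k E :=
  LinearMap.eqLocus M.coactL (TensorProduct.mk k H E 1)

/-- The right-invariant elements, `_EΔ(e) = e ⊗ 1`. -/
def Bicomodule.rightInv (M : Bicomodule k H E) : Submodule k E :=
  LinearMap.eqLocus M.coactR ((TensorProduct.mk k E H).flip 1)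

namespace BicovariantBimodule

variable (M : BicovariantBimodule k H E)

/-- The defining property of Woronowicz's braiding on `E ⊗_H E`: it is a bimodule map and
`σ(ω ⊗ η) = η ⊗ ω` for `ω` left-invariant and `η` right-invariant. -/
structure IsBraiding (σ : TensorOver M M →ₗ[k] TensorOver M M) : Prop where
  map_lact : ∀ a x, σ ((tensor M M).lact (a ⊗ₜ x)) = (tensor M M).lact (a ⊗ₜ σ x)
  map_ract : ∀ x a, σ ((tensor M M).ract (x ⊗ₜ a)) = (tensor M M).ract (σ x ⊗ₜ a)
  exchange : ∀ ω ∈ M.leftInv, ∀ η ∈ M.rightInv, σ (proj M M (ω ⊗ₜ η)) = proj M M (η ⊗ₜ ω)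

/-- Woronowicz's braiding `σ : E ⊗_H E → E ⊗_H E`. -/
def braiding : TensorOver M M →ₗ[k] TensorOver M M := theMap (IsBraiding M)

/-- The canonical map `₀E ⊗ ₀E → E ⊗_H E` (the tensor product on the left is over `k`), by which
`₀E ⊗ ₀E` is identified with the left-invariant elements of `E ⊗_H E`. -/
def incl : M.leftInv ⊗[k] M.leftInv →ₗ[k] TensorOver M M :=
  proj M M ∘ₗ TensorProduct.map M.leftInv.subtype M.leftInv.subtype

/-- The restriction `₀σ` of the braiding to `₀E ⊗ ₀E`. -/
def braiding₀ : Module.End k (M.leftInv ⊗[k] M.leftInv) :=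
  theMap fun f => incl M ∘ₗ f = braiding M ∘ₗ incl M

/-- The idempotent `₀Psym` on `₀E ⊗ ₀E` whose range is the eigenspace of `₀σ` for the eigenvalue
`1` and whose kernel is the sum of the eigenspaces for all the other eigenvalues. -/
def symmetrizer₀ : Module.End k (M.leftInv ⊗[k] M.leftInv) :=
  theMap fun p => p ∘ₗ p = p ∧ LinearMap.range p = LinearMap.ker (braiding₀ M - 1) ∧
    LinearMap.ker p = ⨆ (c : k) (_ : c ≠ 1), Module.End.eigenspace (braiding₀ M) c

/-- The multiplication map `v : H ⊗ ₀E ⊗ ₀E → E ⊗_H E`, `a ⊗ ω ⊗ ω' ↦ a ω ⊗ ω'`. -/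
def mulMap : H ⊗[k] (M.leftInv ⊗[k] M.leftInv) →ₗ[k] TensorOver M M :=
  (tensor M M).lact ∘ₗ (incl M).lTensor H

/-- A left `H`-linear pseudo-Riemannian metric on `E`. -/
structure IsLeftMetric (g : TensorOver M M →ₗ[k] H) : Prop where
  map_lact : ∀ a x, g ((tensor M M).lact (a ⊗ₜ x)) = a * g x
  map_braiding : ∀ x, g (braiding M x) = g x
  nondegenerate : ∀ f, (∀ e, g (proj M M (e ⊗ₜ f)) = 0) → f = 0

/-- Left invariance `(id ⊗ εg) Δ_{E ⊗ E} = g` and right invariance `(εg ⊗ id) _{E ⊗ E}Δ = g`. -/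
structure IsBiinvariant (g : TensorOver M M →ₗ[k] H) : Prop where
  left : ∀ x, TensorProduct.rid k H
    ((counit (R := k) ∘ₗ g).lTensor H ((tensor M M).coactL x)) = g x
  right : ∀ x, TensorProduct.lid k H
    ((counit (R := k) ∘ₗ g).rTensor H ((tensor M M).coactR x)) = g x

variable (g : TensorOver M M →ₗ[k] H) (conn : E →ₗ[k] TensorOver M M)

/-- The restriction `∇ : ₀E → ₀E ⊗ ₀E` of a left-covariant connection. -/
def conn₀ : M.leftInv →ₗ[k] M.leftInv ⊗[k] M.leftInv :=
  theMap fun f => incl M ∘ₗ f = conn ∘ₗ M.leftInv.subtype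

/-- The map `g ⊗ id : ₀E ⊗ ₀E ⊗ ₀E → E`. -/
def metricLeft : M.leftInv ⊗[k] M.leftInv ⊗[k] M.leftInv →ₗ[k] E :=
  M.lact ∘ₗ TensorProduct.map (g ∘ₗ incl M) M.leftInv.subtype

/-- The map `id ⊗ g : ₀E ⊗ ₀E ⊗ ₀E → E`. -/
def metricRight : M.leftInv ⊗[k] (M.leftInv ⊗[k] M.leftInv) →ₗ[k] E :=
  M.ract ∘ₗ TensorProduct.map M.leftInv.subtype (g ∘ₗ incl M)

/-- The map `(g ⊗ id)(id ⊗ σ)(id ⊗ ∇)` on `₀E ⊗ ₀E`. -/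
def connRight : M.leftInv ⊗[k] M.leftInv →ₗ[k] E :=
  metricLeft M g ∘ₗ (TensorProduct.assoc k _ _ _).symm.toLinearMap ∘ₗ
    (braiding₀ M).lTensor M.leftInv ∘ₗ (conn₀ M conn).lTensor M.leftInv

/-- The map `(id ⊗ g)(∇ ⊗ id)` on `₀E ⊗ ₀E`. -/
def connLeft : M.leftInv ⊗[k] M.leftInv →ₗ[k] E :=
  metricRight M g ∘ₗ (TensorProduct.assoc k _ _ _).toLinearMap ∘ₗ
    (conn₀ M conn).rTensor M.leftInv

/-- Compatibility in the sense of Heckenberger and Schmüdgen: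
`(id ⊗ g)(∇ ⊗ id) + (g ⊗ id)(id ⊗ σ)(id ⊗ ∇) = 0` on `₀E ⊗ ₀E`. -/
def HSCompatible : Prop := connLeft M g conn + connRight M g conn = 0

/-- The map `Π⁰ = 2 (g ⊗ id)(id ⊗ σ)(id ⊗ ∇) ₀Psym` on `₀E ⊗ ₀E`. -/
def compat₀ : M.leftInv ⊗[k] M.leftInv →ₗ[k] E :=
  (2 : k) • (connRight M g conn ∘ₗ symmetrizer₀ M)

end BicovariantBimodule

namespace BicovariantCalculus

variable (C : BicovariantCalculus k H E)

/-- The tensor square `E ⊗_H E`. -/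
abbrev Square : Type _ :=
  BicovariantBimodule.TensorOver C.toBicovariantBimodule C.toBicovariantBimodule

/-- The bicovariant bimodule structure on `E ⊗_H E`. -/
abbrev square : BicovariantBimodule k H C.Square :=
  BicovariantBimodule.tensor C.toBicovariantBimodule C.toBicovariantBimodule

/-- A left connection: `∇(a e) = a ∇(e) + da ⊗ e`. -/
def IsLeftConnection (conn : E →ₗ[k] C.Square) : Prop :=
  ∀ a e, conn (C.lact (a ⊗ₜ e)) = C.square.lact (a ⊗ₜ conn e) +
    BicovariantBimodule.proj C.toBicovariantBimodule C.toBicovariantBimodule (C.d a ⊗ₜ e)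

variable (g : C.Square →ₗ[k] H) (conn : E →ₗ[k] C.Square)

/-- The extension `Π : E ⊗_H E → E` of `Π⁰`, determined by
`Π(a ω ⊗ ω') = a Π⁰(ω ⊗ ω') + (da) g(ω ⊗ ω')` for `a` in `H` and `ω`, `ω'` left-invariant. -/
def compatMap : C.Square →ₗ[k] E :=
  theMap fun F => F ∘ₗ BicovariantBimodule.mulMap C.toBicovariantBimodule =
    C.lact ∘ₗ (BicovariantBimodule.compat₀ C.toBicovariantBimodule g conn).lTensor H +
      C.ract ∘ₗ TensorProduct.map C.d (g ∘ₗ BicovariantBimodule.incl C.toBicovariantBimodule)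

/-- Metric compatibility `Π = dg`. -/
def Compatible : Prop := C.compatMap g conn = C.d ∘ₗ g

end BicovariantCalculus

end Connections

end

end BicovCalc

open BicovCalc

/-! Write `L` for `connLeft`, `R` for `connRight` and `τ` for the flip of two tensor factors. The
tensor square of the deformed calculus is free over the deformed algebra on `₀E ⊗ ₀E`, and a
bi-invariant metric takes scalar values there. Hence `d (g (a t)) = (da) g(t)`, and `Π = d ∘ g` says
exactly that `Π⁰ = 0`. If `₀σ` is an involution, then `₀Psym = (1 + ₀σ) / 2` and `Π⁰ = R + R ∘ ₀σ`,
whereas the condition of Heckenberger and Schmüdgen is `L + R = 0`. So two facts suffice: `₀σ² = 1`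
and `L = R ∘ ₀σ` (`compatible_iff_of_connLeft_eq`).

Without deformation both are immediate. The bimodule is symmetric, so the braiding is `τ`. If `∇v`
is a sum of terms `p ⊗ q`, then `L (v ⊗ u)` is the sum of the `p g(q ⊗ u)` and `R (u ⊗ v)` is the
sum of the `g(u ⊗ q) p`, and these agree because `g` is symmetric.

The deformed case reduces to this one because cocycle deformation is monoidal: by `deform_assoc`,
associativity between bicovariant bilinear maps survives the deformation. The twist by `γ` induces
an isomorphism from the tensor square of the deformed bimodule to the deformation of the original
tensor square (`deformTensor`, `deformTensor_bijective`). Transporting the flip along it gives the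
braiding (`deformFlip_isBraiding`, `IsBraiding.unique`), so that `₀σ = twist₀⁻¹ ∘ τ ∘ twist₀`, an
involution. The metric and the connection, carried over in the same way, become a symmetric
bicovariant form `untwistMetric` and a bicovariant map `untwistConn`. In these terms `L` and `R` are
the undeformed expressions composed with `twist₀` (`connLeft_eq`, `connRight_eq`), and the
computation above applies.

Freeness comes from the fundamental theorem of Hopf modules (`IsHopfModule.lift_bijective`), proved
for the undeformed algebra and carried through the twist. No antipode on the deformed algebra is
used. -/

namespace BicovCalc

open scoped TensorProduct
open Coalgebra TensorProduct

noncomputable section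

/-! ### Hopf modules over a commutative Hopf algebra and their coinvariants. -/

section HopfModule

variable {k : Type*} [CommRing k] {A : Type*} [CommRing A] [Algebra k A]
  {E : Type*} [AddCommGroup E] [Module k E]

/-- The algebra map by which `A ⊗ A` acts on `A ⊗ E`, for an action of `A` on `E`. -/
def tensorAction (α : A →ₐ[k] Module.End k E) : A ⊗[k] A →ₐ[k] Module.End k (A ⊗[k] E) :=
  (Module.endTensorEndAlgHom (R := k) (S := k) (A := k) (M := A) (N := E)).comp
    (Algebra.TensorProduct.map (Algebra.lsmul k k A) α)

theorem tensorAction_tmul (α : A →ₐ[k] Module.End k E) (a b c : A) (e : E) :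
    tensorAction α (a ⊗ₜ b) (c ⊗ₜ e) = (a * c) ⊗ₜ α b e := rfl

/-- A one-sided Hopf module over the commutative Hopf algebra with coproduct `δ`, counit `ε` and
antipode `S`: an action `α` and a coaction `ρ` with `ρ(a e) = δ(a) ρ(e)`. The Hopf algebra
structure is explicit, so that it can be replaced by the co-opposite one. -/
structure IsHopfModule (S : A →ₗ[k] A) (ε : A →ₗ[k] k) (δ : A →ₐ[k] A ⊗[k] A)
    (ρ : E →ₗ[k] A ⊗[k] E) (α : A →ₐ[k] Module.End k E) : Prop where
  rid : ∀ a, TensorProduct.rid k A (ε.lTensor A (δ a)) = a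
  antipode_left : ∀ a, LinearMap.mul' k A (S.rTensor A (δ a)) = algebraMap k A (ε a)
  antipode_right : ∀ a, LinearMap.mul' k A (S.lTensor A (δ a)) = algebraMap k A (ε a)
  counit : ∀ e, TensorProduct.lid k E (ε.rTensor E (ρ e)) = e
  coassoc : ∀ e, TensorProduct.assoc k A A E (δ.toLinearMap.rTensor E (ρ e)) = ρ.lTensor A (ρ e)
  map_act : ∀ a e, ρ (α a e) = tensorAction α (δ a) (ρ e)

/-- The convolution `e ↦ β(e₍₋₁₎) f(e₍₀₎)`. -/
def convAct {X : Type*} [AddCommGroup X] [Module k X] (ρ : E →ₗ[k] A ⊗[k] E)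
    (β : A →ₗ[k] Module.End k X) (f : E →ₗ[k] X) : E →ₗ[k] X :=
  TensorProduct.lift β ∘ₗ f.lTensor A ∘ₗ ρ

namespace IsHopfModule

variable {S : A →ₗ[k] A} {ε : A →ₗ[k] k} {δ : A →ₐ[k] A ⊗[k] A}
    {ρ : E →ₗ[k] A ⊗[k] E} {α : A →ₐ[k] Module.End k E}
  {X : Type*} [AddCommGroup X] [Module k X]

/-- By coassociativity the two convolutions merge into one with `β * β'`, which by hypothesis is the
convolution unit. Convolving with `β'` is thus injective, which is how equalities of maps out of `E`
are proved below. -/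
theorem convAct_convAct (h : IsHopfModule S ε δ ρ α) (β β' : A →ₗ[k] Module.End k X)
    (f : E →ₗ[k] X)
    (hβ : ∀ a, LinearMap.mul' k (Module.End k X) (TensorProduct.map β β' (δ a)) =
      algebraMap k _ (ε a)) :
    convAct ρ β (convAct ρ β' f) = f := by
  ext e
  let G : A ⊗[k] (A ⊗[k] E) →ₗ[k] X :=
    TensorProduct.lift β ∘ₗ (TensorProduct.lift β' ∘ₗ f.lTensor A).lTensor A
  have h1 : convAct ρ β (convAct ρ β' f) e = G (ρ.lTensor A (ρ e)) :=
    Bicomodule.lin_ext (TensorProduct.lift β ∘ₗ (convAct ρ β' f).lTensor A) (G ∘ₗ ρ.lTensor A)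
      (ρ e) fun a b => rfl
  rw [h1, ← h.coassoc]
  conv_rhs => rw [← h.counit e]
  refine Bicomodule.lin_ext (G ∘ₗ (TensorProduct.assoc k A A E).toLinearMap ∘ₗ
    δ.toLinearMap.rTensor E) (f ∘ₗ (TensorProduct.lid k E).toLinearMap ∘ₗ ε.rTensor E) (ρ e)
    fun a e => ?_
  refine (Bicomodule.lin_ext (G ∘ₗ (TensorProduct.assoc k A A E).toLinearMap ∘ₗ
    (TensorProduct.mk k _ E).flip e) (LinearMap.applyₗ (f e) ∘ₗ LinearMap.mul' k _ ∘ₗ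
      TensorProduct.map β β') (δ a) fun x y => rfl).trans ?_
  refine (congrArg (LinearMap.applyₗ (f e)) (hβ a)).trans ?_
  simp [Module.algebraMap_end_apply]

theorem antipode_convAct (h : IsHopfModule S ε δ ρ α) (β : A →ₐ[k] Module.End k X)
    (f : E →ₗ[k] X) :
    convAct ρ (β.toLinearMap ∘ₗ S) (convAct ρ β.toLinearMap f) = f := by
  refine h.convAct_convAct _ _ f fun a => ?_
  refine (Bicomodule.lin_ext (LinearMap.mul' k _ ∘ₗ TensorProduct.map (β.toLinearMap ∘ₗ S)
    β.toLinearMap) (β.toLinearMap ∘ₗ LinearMap.mul' k A ∘ₗ S.rTensor A) (δ a)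
    fun x y => by simp).trans ?_
  refine (congrArg β (h.antipode_left a)).trans ?_
  simp

theorem convAct_antipode (h : IsHopfModule S ε δ ρ α) (β : A →ₐ[k] Module.End k X)
    (f : E →ₗ[k] X) :
    convAct ρ β.toLinearMap (convAct ρ (β.toLinearMap ∘ₗ S) f) = f := by
  refine h.convAct_convAct _ _ f fun a => ?_
  refine (Bicomodule.lin_ext (LinearMap.mul' k _ ∘ₗ TensorProduct.map β.toLinearMap
    (β.toLinearMap ∘ₗ S)) (β.toLinearMap ∘ₗ LinearMap.mul' k A ∘ₗ S.lTensor A) (δ a)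
    fun x y => by simp).trans ?_
  refine (congrArg β (h.antipode_right a)).trans ?_
  simp

/-- The projection `e ↦ S(e₍₋₁₎) e₍₀₎` onto the coinvariants. -/
def coinvProj (S : A →ₗ[k] A) (ρ : E →ₗ[k] A ⊗[k] E) (α : A →ₐ[k] Module.End k E) : E →ₗ[k] E :=
  convAct ρ (α.toLinearMap ∘ₗ S) LinearMap.id

/-- The maps `ρ ∘ P` and `1 ⊗ P`, with `P` the projection, have the same convolution with the
algebra map `β = tensorAction α ∘ δ`, and that convolution is invertible. The detour avoids any
formula for the coproduct of an antipode. -/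
theorem coinvProj_invariant (h : IsHopfModule S ε δ ρ α) (e : E) :
    ρ (coinvProj S ρ α e) = 1 ⊗ₜ coinvProj S ρ α e := by
  let β : A →ₐ[k] Module.End k (A ⊗[k] E) := (tensorAction α).comp δ
  have hP := h.convAct_antipode α LinearMap.id
  -- Since `ρ` is `A`-linear, the convolution is `ρ` applied to `e₍₋₁₎ P(e₍₀₎) = e`.
  have h1 : convAct ρ β.toLinearMap (ρ ∘ₗ coinvProj S ρ α) = ρ := by
    refine Eq.trans ?_ (congrArg (fun f => ρ ∘ₗ f) hP)
    refine LinearMap.ext fun e => Bicomodule.lin_ext (TensorProduct.lift β.toLinearMap ∘ₗ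
      (ρ ∘ₗ coinvProj S ρ α).lTensor A) (ρ ∘ₗ TensorProduct.lift α.toLinearMap ∘ₗ
        (coinvProj S ρ α).lTensor A) (ρ e) fun a e => ?_
    exact (h.map_act a _).symm
  -- Here the convolution is `e₍₋₂₎ ⊗ e₍₋₁₎ P(e₍₀₎)`; coassociativity turns it into `e₍₋₁₎ ⊗ e₍₀₎`.
  have h2 : convAct ρ β.toLinearMap (TensorProduct.mk k A E 1 ∘ₗ coinvProj S ρ α) = ρ := by
    ext e
    let G : A ⊗[k] (A ⊗[k] E) →ₗ[k] A ⊗[k] E :=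
      (TensorProduct.lift α.toLinearMap ∘ₗ (coinvProj S ρ α).lTensor A).lTensor A
    refine Eq.trans (b := G (TensorProduct.assoc k A A E (δ.toLinearMap.rTensor E (ρ e)))) ?_ ?_
    · refine Bicomodule.lin_ext (TensorProduct.lift β.toLinearMap ∘ₗ
        (TensorProduct.mk k A E 1 ∘ₗ coinvProj S ρ α).lTensor A) (G ∘ₗ
          (TensorProduct.assoc k A A E).toLinearMap ∘ₗ δ.toLinearMap.rTensor E) (ρ e)
        fun a e => ?_
      exact Bicomodule.lin_ext (LinearMap.applyₗ (1 ⊗ₜ coinvProj S ρ α e) ∘ₗ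
        (tensorAction α).toLinearMap) (G ∘ₗ (TensorProduct.assoc k A A E).toLinearMap ∘ₗ
          (TensorProduct.mk k _ E).flip e) (δ a) fun x y => by
            simp [tensorAction_tmul, G]
    · rw [h.coassoc]
      refine (Bicomodule.lin_ext (G ∘ₗ ρ.lTensor A)
        ((convAct ρ α.toLinearMap (coinvProj S ρ α)).lTensor A) (ρ e) fun a e => rfl).trans ?_
      rw [coinvProj, hP, LinearMap.lTensor_id, LinearMap.id_apply]
  have h3 := congrArg (convAct ρ (β.toLinearMap ∘ₗ S)) (h1.trans h2.symm)
  rw [h.antipode_convAct, h.antipode_convAct] at h3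
  exact LinearMap.congr_fun h3 e

/-- The coinvariants generate `E`. -/
theorem lift_surjective (h : IsHopfModule S ε δ ρ α) (e : E) (I : Submodule k E)
    (hI : ∀ e, ρ e = 1 ⊗ₜ e → e ∈ I) :
    ∃ t : A ⊗[k] I, TensorProduct.lift α.toLinearMap (I.subtype.lTensor A t) = e := by
  let P : E →ₗ[k] I := (coinvProj S ρ α).codRestrict I fun e => hI _ (h.coinvProj_invariant e)
  refine ⟨P.lTensor A (ρ e), ?_⟩
  rw [← LinearMap.lTensor_comp_apply]
  exact LinearMap.congr_fun (h.convAct_antipode α LinearMap.id) e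

/-- The fundamental theorem of Hopf modules: `A ⊗ I → E` is bijective for the space `I` of
coinvariants. -/
theorem lift_bijective (h : IsHopfModule S ε δ ρ α) (I : Submodule k E)
    (hI : ∀ e, e ∈ I ↔ ρ e = 1 ⊗ₜ e) :
    Function.Bijective (TensorProduct.lift α.toLinearMap ∘ₗ I.subtype.lTensor A) := by
  refine ⟨?_, fun e => h.lift_surjective e I fun e => (hI e).2⟩
  let P : E →ₗ[k] I := (coinvProj S ρ α).codRestrict I fun e =>
    (hI _).2 (h.coinvProj_invariant e)
  -- For coinvariant `e` one has `ρ(a e) = a₍₁₎ ⊗ a₍₂₎ e`.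
  have hρ : ∀ (a : A) (e : I), ρ (α a e) = TensorProduct.map LinearMap.id
      (LinearMap.applyₗ (e : E) ∘ₗ α.toLinearMap) (δ a) := fun a e => by
    rw [h.map_act, (hI _).1 e.2]
    exact Bicomodule.lin_ext (LinearMap.applyₗ (1 ⊗ₜ (e : E)) ∘ₗ
        (tensorAction α).toLinearMap) (TensorProduct.map LinearMap.id
      (LinearMap.applyₗ (e : E) ∘ₗ α.toLinearMap)) (δ a) fun x y => by
        simp [tensorAction_tmul]
  -- `P(a e) = S(a₍₁₎) a₍₂₎ e`, and the antipode axiom collapses the coefficient.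
  have hP : ∀ (a : A) (e : I), P (α a e) = ε a • e := fun a e => by
    refine Subtype.ext ((congrArg (TensorProduct.lift (α.toLinearMap ∘ₗ S)) ((congrArg
      (LinearMap.lTensor A LinearMap.id) (hρ a e)))).trans ?_)
    refine (Bicomodule.lin_ext (TensorProduct.lift (α.toLinearMap ∘ₗ S) ∘ₗ
      LinearMap.lTensor A LinearMap.id ∘ₗ TensorProduct.map LinearMap.id
      (LinearMap.applyₗ (e : E) ∘ₗ α.toLinearMap)) (LinearMap.applyₗ (e : E) ∘ₗ α.toLinearMap ∘ₗ
        LinearMap.mul' k A ∘ₗ S.rTensor A) (δ a) fun x y => by simp).trans ?_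
    refine (congrArg (fun z => α z (e : E)) (h.antipode_left a)).trans ?_
    simp
  -- The inverse is `e ↦ e₍₋₁₎ ⊗ P(e₍₀₎)`; on `a e` it gives `a₍₁₎ ⊗ ε(a₍₂₎) e`.
  refine Function.LeftInverse.injective (g := P.lTensor A ∘ₗ ρ) fun t => ?_
  refine Bicomodule.lin_ext (P.lTensor A ∘ₗ ρ ∘ₗ TensorProduct.lift α.toLinearMap ∘ₗ
    I.subtype.lTensor A) LinearMap.id t fun a e => ?_
  refine (congrArg (P.lTensor A) (hρ a e)).trans ?_
  refine (Bicomodule.lin_ext (P.lTensor A ∘ₗ TensorProduct.map LinearMap.id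
    (LinearMap.applyₗ (e : E) ∘ₗ α.toLinearMap)) ((TensorProduct.mk k A I).flip e ∘ₗ
      (TensorProduct.rid k A).toLinearMap ∘ₗ ε.lTensor A) (δ a) fun x y => by
        simp [hP, TensorProduct.smul_tmul']).trans ?_
  exact congrArg (fun z => z ⊗ₜ e) (h.rid a)

end IsHopfModule
end HopfModule

/-! ### Coactions restricted to invariant elements. -/

namespace Bicomodule

section Restriction

variable {k : Type*} [CommRing k] {C : Type*} [AddCommGroup C] [Module k C] [Coalgebra k C]
  {V : Type*} [AddCommGroup V] [Module k V] {W : Type*} [AddCommGroup W] [Module k W]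

/-- A split injective bicovariant map reflects the bicomodule axioms. -/
def ofSplitInjective (M : Bicomodule k C W) (i : V →ₗ[k] W) (r : W →ₗ[k] V)
    (hr : ∀ v, r (i v) = v) (cL : V →ₗ[k] C ⊗[k] V) (cR : V →ₗ[k] V ⊗[k] C)
    (hL : ∀ v, i.lTensor C (cL v) = M.coactL (i v))
    (hR : ∀ v, i.rTensor C (cR v) = M.coactR (i v)) : Bicomodule k C V where
  coactL := cL
  coactR := cR
  coassocL v := by
    -- The retraction `r` keeps `i` injective after tensoring with `C` on either side, so each axiom
    -- may be checked after applying `i`. The other axioms follow the same pattern.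
    refine Function.LeftInverse.injective (f := (i.lTensor C).lTensor C)
      (g := (r.lTensor C).lTensor C) (fun t => ?_) ?_
    · rw [← LinearMap.lTensor_comp_apply, ← LinearMap.lTensor_comp,
        show r ∘ₗ i = LinearMap.id from LinearMap.ext hr]
      simp
    · refine Eq.trans ?_ (((congrArg _ (congrArg _ (hL v))).trans (M.coassocL (i v))).trans ?_)
      · refine lin_ext ((i.lTensor C).lTensor C ∘ₗ (TensorProduct.assoc k C C V).toLinearMap ∘ₗ
          (comul (R := k)).rTensor V) ((TensorProduct.assoc k C C W).toLinearMap ∘ₗ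
          (comul (R := k)).rTensor W ∘ₗ i.lTensor C) (cL v) fun c v => ?_
        exact lin_ext ((i.lTensor C).lTensor C ∘ₗ (TensorProduct.assoc k C C V).toLinearMap ∘ₗ
          (TensorProduct.mk k _ _).flip v) ((TensorProduct.assoc k C C W).toLinearMap ∘ₗ
            (TensorProduct.mk k _ _).flip (i v)) (comul c) fun a b => rfl
      · rw [← hL]
        exact lin_ext (M.coactL.lTensor C ∘ₗ i.lTensor C) ((i.lTensor C).lTensor C ∘ₗ
          cL.lTensor C) (cL v) fun c v => congrArg (c ⊗ₜ ·) (hL v).symm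
  counitL v := by
    refine Function.LeftInverse.injective hr (Eq.trans ?_ (M.counitL (i v)))
    rw [← hL]
    exact lin_ext (i ∘ₗ (TensorProduct.lid k V).toLinearMap ∘ₗ (counit (R := k)).rTensor V)
      ((TensorProduct.lid k W).toLinearMap ∘ₗ (counit (R := k)).rTensor W ∘ₗ i.lTensor C) (cL v)
      fun c v => by simp
  coassocR v := by
    refine Function.LeftInverse.injective (f := i.rTensor (C ⊗[k] C))
      (g := r.rTensor (C ⊗[k] C)) (fun t => ?_) ?_
    · rw [← LinearMap.rTensor_comp_apply, show r ∘ₗ i = LinearMap.id from LinearMap.ext hr]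
      simp
    · refine Eq.trans ?_ ((M.coassocR (i v)).trans ?_)
      · rw [← hR]
        refine lin_ext (i.rTensor (C ⊗[k] C) ∘ₗ (TensorProduct.assoc k V C C).toLinearMap ∘ₗ
          cR.rTensor C) ((TensorProduct.assoc k W C C).toLinearMap ∘ₗ
          M.coactR.rTensor C ∘ₗ i.rTensor C) (cR v) fun v c => ?_
        refine Eq.trans ?_ (congrArg (fun z => TensorProduct.assoc k W C C (z ⊗ₜ c)) (hR v))
        exact lin_ext (i.rTensor (C ⊗[k] C) ∘ₗ (TensorProduct.assoc k V C C).toLinearMap ∘ₗ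
          (TensorProduct.mk k _ _).flip c) ((TensorProduct.assoc k W C C).toLinearMap ∘ₗ
            (TensorProduct.mk k _ _).flip c ∘ₗ i.rTensor C) (cR v) fun a b => rfl
      · rw [← hR]
        exact lin_ext ((comul (R := k)).lTensor W ∘ₗ i.rTensor C) (i.rTensor (C ⊗[k] C) ∘ₗ
          (comul (R := k)).lTensor V) (cR v) fun c v => rfl
  counitR v := by
    refine Function.LeftInverse.injective hr (Eq.trans ?_ (M.counitR (i v)))
    rw [← hR]
    exact lin_ext (i ∘ₗ (TensorProduct.rid k V).toLinearMap ∘ₗ (counit (R := k)).lTensor V)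
      ((TensorProduct.rid k W).toLinearMap ∘ₗ (counit (R := k)).lTensor W ∘ₗ i.rTensor C) (cR v)
      fun c v => by simp
  coact_comm v := by
    refine Function.LeftInverse.injective (f := (i.rTensor C).lTensor C)
      (g := (r.rTensor C).lTensor C) (fun t => ?_) ?_
    · rw [← LinearMap.lTensor_comp_apply, ← LinearMap.rTensor_comp,
        show r ∘ₗ i = LinearMap.id from LinearMap.ext hr]
      simp
    · refine Eq.trans ?_ ((M.coact_comm (i v)).trans ?_)
      · rw [← hR]
        refine lin_ext ((i.rTensor C).lTensor C ∘ₗ (TensorProduct.assoc k C V C).toLinearMap ∘ₗ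
          cL.rTensor C) ((TensorProduct.assoc k C W C).toLinearMap ∘ₗ
          M.coactL.rTensor C ∘ₗ i.rTensor C) (cR v) fun v c => ?_
        refine Eq.trans ?_ (congrArg (fun z => TensorProduct.assoc k C W C (z ⊗ₜ c)) (hL v))
        exact lin_ext ((i.rTensor C).lTensor C ∘ₗ (TensorProduct.assoc k C V C).toLinearMap ∘ₗ
          (TensorProduct.mk k _ _).flip c) ((TensorProduct.assoc k C W C).toLinearMap ∘ₗ
            (TensorProduct.mk k _ _).flip c ∘ₗ i.lTensor C) (cL v) fun a b => rfl
      · rw [← hL]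
        exact lin_ext (M.coactR.lTensor C ∘ₗ i.lTensor C) ((i.rTensor C).lTensor C ∘ₗ
          cR.lTensor C) (cL v) fun c v => congrArg (c ⊗ₜ ·) (hR v).symm

end Restriction

section Invariants

variable {k : Type*} [Field k] {H : Type*} [Ring H] [Bialgebra k H]
  {E : Type*} [AddCommGroup E] [Module k E]

variable (M : Bicomodule k H E)

/-- The two coactions commute, so the right coaction of a left-invariant element is killed by
`(coactL - 1 ⊗ ·) ⊗ id`. By flatness over the field `k`, that kernel is `₀E ⊗ H`. -/
theorem exists_coactR_leftInv : ∃ c : M.leftInv →ₗ[k] M.leftInv ⊗[k] H,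
    ∀ ω, M.leftInv.subtype.rTensor H (c ω) = M.coactR ω := by
  have hex : Function.Exact M.leftInv.subtype (M.coactL - TensorProduct.mk k H E 1) := by
    intro x
    rw [LinearMap.sub_apply, sub_eq_zero]
    exact ⟨fun h => ⟨⟨x, h⟩, rfl⟩, fun ⟨y, hy⟩ => hy ▸ y.2⟩
  obtain ⟨r, hr⟩ := LinearMap.exists_leftInverse_of_injective M.leftInv.subtype
    M.leftInv.ker_subtype
  -- Any linear retraction onto the invariants serves: it recovers the preimage once that is known
  -- to exist.
  refine ⟨r.rTensor H ∘ₗ M.coactR ∘ₗ M.leftInv.subtype, fun ω => ?_⟩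
  obtain ⟨t, ht⟩ := (Module.Flat.rTensor_exact H hex (M.coactR ω)).1 (by
    refine (LinearMap.congr_fun (LinearMap.rTensor_sub _ _) _).trans
      (sub_eq_zero (a := M.coactL.rTensor H (M.coactR ω))
        (b := (TensorProduct.mk k H E 1).rTensor H (M.coactR ω)) |>.2 ?_)
    refine (TensorProduct.assoc k H E H).injective ((M.coact_comm ω).trans ?_)
    refine (congrArg (M.coactR.lTensor H) ω.2).trans ?_
    exact (lin_ext ((TensorProduct.assoc k H E H).toLinearMap ∘ₗ
      (TensorProduct.mk k H E 1).rTensor H) (TensorProduct.mk k H _ 1) (M.coactR ω)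
      fun a b => rfl).symm)
  simp only [LinearMap.comp_apply, Submodule.subtype_apply]
  rw [← ht, ← LinearMap.rTensor_comp_apply _ r, hr, LinearMap.rTensor_id, LinearMap.id_apply]

theorem exists_coactL_rightInv : ∃ c : M.rightInv →ₗ[k] H ⊗[k] M.rightInv,
    ∀ η, M.rightInv.subtype.lTensor H (c η) = M.coactL η := by
  have hex : Function.Exact M.rightInv.subtype
      (M.coactR - (TensorProduct.mk k E H).flip 1) := by
    intro x
    rw [LinearMap.sub_apply, sub_eq_zero]
    exact ⟨fun h => ⟨⟨x, h⟩, rfl⟩, fun ⟨y, hy⟩ => hy ▸ y.2⟩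
  obtain ⟨r, hr⟩ := LinearMap.exists_leftInverse_of_injective M.rightInv.subtype
    M.rightInv.ker_subtype
  refine ⟨r.lTensor H ∘ₗ M.coactL ∘ₗ M.rightInv.subtype, fun η => ?_⟩
  obtain ⟨t, ht⟩ := (Module.Flat.lTensor_exact H hex (M.coactL η)).1 (by
    refine (LinearMap.congr_fun (LinearMap.lTensor_sub _ _) _).trans
      (sub_eq_zero.2 ?_)
    refine (M.coact_comm η).symm.trans ?_
    refine (congrArg (fun z => TensorProduct.assoc k H E H (M.coactL.rTensor H z)) η.2).trans ?_
    exact lin_ext ((TensorProduct.assoc k H E H).toLinearMap ∘ₗ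
      (TensorProduct.mk k (H ⊗[k] E) H).flip 1) (((TensorProduct.mk k E H).flip 1).lTensor H)
        (M.coactL η) fun a b => rfl)
  simp only [LinearMap.comp_apply, Submodule.subtype_apply]
  rw [← ht, ← LinearMap.lTensor_comp_apply _ r, hr, LinearMap.lTensor_id, LinearMap.id_apply]

theorem exists_retraction (p : Submodule k E) : ∃ r : E →ₗ[k] p, ∀ v : p, r (p.subtype v) = v := by
  obtain ⟨r, hr⟩ := LinearMap.exists_leftInverse_of_injective p.subtype p.ker_subtype
  exact ⟨r, LinearMap.congr_fun hr⟩

/-- The left-invariant elements, with the trivial left and the restricted right coaction. -/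
def leftInvBicomodule : Bicomodule k H M.leftInv :=
  M.ofSplitInjective M.leftInv.subtype (exists_retraction M.leftInv).choose
    (exists_retraction M.leftInv).choose_spec (TensorProduct.mk k H M.leftInv 1)
    M.exists_coactR_leftInv.choose
    (fun v => (show M.coactL v = 1 ⊗ₜ (v : E) from v.2).symm) M.exists_coactR_leftInv.choose_spec

theorem leftInv_subtype_bicovariant :
    M.leftInvBicomodule.IsBicovariant M M.leftInv.subtype :=
  ⟨fun v => (show M.coactL v = 1 ⊗ₜ (v : E) from v.2).symm,
    M.exists_coactR_leftInv.choose_spec⟩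

/-- The right-invariant elements, with the trivial right and the restricted left coaction. -/
def rightInvBicomodule : Bicomodule k H M.rightInv :=
  M.ofSplitInjective M.rightInv.subtype (exists_retraction M.rightInv).choose
    (exists_retraction M.rightInv).choose_spec M.exists_coactL_rightInv.choose
    ((TensorProduct.mk k M.rightInv H).flip 1) M.exists_coactL_rightInv.choose_spec
    (fun v => (show M.coactR v = (v : E) ⊗ₜ 1 from v.2).symm)

theorem rightInv_subtype_bicovariant :
    M.rightInvBicomodule.IsBicovariant M M.rightInv.subtype :=
  ⟨M.exists_coactL_rightInv.choose_spec,
    fun v => (show M.coactR v = (v : E) ⊗ₜ 1 from v.2).symm⟩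

end Invariants

end Bicomodule

/-! ### Bicovariant bimodules as Hopf modules. -/

section Hopf

variable {k : Type*} [CommRing k] {A : Type*} [CommRing A] [HopfAlgebra k A]
  {E : Type*} [AddCommGroup E] [Module k E]

namespace BicovariantBimodule

variable (M : BicovariantBimodule k A E)

/-- The left action as an algebra map. -/
def lactHom : A →ₐ[k] Module.End k E :=
  AlgHom.ofLinearMap (TensorProduct.curry M.lact) (LinearMap.ext M.one_lact)
    fun a b => LinearMap.ext (M.mul_lact a b)

theorem lift_lactHom : TensorProduct.lift M.lactHom.toLinearMap = M.lact :=
  TensorProduct.ext' fun _ _ => rfl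

theorem isHopfModule_left : IsHopfModule (HopfAlgebra.antipode k) (counit (R := k))
    (Bialgebra.comulAlgHom k A) M.coactL M.lactHom where
  rid a := (Bicomodule.regular k A).counitR a
  antipode_left a := HopfAlgebra.mul_antipode_rTensor_comul_apply a
  antipode_right a := HopfAlgebra.mul_antipode_lTensor_comul_apply a
  counit := M.counitL
  coassoc := M.coassocL
  map_act a e := by
    refine (M.lact_covariant.1 (a ⊗ₜ e)).symm.trans ?_
    exact Bicomodule.lin_ext4 (M.lact.lTensor A ∘ₗ (LinearMap.mul' k A).rTensor _ ∘ₗ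
      Bicomodule.swap k A A A E) (TensorProduct.lift (tensorAction M.lactHom).toLinearMap)
      (comul a) (M.coactL e) fun x y z t => rfl

/-- A right coaction followed by the flip is a left coaction of the co-opposite coalgebra. As `A` is
commutative, the same antipode serves there: `S(a₍₂₎) a₍₁₎ = a₍₁₎ S(a₍₂₎) = ε(a)`. The result puts
right-invariant elements under the same theorem as left-invariant ones. -/
theorem isHopfModule_right : IsHopfModule (HopfAlgebra.antipode k) (counit (R := k))
    ((Algebra.TensorProduct.comm k A A).toAlgHom.comp (Bialgebra.comulAlgHom k A))
    ((TensorProduct.comm k E A).toLinearMap ∘ₗ M.coactR) M.lactHom where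
  rid a := (Bicomodule.lin_ext ((TensorProduct.rid k A).toLinearMap ∘ₗ (counit (R := k)).lTensor A
    ∘ₗ (TensorProduct.comm k A A).toLinearMap) ((TensorProduct.lid k A).toLinearMap ∘ₗ
      (counit (R := k)).rTensor A) (comul a) fun x y => by simp).trans
    ((Bicomodule.regular k A).counitL a)
  antipode_left a := (Bicomodule.lin_ext (LinearMap.mul' k A ∘ₗ
    (HopfAlgebra.antipode k).rTensor A ∘ₗ (TensorProduct.comm k A A).toLinearMap)
      (LinearMap.mul' k A ∘ₗ (HopfAlgebra.antipode k).lTensor A) (comul a)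
        fun x y => by simp [mul_comm]).trans (HopfAlgebra.mul_antipode_lTensor_comul_apply a)
  antipode_right a := (Bicomodule.lin_ext (LinearMap.mul' k A ∘ₗ
    (HopfAlgebra.antipode k).lTensor A ∘ₗ (TensorProduct.comm k A A).toLinearMap)
      (LinearMap.mul' k A ∘ₗ (HopfAlgebra.antipode k).rTensor A) (comul a)
        fun x y => by simp [mul_comm]).trans (HopfAlgebra.mul_antipode_rTensor_comul_apply a)
  counit e := (Bicomodule.lin_ext ((TensorProduct.lid k E).toLinearMap ∘ₗ
    (counit (R := k)).rTensor E ∘ₗ (TensorProduct.comm k E A).toLinearMap)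
      ((TensorProduct.rid k E).toLinearMap ∘ₗ (counit (R := k)).lTensor E) (M.coactR e)
        fun x y => by simp).trans (M.counitR e)
  coassoc e := by
    -- `Φ` reverses the order of the three factors and so carries right coassociativity to left
    -- coassociativity.
    let Φ : E ⊗[k] (A ⊗[k] A) →ₗ[k] A ⊗[k] (A ⊗[k] E) :=
      (TensorProduct.assoc k A A E).toLinearMap ∘ₗ (TensorProduct.comm k _ _).toLinearMap ∘ₗ
        (TensorProduct.comm k A A).toLinearMap.lTensor E
    refine Eq.trans ?_ ((congrArg Φ (M.coassocR e)).symm.trans ?_)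
    · exact Bicomodule.lin_ext ((TensorProduct.assoc k A A E).toLinearMap ∘ₗ
        ((Algebra.TensorProduct.comm k A A).toAlgHom.comp
          (Bialgebra.comulAlgHom k A)).toLinearMap.rTensor E ∘ₗ
            (TensorProduct.comm k E A).toLinearMap) (Φ ∘ₗ (comul (R := k)).lTensor E)
        (M.coactR e) fun v a => rfl
    · refine Bicomodule.lin_ext (Φ ∘ₗ (TensorProduct.assoc k E A A).toLinearMap ∘ₗ
        M.coactR.rTensor A) (((TensorProduct.comm k E A).toLinearMap ∘ₗ M.coactR).lTensor A ∘ₗ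
          (TensorProduct.comm k E A).toLinearMap) (M.coactR e) fun v a => ?_
      exact Bicomodule.lin_ext (Φ ∘ₗ (TensorProduct.assoc k E A A).toLinearMap ∘ₗ
        (TensorProduct.mk k _ _).flip a) (TensorProduct.mk k _ _ a ∘ₗ
          (TensorProduct.comm k E A).toLinearMap) (M.coactR v) fun x y => rfl
  map_act a e := by
    refine (congrArg (TensorProduct.comm k E A) (M.lact_covariant.2 (a ⊗ₜ e))).symm.trans ?_
    exact Bicomodule.lin_ext4 ((TensorProduct.comm k E A).toLinearMap ∘ₗ M.lact.rTensor A ∘ₗ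
      (LinearMap.mul' k A).lTensor _ ∘ₗ Bicomodule.swap k A A E A) (TensorProduct.lift
        ((tensorAction M.lactHom).toLinearMap ∘ₗ (TensorProduct.comm k A A).toLinearMap) ∘ₗ
          (TensorProduct.comm k E A).toLinearMap.lTensor _)
      (comul a) (M.coactR e) fun x y z t => rfl

end BicovariantBimodule

end Hopf

/-! ### Generation by invariant elements, before and after deformation. -/

namespace BicovariantBimodule

section

variable {k : Type*} [CommRing k] {H : Type*} [Ring H] [Bialgebra k H]
  {E : Type*} [AddCommGroup E] [Module k E] (M : BicovariantBimodule k H E)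

/-- The map `H ⊗ ₀E → E`, `a ⊗ ω ↦ a ω`. -/
def leftInvMul : H ⊗[k] M.leftInv →ₗ[k] E := M.lact ∘ₗ M.leftInv.subtype.lTensor H

/-- The map `H ⊗ E₀ → E`, `a ⊗ η ↦ a η`, on right-invariant elements. -/
def rightInvMul : H ⊗[k] M.rightInv →ₗ[k] E := M.lact ∘ₗ M.rightInv.subtype.lTensor H

end

section

variable {k : Type*} [CommRing k] {A : Type*} [CommRing A] [HopfAlgebra k A]
  {E : Type*} [AddCommGroup E] [Module k E] (M : BicovariantBimodule k A E)

theorem leftInvMul_bijective : Function.Bijective M.leftInvMul := by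
  have h := M.isHopfModule_left.lift_bijective M.leftInv fun e => Iff.rfl
  rwa [lift_lactHom] at h

theorem rightInvMul_surjective : Function.Surjective M.rightInvMul := fun e => by
  have h := M.isHopfModule_right.lift_surjective e M.rightInv fun e he =>
    (TensorProduct.comm k E A).injective he
  rwa [lift_lactHom] at h

end

section

variable {k : Type*} [Field k] {A : Type*} [CommRing A] [HopfAlgebra k A]
  {E : Type*} [AddCommGroup E] [Module k E] (M : BicovariantBimodule k A E) (γ : TwoCocycle k A)

theorem _root_.BicovCalc.Bicomodule.twist_bijective {k : Type*} [CommRing k] {C : Type*}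
    [AddCommGroup C] [Module k C] [Coalgebra k C] {V : Type*} [AddCommGroup V] [Module k V]
    (M : Bicomodule k C V) (u : (WithConv (C →ₗ[k] k))ˣ) : Function.Bijective (M.twist u) :=
  Function.bijective_iff_has_inverse.2 ⟨M.twist u⁻¹, fun v => by
    simpa using M.twist_twist_inv u⁻¹ v, M.twist_twist_inv u⟩

/-- The deformed multiplication map is the original one preceded by the twist of `A ⊗ ₀E`, which is
invertible. The comparison makes sense because the coactions and the unit, hence the left-invariant
elements, do not change. -/
theorem deform_leftInvMul_bijective : Function.Bijective (M.deform γ).leftInvMul := by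
  have h : M.deformLact γ ∘ₗ M.leftInv.subtype.lTensor A = M.leftInvMul ∘ₗ
      ((Bicomodule.regular k A).tensor M.leftInvBicomodule).twist γ.unit := by
    refine LinearMap.ext fun t => ?_
    exact congrArg M.lact ((M.leftInv_subtype_bicovariant.lTensor
      (Bicomodule.regular k A)).twist γ.unit t)
  -- Stated over `A` and the undeformed invariants, so that `h` rewrites; the goal is the same map
  -- up to unfolding.
  have hb : Function.Bijective (M.deformLact γ ∘ₗ M.leftInv.subtype.lTensor A) := by
    rw [h]
    exact M.leftInvMul_bijective.comp (Bicomodule.twist_bijective _ _)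
  exact hb

theorem deform_rightInvMul_surjective : Function.Surjective (M.deform γ).rightInvMul := by
  have h : M.deformLact γ ∘ₗ M.rightInv.subtype.lTensor A = M.rightInvMul ∘ₗ
      ((Bicomodule.regular k A).tensor M.rightInvBicomodule).twist γ.unit := by
    refine LinearMap.ext fun t => ?_
    exact congrArg M.lact ((M.rightInv_subtype_bicovariant.lTensor
      (Bicomodule.regular k A)).twist γ.unit t)
  have hb : Function.Surjective (M.deformLact γ ∘ₗ M.rightInv.subtype.lTensor A) := by
    rw [h]
    exact M.rightInvMul_surjective.comp (Bicomodule.twist_bijective _ _).2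
  exact hb

end

end BicovariantBimodule

/-! ### Maps given by a defining property, and the symmetrizer of an involution. -/

section TheMap

variable {k : Type*} [CommRing k] {V : Type*} [AddCommGroup V] [Module k V]
  {W : Type*} [AddCommGroup W] [Module k W]

theorem theMap_eq {P : (V →ₗ[k] W) → Prop} {f : V →ₗ[k] W} (hf : P f)
    (h : ∀ f', P f' → f' = f) : theMap P = f := by
  have hex : ∃! f, P f := ⟨f, hf, h⟩
  rw [theMap, dif_pos hex]
  exact h _ hex.choose_spec.1

/-- The projection onto the fixed space of an involution, along the sum of the other
eigenspaces. -/
theorem theMap_projection {k : Type*} [Field k] {X : Type*} [AddCommGroup X] [Module k X]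
    (h2 : (2 : k) ≠ 0) {s : Module.End k X} (hs : ∀ t, s (s t) = t) :
    theMap (fun p : X →ₗ[k] X => p ∘ₗ p = p ∧ LinearMap.range p = LinearMap.ker (s - 1) ∧
      LinearMap.ker p = ⨆ (c : k) (_ : c ≠ 1), Module.End.eigenspace s c) =
    (2⁻¹ : k) • (1 + s) := by
  have hp : ∀ t, ((2⁻¹ : k) • (1 + s)) t = (2⁻¹ : k) • (t + s t) := fun t => rfl
  have hhalf : ∀ t : X, (2⁻¹ : k) • (t + t) = t := fun t => by
    rw [← two_smul k t, smul_smul, inv_mul_cancel₀ h2, one_smul]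
  have hker : ∀ t, ((2⁻¹ : k) • (1 + s)) t = 0 ↔ s t = (-1 : k) • t := fun t => by
    rw [hp, smul_eq_zero_iff_right (inv_ne_zero h2), neg_one_smul, add_comm, add_eq_zero_iff_eq_neg]
  have hidem : ((2⁻¹ : k) • (1 + s)) ∘ₗ ((2⁻¹ : k) • (1 + s)) = (2⁻¹ : k) • (1 + s) := by
    ext t
    rw [LinearMap.comp_apply, hp, hp, map_smul, map_add, hs, add_comm (s t) t, ← smul_add, hhalf]
  have hrange : LinearMap.range ((2⁻¹ : k) • (1 + s)) = LinearMap.ker (s - 1) := by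
    refine le_antisymm ?_ fun t ht => ⟨t, ?_⟩
    · rintro _ ⟨t, rfl⟩
      rw [LinearMap.mem_ker, LinearMap.sub_apply, sub_eq_zero, hp, map_smul, map_add, hs,
        Module.End.one_apply, add_comm]
    · rw [LinearMap.mem_ker, LinearMap.sub_apply, sub_eq_zero, Module.End.one_apply] at ht
      rw [hp, ht, hhalf]
  have hker' : LinearMap.ker ((2⁻¹ : k) • (1 + s)) =
      ⨆ (c : k) (_ : c ≠ 1), Module.End.eigenspace s c := by
    refine le_antisymm (fun t ht => ?_) (iSup₂_le fun c hc t ht => ?_)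
    -- The kernel of `(1 + s) / 2` is the eigenspace for `-1`, which occurs in the supremum because
    -- `2 ≠ 0`.
    · have hne : (-1 : k) ≠ 1 := fun h => h2 (by
        rw [← one_add_one_eq_two]; nth_rewrite 1 [← h]; exact neg_add_cancel 1)
      exact Submodule.mem_iSup_of_mem (-1) (Submodule.mem_iSup_of_mem hne
        (Module.End.mem_eigenspace_iff.2 ((hker t).1 ht)))
    · rw [Module.End.mem_eigenspace_iff] at ht
      -- From `s² = 1`. As `c ≠ 1`, this leaves `c t = -t`, so the eigenspaces for values other than
      -- `±1` contribute nothing.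
      have h1 : ((c - 1) * (c + 1)) • t = 0 := by
        have h := hs t
        rw [ht, map_smul, ht, smul_smul] at h
        rw [show (c - 1) * (c + 1) = c * c - 1 by ring, sub_smul, one_smul, h, sub_self]
      rw [mul_smul, smul_eq_zero_iff_right (sub_ne_zero.2 hc), add_smul, one_smul] at h1
      exact (hker t).2 (by rw [ht, neg_one_smul]; exact eq_neg_of_add_eq_zero_left h1)
  refine theMap_eq ⟨hidem, hrange, hker'⟩ ?_
  rintro p ⟨hpp, hr, hk⟩
  ext t
  -- An idempotent is determined by its range and kernel. With `q = (1 + s) / 2`, the vector `t - q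
  -- t` lies in the kernel of `p` and `q t` in its range, so `p t = p (q t) = q t`.
  have h1 : t - ((2⁻¹ : k) • (1 + s)) t ∈ LinearMap.ker p := by
    rw [hk, ← hker', LinearMap.mem_ker, map_sub, sub_eq_zero]
    exact (LinearMap.congr_fun hidem t).symm
  obtain ⟨y, hy⟩ : ((2⁻¹ : k) • (1 + s)) t ∈ LinearMap.range p := by
    rw [hr, ← hrange]
    exact ⟨t, rfl⟩
  rw [LinearMap.mem_ker, map_sub, sub_eq_zero] at h1
  rw [h1, ← hy]
  exact LinearMap.congr_fun hpp y

end TheMap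

/-! ### The tensor square as a free module over its left-invariant elements. -/

namespace BicovariantBimodule

section Free

variable {k : Type*} [CommRing k] {H : Type*} [Ring H] [Bialgebra k H]
  {E : Type*} [AddCommGroup E] [Module k E] {M : BicovariantBimodule k H E}

/-- Write the second factor as a sum of terms `a ω`, move `a` across the tensor sign, and expand the
new first factor in the same way. -/
theorem mulMap_surjective (hM : Function.Surjective M.leftInvMul) :
    Function.Surjective (mulMap M) := by
  have h1 : ∀ (s : H ⊗[k] M.leftInv) (ω : M.leftInv),
      proj M M (M.leftInvMul s ⊗ₜ (ω : E)) = mulMap M (TensorProduct.assoc k _ _ _ (s ⊗ₜ ω)) :=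
    fun s ω => Bicomodule.lin_ext (proj M M ∘ₗ (TensorProduct.mk k E E).flip ω ∘ₗ M.leftInvMul)
      (mulMap M ∘ₗ (TensorProduct.assoc k _ _ _).toLinearMap ∘ₗ
        (TensorProduct.mk k _ _).flip ω) s fun a v => rfl
  have h2 : ∀ (v : E) (t : H ⊗[k] M.leftInv),
      proj M M (v ⊗ₜ M.leftInvMul t) ∈ LinearMap.range (mulMap M) := by
    intro v t
    induction t with
    | zero => simp
    | add x y hx hy =>
      rw [map_add, TensorProduct.tmul_add, map_add]
      exact Submodule.add_mem _ hx hy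
    | tmul a ω =>
      obtain ⟨s, hs⟩ := hM (M.ract (v ⊗ₜ a))
      refine ⟨_, (h1 s ω).symm.trans ?_⟩
      rw [hs]
      exact proj_balanced M M v a ω
  intro x
  obtain ⟨y, rfl⟩ := Submodule.mkQ_surjective _ x
  change proj M M y ∈ LinearMap.range (mulMap M)
  induction y with
  | zero => simp
  | add x y hx hy =>
    rw [map_add]
    exact Submodule.add_mem _ hx hy
  | tmul v w =>
    obtain ⟨t, rfl⟩ := hM w
    exact h2 v t

/-- The rewriting behind surjectivity, read as a formula, is a balanced map and thus descends to a
left inverse. -/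
theorem mulMap_injective (hM : Function.Bijective M.leftInvMul) :
    Function.Injective (mulMap M) := by
  let e : H ⊗[k] M.leftInv ≃ₗ[k] E := LinearEquiv.ofBijective M.leftInvMul hM
  have he : ∀ (a : H) (ω : M.leftInv), e.symm (M.lact (a ⊗ₜ (ω : E))) = a ⊗ₜ ω := fun a ω =>
    e.symm_apply_apply (a ⊗ₜ ω)
  -- `F₁` sends `v ⊗ (a ⊗ ω)` to the expansion of `v a` in `H ⊗ ₀E`, followed by `ω`.
  let F₁ : E ⊗[k] (H ⊗[k] M.leftInv) →ₗ[k] H ⊗[k] (M.leftInv ⊗[k] M.leftInv) :=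
    (TensorProduct.assoc k H M.leftInv M.leftInv).toLinearMap ∘ₗ
      (e.symm.toLinearMap ∘ₗ M.ract).rTensor M.leftInv ∘ₗ
        (TensorProduct.assoc k E H M.leftInv).symm.toLinearMap
  let F : E ⊗[k] E →ₗ[k] H ⊗[k] (M.leftInv ⊗[k] M.leftInv) := F₁ ∘ₗ e.symm.toLinearMap.lTensor E
  -- For `w = b ω` both sides depend only on `v a b` and `ω`.
  have hF : ∀ v a w, F (M.ract (v ⊗ₜ a) ⊗ₜ w) = F (v ⊗ₜ M.lact (a ⊗ₜ w)) := by
    intro v a w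
    obtain ⟨t, rfl⟩ := e.surjective w
    refine Bicomodule.lin_ext (F ∘ₗ TensorProduct.mk k _ _ (M.ract (v ⊗ₜ a)) ∘ₗ e.toLinearMap)
      (F ∘ₗ TensorProduct.mk k _ _ v ∘ₗ M.lact ∘ₗ TensorProduct.mk k _ _ a ∘ₗ e.toLinearMap) t
      fun b ω => ?_
    have h1 : e.symm (e (b ⊗ₜ ω)) = b ⊗ₜ ω := e.symm_apply_apply _
    have h2 : e.symm (M.lact (a ⊗ₜ e (b ⊗ₜ ω))) = (a * b) ⊗ₜ ω :=
      (congrArg e.symm (M.mul_lact a b ω).symm).trans (he _ ω)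
    refine (congrArg (fun z => F₁ (M.ract (v ⊗ₜ a) ⊗ₜ z)) h1).trans (Eq.trans ?_
      (congrArg (fun z => F₁ (v ⊗ₜ z)) h2).symm)
    exact congrArg (fun z => TensorProduct.assoc k _ _ _ (e.symm z ⊗ₜ[k] ω)) (M.ract_mul v a b).symm
  refine Function.LeftInverse.injective
    (g := (balancing M M).liftQ F (balancing_le M M F hF)) fun t => ?_
  refine LinearMap.congr_fun (f := (balancing M M).liftQ F (balancing_le M M F hF) ∘ₗ mulMap M)
    (g := LinearMap.id) (TensorProduct.ext (LinearMap.ext fun a => TensorProduct.ext'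
      fun ω ω' => ?_)) t
  have h1 : e.symm (ω' : E) = 1 ⊗ₜ ω' := by rw [← he, M.one_lact]
  refine (congrArg (fun z => F₁ (M.lact (a ⊗ₜ (ω : E)) ⊗ₜ z)) h1).trans ?_
  refine (congrArg (fun z => TensorProduct.assoc k _ _ _ (e.symm z ⊗ₜ[k] ω'))
    (M.ract_one _)).trans ?_
  exact congrArg (fun z => TensorProduct.assoc k _ _ _ (z ⊗ₜ[k] ω')) (he a ω)

theorem mulMap_bijective (hM : Function.Bijective M.leftInvMul) :
    Function.Bijective (mulMap M) :=
  ⟨mulMap_injective hM, mulMap_surjective hM.2⟩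

theorem mulMap_one_tmul (t : M.leftInv ⊗[k] M.leftInv) : mulMap M (1 ⊗ₜ t) = incl M t :=
  (tensor M M).one_lact (incl M t)

theorem incl_mem_leftInv (t : M.leftInv ⊗[k] M.leftInv) : incl M t ∈ (tensor M M).leftInv := by
  change (tensor M M).coactL (incl M t) = 1 ⊗ₜ incl M t
  refine Bicomodule.lin_ext ((tensor M M).coactL ∘ₗ incl M) (TensorProduct.mk k _ _ 1 ∘ₗ incl M) t
    fun ω ω' => ?_
  refine (congrArg (fun z => (proj M M).lTensor H ((LinearMap.mul' k H).rTensor _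
    (Bicomodule.swap k H E H E z))) (congrArg₂ (· ⊗ₜ[k] ·) ω.2 ω'.2)).trans ?_
  exact congrArg (· ⊗ₜ proj M M ((ω : E) ⊗ₜ (ω' : E))) (mul_one (1 : H))

theorem coactL_mulMap (t : H ⊗[k] (M.leftInv ⊗[k] M.leftInv)) :
    (tensor M M).coactL (mulMap M t) = (mulMap M).lTensor H (TensorProduct.assoc k _ _ _
      ((comul (R := k)).rTensor _ t)) := by
  refine Bicomodule.lin_ext ((tensor M M).coactL ∘ₗ mulMap M) ((mulMap M).lTensor H ∘ₗ
    (TensorProduct.assoc k _ _ _).toLinearMap ∘ₗ (comul (R := k)).rTensor _) t fun a x => ?_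
  refine ((tensor M M).lact_covariant.1 (a ⊗ₜ incl M x)).symm.trans ?_
  refine (congrArg (fun z => (tensor M M).lact.lTensor H ((LinearMap.mul' k H).rTensor _
    (Bicomodule.swap k H H H _ (comul a ⊗ₜ z)))) (incl_mem_leftInv x)).trans ?_
  exact Bicomodule.lin_ext ((tensor M M).lact.lTensor H ∘ₗ (LinearMap.mul' k H).rTensor _ ∘ₗ
    Bicomodule.swap k H H H _ ∘ₗ (TensorProduct.mk k _ _).flip (1 ⊗ₜ incl M x))
    ((mulMap M).lTensor H ∘ₗ (TensorProduct.assoc k _ _ _).toLinearMap ∘ₗ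
      (TensorProduct.mk k _ _).flip x) (comul a) fun y z =>
      congrArg (· ⊗ₜ[k] mulMap M (z ⊗ₜ x)) (mul_one y)

/-- `incl` identifies `₀E ⊗ ₀E` with the left-invariant elements of `E ⊗_H E`. -/
theorem exists_incl_retraction (hM : Function.Bijective M.leftInvMul) :
    ∃ r : TensorOver M M →ₗ[k] M.leftInv ⊗[k] M.leftInv, (∀ t, r (incl M t) = t) ∧
      ∀ x ∈ (tensor M M).leftInv, incl M (r x) = x := by
  let e := LinearEquiv.ofBijective (mulMap M) (mulMap_bijective hM)
  have hone : ∀ t, e (1 ⊗ₜ t) = incl M t := mulMap_one_tmul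
  -- The retraction is `a t ↦ ε(a) t` in the decomposition given by `e`.
  refine ⟨(TensorProduct.lid k _).toLinearMap ∘ₗ (counit (R := k)).rTensor _ ∘ₗ e.symm.toLinearMap,
    fun t => ?_, fun x hx => ?_⟩
  · rw [← hone]
    simp
  · obtain ⟨t, rfl⟩ := e.surjective x
    have h1 : (mulMap M).lTensor H (TensorProduct.assoc k _ _ _ ((comul (R := k)).rTensor _ t)) =
      (mulMap M).lTensor H (1 ⊗ₜ t) := (coactL_mulMap t).symm.trans hx
    have h2 : TensorProduct.assoc k _ _ _ ((comul (R := k)).rTensor _ t) = 1 ⊗ₜ t :=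
      (LinearEquiv.lTensor H e).injective h1
    have h3 := congrArg (((TensorProduct.lid k _).toLinearMap ∘ₗ
      (counit (R := k)).rTensor (M.leftInv ⊗[k] M.leftInv)).lTensor H) h2
    -- Left invariance reads `a₍₁₎ ⊗ a₍₂₎ ⊗ x = 1 ⊗ a ⊗ x`; applying the counit to the middle factor
    -- shows that the coefficient is a scalar.
    have h4 : t = 1 ⊗ₜ TensorProduct.lid k _ ((counit (R := k)).rTensor _ t) := by
      refine Eq.trans ?_ h3
      refine (Bicomodule.lin_ext (((TensorProduct.lid k _).toLinearMap ∘ₗ (counit (R := k)).rTensor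
        (M.leftInv ⊗[k] M.leftInv)).lTensor H ∘ₗ (TensorProduct.assoc k _ _ _).toLinearMap ∘ₗ
          (comul (R := k)).rTensor _) LinearMap.id t fun a x => ?_).symm
      refine (Bicomodule.lin_ext (((TensorProduct.lid k _).toLinearMap ∘ₗ (counit (R := k)).rTensor
        (M.leftInv ⊗[k] M.leftInv)).lTensor H ∘ₗ (TensorProduct.assoc k _ _ _).toLinearMap ∘ₗ
          (TensorProduct.mk k _ _).flip x) ((TensorProduct.mk k _ _).flip x ∘ₗ
            (TensorProduct.rid k H).toLinearMap ∘ₗ (counit (R := k)).lTensor H) (comul a)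
            fun y z => by simp [TensorProduct.smul_tmul']).trans ?_
      exact congrArg (· ⊗ₜ x) ((Bicomodule.regular k H).counitR a)
    simp only [LinearMap.comp_apply, LinearEquiv.coe_coe, LinearEquiv.symm_apply_apply]
    rw [← hone, ← h4]

theorem incl_injective (hM : Function.Bijective M.leftInvMul) : Function.Injective (incl M) :=
  let ⟨_, hr, _⟩ := exists_incl_retraction hM
  Function.LeftInverse.injective hr

/-- Injectivity of `incl` makes the restriction unique, which is what `theMap` requires in order to
return it. -/
theorem braiding₀_eq (hM : Function.Bijective M.leftInvMul)
    {c : Module.End k (M.leftInv ⊗[k] M.leftInv)}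
    (hc : ∀ t, incl M (c t) = braiding M (incl M t)) : braiding₀ M = c :=
  theMap_eq (LinearMap.ext hc) fun _ hf => LinearMap.ext fun t =>
    incl_injective hM ((LinearMap.congr_fun hf t).trans (hc t).symm)

/-- A left-covariant map preserves left-invariant elements, and those of the square are the image of
`incl`. So `conn₀` really is the restriction and not the default value `0`. -/
theorem incl_conn₀ (hM : Function.Bijective M.leftInvMul) {conn : E →ₗ[k] TensorOver M M}
    (hconn : M.toBicomodule.IsLeftCovariant (tensor M M).toBicomodule conn) (ω : M.leftInv) :
    incl M (conn₀ M conn ω) = conn ω := by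
  obtain ⟨r, hr, hr'⟩ := exists_incl_retraction hM
  have h : ∀ ω : M.leftInv, incl M (r (conn ω)) = conn ω := fun ω => hr' _ <| by
    change (tensor M M).coactL (conn ω) = 1 ⊗ₜ conn ω
    rw [← hconn, show M.coactL ω = 1 ⊗ₜ (ω : E) from ω.2]
    rfl
  have h' : conn₀ M conn = r ∘ₗ conn ∘ₗ M.leftInv.subtype :=
    theMap_eq (LinearMap.ext h) fun _ hf => LinearMap.ext fun t => incl_injective hM
      ((LinearMap.congr_fun hf t).trans (h t).symm)
  rw [h']
  exact h ω

/-- Left invariance of `g` at an element with coaction `1 ⊗ x` reads `g(x) = ε(g(x)) 1`. -/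
theorem IsBiinvariant.incl_eq {g : TensorOver M M →ₗ[k] H} (hg : IsBiinvariant M g)
    (t : M.leftInv ⊗[k] M.leftInv) :
    g (incl M t) = algebraMap k H (counit (R := k) (g (incl M t))) := by
  have h := hg.left (incl M t)
  rw [show (tensor M M).coactL (incl M t) = 1 ⊗ₜ incl M t from incl_mem_leftInv t] at h
  rw [Algebra.algebraMap_eq_smul_one]
  exact h.symm.trans (by simp)

/-- The invariance formula expresses `g` through the coaction and the functional `ε ∘ g`, so
applying the coproduct to it and using coassociativity gives covariance. Bicovariance is the form in
which twists pass through `g`. -/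
theorem IsBiinvariant.bicovariant {g : TensorOver M M →ₗ[k] H} (hg : IsBiinvariant M g) :
    (tensor M M).toBicomodule.IsBicovariant (Bicomodule.regular k H) g := by
  constructor
  · intro x
    let Φ := ((TensorProduct.rid k H).toLinearMap ∘ₗ (counit (R := k) ∘ₗ g).lTensor H).lTensor H
    refine Eq.trans ?_ (((congrArg Φ ((tensor M M).coassocL x)).symm.trans ?_).trans
      (congrArg (comul (R := k)) (hg.left x)))
    · exact Bicomodule.lin_ext (g.lTensor H) (Φ ∘ₗ (tensor M M).coactL.lTensor H)
        ((tensor M M).coactL x) fun a y => congrArg (a ⊗ₜ ·) (hg.left y).symm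
    · refine Bicomodule.lin_ext (Φ ∘ₗ (TensorProduct.assoc k _ _ _).toLinearMap ∘ₗ
        (comul (R := k)).rTensor _) (comul (R := k) ∘ₗ (TensorProduct.rid k H).toLinearMap ∘ₗ
          (counit (R := k) ∘ₗ g).lTensor H) ((tensor M M).coactL x) fun a y => ?_
      refine Eq.trans ?_ (map_smul (comul (R := k)) (counit (R := k) (g y)) a).symm
      exact Bicomodule.lin_ext (Φ ∘ₗ (TensorProduct.assoc k _ _ _).toLinearMap ∘ₗ
        (TensorProduct.mk k _ _).flip y) (counit (R := k) (g y) • LinearMap.id) (comul a)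
        fun b c => by simp [Φ]
  · intro x
    let Φ := ((TensorProduct.lid k H).toLinearMap ∘ₗ (counit (R := k) ∘ₗ g).rTensor H).rTensor H
    refine Eq.trans ?_ (((congrArg (fun z => Φ ((TensorProduct.assoc k _ _ _).symm z))
      ((tensor M M).coassocR x)).trans ?_).trans (congrArg (comul (R := k)) (hg.right x)))
    · rw [LinearEquiv.symm_apply_apply]
      exact Bicomodule.lin_ext (g.rTensor H) (Φ ∘ₗ (tensor M M).coactR.rTensor H)
        ((tensor M M).coactR x) fun y a => congrArg (· ⊗ₜ a) (hg.right y).symm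
    · refine Bicomodule.lin_ext (Φ ∘ₗ (TensorProduct.assoc k _ _ _).symm.toLinearMap ∘ₗ
        (comul (R := k)).lTensor _) (comul (R := k) ∘ₗ (TensorProduct.lid k H).toLinearMap ∘ₗ
          (counit (R := k) ∘ₗ g).rTensor H) ((tensor M M).coactR x) fun y a => ?_
      refine Eq.trans ?_ (map_smul (comul (R := k)) (counit (R := k) (g y)) a).symm
      exact Bicomodule.lin_ext (Φ ∘ₗ (TensorProduct.assoc k _ _ _).symm.toLinearMap ∘ₗ
        TensorProduct.mk k _ _ y) (counit (R := k) (g y) • LinearMap.id) (comul a)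
        fun b c => by simp [Φ, TensorProduct.smul_tmul']

end Free

section Symmetrizer

variable {k : Type*} [Field k] {H : Type*} [Ring H] [Bialgebra k H]
  {E : Type*} [AddCommGroup E] [Module k E] {M : BicovariantBimodule k H E}

theorem symmetrizer₀_eq (h2 : (2 : k) ≠ 0) (hσ : ∀ t, braiding₀ M (braiding₀ M t) = t) :
    symmetrizer₀ M = (2⁻¹ : k) • (1 + braiding₀ M) :=
  theMap_projection h2 hσ

end Symmetrizer

end BicovariantBimodule

/-! ### Reduction to two facts about the braiding. -/

namespace BicovariantCalculus

variable {k : Type*} [Field k] {H : Type*} [Ring H] [Bialgebra k H]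
  {E : Type*} [AddCommGroup E] [Module k E] (C : BicovariantCalculus k H E)

theorem d_algebraMap (r : k) : C.d (algebraMap k H r) = 0 := by
  have h := C.leibniz 1 1
  rw [mul_one, C.ract_one, C.one_lact] at h
  -- The Leibniz rule at `1 * 1` reads `d 1 = d 1 + d 1`.
  rw [Algebra.algebraMap_eq_smul_one, map_smul, left_eq_add.1 h, smul_zero]

open BicovariantBimodule in
/-- If the braiding is an involution on `₀E ⊗ ₀E`, and `(id ⊗ g)(∇ ⊗ id)` is the composition of
`(g ⊗ id)(id ⊗ σ)(id ⊗ ∇)` with the braiding, then the two notions of compatibility agree. -/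
theorem compatible_iff_of_connLeft_eq (h2 : (2 : k) ≠ 0)
    (hM : Function.Bijective C.toBicovariantBimodule.leftInvMul) {g : C.Square →ₗ[k] H}
    (hg : IsLeftMetric C.toBicovariantBimodule g) (hg' : IsBiinvariant C.toBicovariantBimodule g)
    {conn : E →ₗ[k] C.Square}
    (hσ : ∀ t, braiding₀ C.toBicovariantBimodule (braiding₀ C.toBicovariantBimodule t) = t)
    (hconn : ∀ t, connLeft C.toBicovariantBimodule g conn t =
      connRight C.toBicovariantBimodule g conn (braiding₀ C.toBicovariantBimodule t)) :
    C.Compatible g conn ↔ HSCompatible C.toBicovariantBimodule g conn := by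
  -- The factor `2` in `Π⁰` cancels the half in the symmetrizer, leaving `connRight t + connRight
  -- (₀σ t)`; the second term is `connLeft t`.
  have hcompat : ∀ t, compat₀ C.toBicovariantBimodule g conn t =
      (connLeft C.toBicovariantBimodule g conn + connRight C.toBicovariantBimodule g conn) t := by
    intro t
    rw [compat₀, symmetrizer₀_eq h2 hσ, LinearMap.add_apply, hconn]
    have h1 : ((2⁻¹ : k) • (1 + braiding₀ C.toBicovariantBimodule)) t =
      (2⁻¹ : k) • (t + braiding₀ C.toBicovariantBimodule t) := rfl
    rw [LinearMap.smul_apply, LinearMap.comp_apply, h1, map_smul, smul_smul, mul_inv_cancel₀ h2,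
      one_smul, map_add, add_comm]
  let e := LinearEquiv.ofBijective (mulMap C.toBicovariantBimodule) (mulMap_bijective hM)
  have he : e.symm.toLinearMap ∘ₗ mulMap C.toBicovariantBimodule = LinearMap.id :=
    LinearMap.ext e.symm_apply_apply
  let G := C.lact ∘ₗ (compat₀ C.toBicovariantBimodule g conn).lTensor H +
      C.ract ∘ₗ TensorProduct.map C.d (g ∘ₗ incl C.toBicovariantBimodule)
  -- Bijectivity of `mulMap` gives existence and uniqueness of the extension, so `compatMap`
  -- satisfies its defining equation.
  have hmul : C.compatMap g conn ∘ₗ mulMap C.toBicovariantBimodule = G := by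
    have h1 : C.compatMap g conn = G ∘ₗ e.symm.toLinearMap := by
      refine theMap_eq ?_ fun f hf => ?_
      · rw [LinearMap.comp_assoc, he, LinearMap.comp_id]
      · refine LinearMap.ext fun x => ?_
        obtain ⟨t, rfl⟩ := e.surjective x
        exact (LinearMap.congr_fun hf t).trans (congrArg G (e.symm_apply_apply t).symm)
    rw [h1, LinearMap.comp_assoc, he, LinearMap.comp_id]
  -- Since `g` is a scalar on `₀E ⊗ ₀E`, the term `a d(g t)` of the Leibniz rule vanishes.
  have hdg : ∀ a t, C.d (g (mulMap C.toBicovariantBimodule (a ⊗ₜ t))) =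
      C.ract (C.d a ⊗ₜ g (incl C.toBicovariantBimodule t)) := by
    intro a t
    refine (congrArg C.d (hg.map_lact a (incl C.toBicovariantBimodule t))).trans
      ((C.leibniz _ _).trans ?_)
    rw [hg'.incl_eq t, d_algebraMap, TensorProduct.tmul_zero, map_zero, add_zero]
  have hG : ∀ a t, C.compatMap g conn (mulMap C.toBicovariantBimodule (a ⊗ₜ t)) =
      C.lact (a ⊗ₜ compat₀ C.toBicovariantBimodule g conn t) +
        C.ract (C.d a ⊗ₜ g (incl C.toBicovariantBimodule t)) := fun a t =>
    LinearMap.congr_fun hmul (a ⊗ₜ t)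
  constructor
  · intro h
    refine LinearMap.ext fun t => (hcompat t).symm.trans ?_
    -- At `a = 1` the term in `d a` appears on both sides and cancels, which leaves `Π⁰ t = 0`.
    have h1 := (hG 1 t).symm.trans ((LinearMap.congr_fun h _).trans (hdg 1 t))
    rw [C.one_lact] at h1
    exact add_eq_right.1 h1
  · intro h
    refine LinearMap.ext fun x => ?_
    obtain ⟨t, rfl⟩ := (mulMap_bijective hM).2 x
    refine Bicomodule.lin_ext (C.compatMap g conn ∘ₗ mulMap C.toBicovariantBimodule)
      (C.d ∘ₗ g ∘ₗ mulMap C.toBicovariantBimodule) t fun a t => ?_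
    refine (hG a t).trans (Eq.trans ?_ (hdg a t).symm)
    rw [hcompat, show connLeft C.toBicovariantBimodule g conn +
      connRight C.toBicovariantBimodule g conn = 0 from h, LinearMap.zero_apply,
      TensorProduct.tmul_zero, map_zero, zero_add]

end BicovariantCalculus

/-! ### The twist on invariant vectors. -/

namespace Bicomodule

variable {k : Type*} [CommRing k] {H : Type*} [Ring H] [Bialgebra k H]
  {V : Type*} [AddCommGroup V] [Module k V] {W : Type*} [AddCommGroup W] [Module k W]
  {V' : Type*} [AddCommGroup V'] [Module k V'] {W' : Type*} [AddCommGroup W'] [Module k W']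

theorem actL_tmul_of_leftInv (M : Bicomodule k H V) (N : Bicomodule k H W)
    {φ : WithConv (H ⊗[k] H →ₗ[k] k)} (hφ : ∀ a, φ (1 ⊗ₜ a) = counit (R := k) a) {v : V}
    (hv : v ∈ M.leftInv) (w : W) : (M.tensor N).actL φ (v ⊗ₜ w) = v ⊗ₜ w := by
  refine (congrArg (fun z => TensorProduct.lid k _ (φ.ofConv.rTensor _ (swap k H V H W
    (z ⊗ₜ N.coactL w)))) hv).trans (Eq.trans ?_ (congrArg (v ⊗ₜ ·) (N.counitL w)))
  exact lin_ext ((TensorProduct.lid k _).toLinearMap ∘ₗ φ.ofConv.rTensor _ ∘ₗ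
    swap k H V H W ∘ₗ TensorProduct.mk k _ _ (1 ⊗ₜ v)) (TensorProduct.mk k _ _ v ∘ₗ
      (TensorProduct.lid k _).toLinearMap ∘ₗ (counit (R := k)).rTensor W) (N.coactL w)
    fun a b => by simp [hφ]

theorem actL_tmul_of_leftInv_right (M : Bicomodule k H V) (N : Bicomodule k H W)
    {φ : WithConv (H ⊗[k] H →ₗ[k] k)} (hφ : ∀ a, φ (a ⊗ₜ 1) = counit (R := k) a) (v : V) {w : W}
    (hw : w ∈ N.leftInv) : (M.tensor N).actL φ (v ⊗ₜ w) = v ⊗ₜ w := by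
  refine (congrArg (fun z => TensorProduct.lid k _ (φ.ofConv.rTensor _ (swap k H V H W
    (M.coactL v ⊗ₜ z)))) hw).trans (Eq.trans ?_ (congrArg (· ⊗ₜ w) (M.counitL v)))
  exact lin_ext ((TensorProduct.lid k _).toLinearMap ∘ₗ φ.ofConv.rTensor _ ∘ₗ
    swap k H V H W ∘ₗ (TensorProduct.mk k _ _).flip (1 ⊗ₜ w)) ((TensorProduct.mk k _ _).flip w ∘ₗ
      (TensorProduct.lid k _).toLinearMap ∘ₗ (counit (R := k)).rTensor V) (M.coactL v)
    fun a b => by simp [hφ, TensorProduct.smul_tmul']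

theorem actR_tmul_of_rightInv (M : Bicomodule k H V) (N : Bicomodule k H W)
    {φ : WithConv (H ⊗[k] H →ₗ[k] k)} (hφ : ∀ a, φ (1 ⊗ₜ a) = counit (R := k) a) {v : V}
    (hv : v ∈ M.rightInv) (w : W) : (M.tensor N).actR φ (v ⊗ₜ w) = v ⊗ₜ w := by
  refine (congrArg (fun z => TensorProduct.rid k _ (φ.ofConv.lTensor _ (swap k V H W H
    (z ⊗ₜ N.coactR w)))) hv).trans (Eq.trans ?_ (congrArg (v ⊗ₜ ·) (N.counitR w)))
  exact lin_ext ((TensorProduct.rid k _).toLinearMap ∘ₗ φ.ofConv.lTensor _ ∘ₗ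
    swap k V H W H ∘ₗ TensorProduct.mk k _ _ (v ⊗ₜ 1)) (TensorProduct.mk k _ _ v ∘ₗ
      (TensorProduct.rid k _).toLinearMap ∘ₗ (counit (R := k)).lTensor W) (N.coactR w)
    fun a b => by simp [hφ]

theorem actR_tmul_of_rightInv_right (M : Bicomodule k H V) (N : Bicomodule k H W)
    {φ : WithConv (H ⊗[k] H →ₗ[k] k)} (hφ : ∀ a, φ (a ⊗ₜ 1) = counit (R := k) a) (v : V) {w : W}
    (hw : w ∈ N.rightInv) : (M.tensor N).actR φ (v ⊗ₜ w) = v ⊗ₜ w := by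
  refine (congrArg (fun z => TensorProduct.rid k _ (φ.ofConv.lTensor _ (swap k V H W H
    (M.coactR v ⊗ₜ z)))) hw).trans (Eq.trans ?_ (congrArg (· ⊗ₜ w) (M.counitR v)))
  exact lin_ext ((TensorProduct.rid k _).toLinearMap ∘ₗ φ.ofConv.lTensor _ ∘ₗ
    swap k V H W H ∘ₗ (TensorProduct.mk k _ _).flip (w ⊗ₜ 1)) ((TensorProduct.mk k _ _).flip w ∘ₗ
      (TensorProduct.rid k _).toLinearMap ∘ₗ (counit (R := k)).lTensor V) (M.coactR v)
    fun a b => by simp [hφ, TensorProduct.smul_tmul']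

/-- The twist only meets `γ(1 ⊗ ·)` on the left and `γ⁻¹(· ⊗ 1)` on the right, both counits by
normalisation. With its mirror image below, this is why the exchange rule of the braiding is
insensitive to the deformation. -/
theorem twist_tmul_of_leftInv_rightInv (M : Bicomodule k H V) (N : Bicomodule k H W)
    (γ : TwoCocycle k H) {v : V} (hv : v ∈ M.leftInv) {w : W} (hw : w ∈ N.rightInv) :
    (M.tensor N).twist γ.unit (v ⊗ₜ w) = v ⊗ₜ w := by
  rw [twist, LinearMap.comp_apply, actR_tmul_of_rightInv_right M N γ.inv_one_right v hw,
    actL_tmul_of_leftInv M N γ.one_left hv]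

theorem twist_tmul_of_rightInv_leftInv (M : Bicomodule k H V) (N : Bicomodule k H W)
    (γ : TwoCocycle k H) {v : V} (hv : v ∈ M.rightInv) {w : W} (hw : w ∈ N.leftInv) :
    (M.tensor N).twist γ.unit (v ⊗ₜ w) = v ⊗ₜ w := by
  rw [twist, LinearMap.comp_apply, actR_tmul_of_rightInv M N γ.inv_one_left hv,
    actL_tmul_of_leftInv_right M N γ.one_right v hw]

theorem IsBicovariant.tensorMap {M : Bicomodule k H V} {M' : Bicomodule k H V'}
    {N : Bicomodule k H W} {N' : Bicomodule k H W'} {S : V →ₗ[k] V'} {T : W →ₗ[k] W'}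
    (hS : M.IsBicovariant M' S) (hT : N.IsBicovariant N' T) :
    (M.tensor N).IsBicovariant (M'.tensor N') (TensorProduct.map S T) := by
  rw [← LinearMap.rTensor_comp_lTensor]
  exact (hS.rTensor N').comp (hT.lTensor M)

end Bicomodule

/-! ### Uniqueness of the braiding, and the flip of a symmetric bimodule. -/

namespace BicovariantBimodule

section Uniqueness

variable {k : Type*} [CommRing k] {H : Type*} [Ring H] [Bialgebra k H]
  {E : Type*} [AddCommGroup E] [Module k E] {M : BicovariantBimodule k H E}

/-- The square is spanned by elements `b ω ⊗ η` with `ω` left-invariant and `η` right-invariant,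
where left linearity and the exchange rule fix the value. -/
theorem IsBraiding.unique {σ σ' : TensorOver M M →ₗ[k] TensorOver M M} (h : IsBraiding M σ)
    (h' : IsBraiding M σ') (hl : Function.Surjective M.leftInvMul)
    (hr : Function.Surjective M.rightInvMul) : σ = σ' := by
  have h1 : ∀ (v : E) (η : M.rightInv),
      σ (proj M M (v ⊗ₜ (η : E))) = σ' (proj M M (v ⊗ₜ (η : E))) := by
    intro v η
    obtain ⟨s, rfl⟩ := hl v
    refine Bicomodule.lin_ext (σ ∘ₗ proj M M ∘ₗ (TensorProduct.mk k _ _).flip (η : E) ∘ₗ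
      M.leftInvMul) (σ' ∘ₗ proj M M ∘ₗ (TensorProduct.mk k _ _).flip (η : E) ∘ₗ M.leftInvMul) s
      fun b ω => ?_
    refine (h.map_lact b (proj M M ((ω : E) ⊗ₜ (η : E)))).trans (Eq.trans ?_
      (h'.map_lact b (proj M M ((ω : E) ⊗ₜ (η : E)))).symm)
    rw [h.exchange _ ω.2 _ η.2, h'.exchange _ ω.2 _ η.2]
  refine LinearMap.ext fun x => hom_ext M M _ _ x fun v w => ?_
  obtain ⟨t, rfl⟩ := hr w
  refine Bicomodule.lin_ext (σ ∘ₗ proj M M ∘ₗ TensorProduct.mk k _ _ v ∘ₗ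
    M.rightInvMul) (σ' ∘ₗ proj M M ∘ₗ TensorProduct.mk k _ _ v ∘ₗ M.rightInvMul) t
    fun a η => ?_
  -- The coefficient of `a η` moves into the first factor, where `h1` covers an arbitrary element.
  exact (congrArg σ (proj_balanced M M v a η)).symm.trans ((h1 _ η).trans
    (congrArg σ' (proj_balanced M M v a η)))

theorem braiding_eq {σ : TensorOver M M →ₗ[k] TensorOver M M} (h : IsBraiding M σ)
    (hl : Function.Surjective M.leftInvMul) (hr : Function.Surjective M.rightInvMul) :
    braiding M = σ :=
  theMap_eq h fun _ h' => h'.unique h hl hr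

end Uniqueness

section Flip

variable {k : Type*} [CommRing k] {A : Type*} [CommRing A] [Bialgebra k A]
  {E : Type*} [AddCommGroup E] [Module k E] (M : BicovariantBimodule k A E)

/-- The bimodule structure is symmetric, `e a = a e`. -/
def IsSymmetric : Prop := ∀ a e, M.ract (e ⊗ₜ a) = M.lact (a ⊗ₜ e)

variable {M}

/-- The flip `v ⊗ w ↦ w ⊗ v` of `E ⊗_A E` for a symmetric bimodule `E`. -/
def flip (hs : M.IsSymmetric) : TensorOver M M →ₗ[k] TensorOver M M :=
  (balancing M M).liftQ (proj M M ∘ₗ (TensorProduct.comm k E E).toLinearMap)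
    (balancing_le M M _ fun v a w => by
      -- The chain is `w ⊗ v a = w ⊗ a v = w a ⊗ v = a w ⊗ v`.
      refine (congrArg (fun z => proj M M (w ⊗ₜ z)) (hs a v)).trans ?_
      refine (proj_balanced M M w a v).symm.trans ?_
      exact congrArg (fun z => proj M M (z ⊗ₜ v)) (hs a w))

variable (hs : M.IsSymmetric)

theorem flip_lact (t : A ⊗[k] TensorOver M M) :
    flip hs ((tensor M M).lact t) = (tensor M M).lact ((flip hs).lTensor A t) := by
  refine Bicomodule.lin_ext (flip hs ∘ₗ (tensor M M).lact)
    ((tensor M M).lact ∘ₗ (flip hs).lTensor A) t fun a x => ?_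
  refine hom_ext M M (flip hs ∘ₗ (tensor M M).lact ∘ₗ TensorProduct.mk k _ _ a)
    ((tensor M M).lact ∘ₗ TensorProduct.mk k _ _ a ∘ₗ flip hs) x fun v w => ?_
  exact (proj_balanced M M w a v).symm.trans (congrArg (fun z => proj M M (z ⊗ₜ v)) (hs a w))

theorem flip_ract (t : TensorOver M M ⊗[k] A) :
    flip hs ((tensor M M).ract t) = (tensor M M).ract ((flip hs).rTensor A t) := by
  refine Bicomodule.lin_ext (flip hs ∘ₗ (tensor M M).ract)
    ((tensor M M).ract ∘ₗ (flip hs).rTensor A) t fun x a => ?_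
  refine hom_ext M M (flip hs ∘ₗ (tensor M M).ract ∘ₗ (TensorProduct.mk k _ _).flip a)
    ((tensor M M).ract ∘ₗ (TensorProduct.mk k _ _).flip a ∘ₗ flip hs) x fun v w => ?_
  exact (proj_balanced M M w a v).trans (congrArg (fun z => proj M M (w ⊗ₜ z)) (hs a v)).symm

/-- Commutativity of `A` makes the codiagonal coactions independent of the order of the factors. -/
theorem flip_bicovariant : (tensorBicomodule M M).IsBicovariant (tensorBicomodule M M)
    (flip hs) :=
  (proj_bicovariant M M).of_surjective (Submodule.mkQ_surjective _)
    ((proj_bicovariant M M).comp (Bicomodule.codiag_comm M.toBicomodule M.toBicomodule))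

end Flip

section

variable {k : Type*} [CommRing k] {H : Type*} [Ring H] [Bialgebra k H]
  {V : Type*} [AddCommGroup V] [Module k V] {W : Type*} [AddCommGroup W] [Module k W]
  (M : BicovariantBimodule k H V) (N : BicovariantBimodule k H W)

theorem tensor_lact_proj (a : H) (v : V) (w : W) :
    (tensor M N).lact (a ⊗ₜ proj M N (v ⊗ₜ w)) = proj M N (M.lact (a ⊗ₜ v) ⊗ₜ w) := rfl

theorem tensor_ract_proj (v : V) (w : W) (a : H) :
    (tensor M N).ract (proj M N (v ⊗ₜ w) ⊗ₜ a) = proj M N (v ⊗ₜ N.ract (w ⊗ₜ a)) := rfl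

end

/-! ### Monoidality of the deformation: comparison of the two tensor squares. -/

section DeformedTensor

variable {k : Type*} [CommRing k] {H : Type*} [Ring H] [Bialgebra k H]
  {E : Type*} [AddCommGroup E] [Module k E] (M : BicovariantBimodule k H E) (γ : TwoCocycle k H)

/-- The canonical map `E_γ ⊗ E_γ → (E ⊗ E)_γ` of tensor products over the deformed and the
original algebra. -/
def deformTensor : TensorOver (M.deform γ) (M.deform γ) →ₗ[k] TensorOver M M :=
  (balancing (M.deform γ) (M.deform γ)).liftQ (γ.deform M.toBicomodule M.toBicomodule (proj M M))
    -- The quotient map is balanced, that is, associative with the two actions; the cocycle identity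
    -- passes this on to the deformed actions.
    (balancing_le (M.deform γ) (M.deform γ) _ fun v a w =>
      γ.deform_assoc M.ract_covariant M.lact_covariant (proj_balanced M M) v a w)

theorem deformTensor_proj (t : E ⊗[k] E) : deformTensor M γ (proj (M.deform γ) (M.deform γ) t) =
    proj M M ((M.toBicomodule.tensor M.toBicomodule).twist γ.unit t) := rfl

theorem deformTensor_proj_lact (a : H) (v w : E) :
    deformTensor M γ (proj (M.deform γ) (M.deform γ) (M.deformLact γ (a ⊗ₜ v) ⊗ₜ w)) =
      (tensor M M).deformLact γ (a ⊗ₜ deformTensor M γ (proj (M.deform γ) (M.deform γ)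
        (v ⊗ₜ w))) :=
  γ.deform_assoc (Q' := M.toBicomodule) (S' := tensorBicomodule M M) M.lact_covariant
    (proj_bicovariant M M) (μ' := proj M M) (ν' := (tensor M M).lact) (fun _ _ _ => rfl) a v w

theorem deformTensor_proj_ract (v w : E) (a : H) :
    deformTensor M γ (proj (M.deform γ) (M.deform γ) (v ⊗ₜ M.deformRact γ (w ⊗ₜ a))) =
      (tensor M M).deformRact γ (deformTensor M γ (proj (M.deform γ) (M.deform γ)
        (v ⊗ₜ w)) ⊗ₜ a) :=
  (γ.deform_assoc (S' := M.toBicomodule) (Q' := tensorBicomodule M M) (proj_bicovariant M M)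
    M.ract_covariant (μ' := (tensor M M).ract) (ν' := proj M M) (fun _ _ _ => rfl) v w a).symm

/-- With its right-handed counterpart, this says that the comparison map is a bimodule map onto the
deformation of the original square, so flip-equivariance can be transported. -/
theorem deformTensor_lact (a : CocycleTwist γ) (x : TensorOver (M.deform γ) (M.deform γ)) :
    deformTensor M γ ((tensor (M.deform γ) (M.deform γ)).lact (a ⊗ₜ x)) =
      (tensor M M).deformLact γ ((show H from a) ⊗ₜ deformTensor M γ x) := by
  refine hom_ext (M.deform γ) (M.deform γ)
    (deformTensor M γ ∘ₗ (tensor (M.deform γ) (M.deform γ)).lact ∘ₗ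
      TensorProduct.mk k (CocycleTwist γ) _ a)
    ((tensor M M).deformLact γ ∘ₗ TensorProduct.mk k H _ (show H from a) ∘ₗ deformTensor M γ) x
    fun v w => ?_
  exact (congrArg (deformTensor M γ) (tensor_lact_proj (M.deform γ) (M.deform γ) a v w)).trans
    (deformTensor_proj_lact M γ a v w)

theorem deformTensor_ract (x : TensorOver (M.deform γ) (M.deform γ)) (a : CocycleTwist γ) :
    deformTensor M γ ((tensor (M.deform γ) (M.deform γ)).ract (x ⊗ₜ a)) =
      (tensor M M).deformRact γ (deformTensor M γ x ⊗ₜ (show H from a)) := by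
  refine hom_ext (M.deform γ) (M.deform γ)
    (deformTensor M γ ∘ₗ (tensor (M.deform γ) (M.deform γ)).ract ∘ₗ
      (TensorProduct.mk k _ (CocycleTwist γ)).flip a)
    ((tensor M M).deformRact γ ∘ₗ (TensorProduct.mk k _ H).flip (show H from a) ∘ₗ
      deformTensor M γ) x fun v w => ?_
  exact (congrArg (deformTensor M γ) (tensor_ract_proj (M.deform γ) (M.deform γ) v w a)).trans
    (deformTensor_proj_ract M γ v w a)

end DeformedTensor

end BicovariantBimodule

namespace BicovariantBimodule

/-! ### The twist on left-invariant pairs. -/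

section Incl

variable {k : Type*} [Field k] {H : Type*} [Ring H] [Bialgebra k H]
  {E : Type*} [AddCommGroup E] [Module k E] (M : BicovariantBimodule k H E) (γ : TwoCocycle k H)

theorem incl_bicovariant : (M.leftInvBicomodule.codiag M.leftInvBicomodule).IsBicovariant
    (tensorBicomodule M M) (incl M) :=
  (proj_bicovariant M M).comp ((M.leftInv_subtype_bicovariant.tensorMap
    M.leftInv_subtype_bicovariant).push (Bialgebra.mulCoalgHom k H))

/-- The map `ω ⊗ ω' ↦ ω₍₀₎ ⊗ ω'₍₀₎ γ⁻¹(ω₍₁₎ ⊗ ω'₍₁₎)` on `₀E ⊗ ₀E`. -/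
def twist₀ : M.leftInv ⊗[k] M.leftInv →ₗ[k] M.leftInv ⊗[k] M.leftInv :=
  (M.leftInvBicomodule.tensor M.leftInvBicomodule).twist γ.unit

/-- The inverse of `twist₀`. -/
def twistInv₀ : M.leftInv ⊗[k] M.leftInv →ₗ[k] M.leftInv ⊗[k] M.leftInv :=
  (M.leftInvBicomodule.tensor M.leftInvBicomodule).twist γ.unit⁻¹

theorem twist₀_twistInv₀ (t : M.leftInv ⊗[k] M.leftInv) :
    twist₀ M γ (twistInv₀ M γ t) = t :=
  Bicomodule.twist_twist_inv _ _ t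

theorem twistInv₀_twist₀ (t : M.leftInv ⊗[k] M.leftInv) :
    twistInv₀ M γ (twist₀ M γ t) = t := by
  simpa [twist₀, twistInv₀] using Bicomodule.twist_twist_inv
    (M.leftInvBicomodule.tensor M.leftInvBicomodule) γ.unit⁻¹ t

/-- The map `incl` of the deformed bimodule; the left-invariant elements are unchanged. -/
def deformIncl : M.leftInv ⊗[k] M.leftInv →ₗ[k] TensorOver (M.deform γ) (M.deform γ) :=
  incl (M.deform γ)

/-- The inclusion of the invariants is bicovariant, so the twist on `E ⊗ E` restricts to `twist₀`.
-/
theorem deformTensor_deformIncl (t : M.leftInv ⊗[k] M.leftInv) :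
    deformTensor M γ (deformIncl M γ t) = incl M (twist₀ M γ t) :=
  congrArg (proj M M) ((M.leftInv_subtype_bicovariant.tensorMap
    M.leftInv_subtype_bicovariant).twist γ.unit t)

theorem deformIncl_bicovariant : ((M.leftInvBicomodule.toTwist γ).codiag
    (M.leftInvBicomodule.toTwist γ)).IsBicovariant (tensorBicomodule (M.deform γ) (M.deform γ))
      (deformIncl M γ) := by
  have h : (M.leftInvBicomodule.toTwist γ).IsBicovariant (M.toBicomodule.toTwist γ)
    M.leftInv.subtype := M.leftInv_subtype_bicovariant
  exact (proj_bicovariant (M.deform γ) (M.deform γ)).comp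
    ((h.tensorMap h).push (Bialgebra.mulCoalgHom k (CocycleTwist γ)))

/-- This lets the identity of `₀E ⊗ ₀E` count as a bicovariant product, so that `twist₀` is its
deformation and `deform_assoc` applies to it. -/
theorem id_bicovariant : (M.leftInvBicomodule.codiag M.leftInvBicomodule).IsBicovariant
    (M.leftInvBicomodule.codiag M.leftInvBicomodule) LinearMap.id :=
  ⟨fun v => by simp, fun v => by simp⟩

theorem twist₀_bicovariant : ((M.leftInvBicomodule.toTwist γ).codiag
    (M.leftInvBicomodule.toTwist γ)).IsBicovariant
      ((M.leftInvBicomodule.codiag M.leftInvBicomodule).toTwist γ) (twist₀ M γ) := by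
  have h' := γ.deform_bicovariant (id_bicovariant M)
  rwa [TwoCocycle.deform, LinearMap.id_comp] at h'

end Incl

/-! ### The braiding of the deformed bimodule. -/

section Braiding

variable {k : Type*} [Field k] {A : Type*} [CommRing A] [HopfAlgebra k A]
  {E : Type*} [AddCommGroup E] [Module k E] (M : BicovariantBimodule k A E) (γ : TwoCocycle k A)

/-- In the free coordinates `A ⊗ ₀E ⊗ ₀E` on both sides the comparison map becomes a composite of
two twists, each invertible. -/
theorem deformTensor_bijective : Function.Bijective (deformTensor M γ) := by
  let m : A ⊗[k] (M.leftInv ⊗[k] M.leftInv) →ₗ[k] TensorOver (M.deform γ) (M.deform γ) :=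
    mulMap (M.deform γ)
  have hm : Function.Bijective m := mulMap_bijective (M.deform_leftInvMul_bijective γ)
  have h : deformTensor M γ ∘ₗ m = mulMap M ∘ₗ ((Bicomodule.regular k A).tensor
      (M.leftInvBicomodule.codiag M.leftInvBicomodule)).twist γ.unit ∘ₗ
        (twist₀ M γ).lTensor A := by
    refine TensorProduct.ext' fun a t => ?_
    refine (deformTensor_lact M γ a (deformIncl M γ t)).trans ?_
    refine (congrArg (fun z => (tensor M M).deformLact γ (a ⊗ₜ z))
      (deformTensor_deformIncl M γ t)).trans ?_
    exact congrArg (tensor M M).lact (((incl_bicovariant M).lTensor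
      (Bicomodule.regular k A)).twist γ.unit (a ⊗ₜ twist₀ M γ t))
  have ht : Function.Bijective ((twist₀ M γ).lTensor A) :=
    (LinearEquiv.lTensor A (LinearEquiv.ofBijective (twist₀ M γ)
      (Bicomodule.twist_bijective (M.leftInvBicomodule.tensor M.leftInvBicomodule)
        γ.unit))).bijective
  have hb : Function.Bijective (deformTensor M γ ∘ₗ m) := by
    rw [h, LinearMap.coe_comp, LinearMap.coe_comp]
    exact (mulMap_bijective M.leftInvMul_bijective).comp
      ((Bicomodule.twist_bijective _ _).comp ht)
  exact (Function.Bijective.of_comp_iff (deformTensor M γ) hm).1 hb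

/-- `deformTensor` as a linear equivalence. -/
def deformTensorEquiv : TensorOver (M.deform γ) (M.deform γ) ≃ₗ[k] TensorOver M M :=
  LinearEquiv.ofBijective (deformTensor M γ) (deformTensor_bijective M γ)

variable {M}

/-- The flip of `E ⊗ E`, transported to the tensor square of the deformed bimodule. -/
def deformFlip (hs : M.IsSymmetric) : TensorOver (M.deform γ) (M.deform γ) →ₗ[k]
    TensorOver (M.deform γ) (M.deform γ) :=
  (deformTensorEquiv M γ).symm.toLinearMap ∘ₗ flip hs ∘ₗ (deformTensorEquiv M γ).toLinearMap

theorem deformTensor_deformFlip (hs : M.IsSymmetric) (x : TensorOver (M.deform γ) (M.deform γ)) :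
    deformTensor M γ (deformFlip γ hs x) = flip hs (deformTensor M γ x) :=
  (deformTensorEquiv M γ).apply_symm_apply _

/-- Everything is checked after applying the injective map `deformTensor`. -/
theorem deformFlip_isBraiding (hs : M.IsSymmetric) : IsBraiding (M.deform γ) (deformFlip γ hs) where
  map_lact a x := by
    refine (deformTensor_bijective M γ).1 ?_
    rw [deformTensor_deformFlip, deformTensor_lact, deformTensor_lact, deformTensor_deformFlip]
    refine (flip_lact hs _).trans ?_
    -- The deformed action is the original one after a twist, and the twist commutes with the
    -- bicovariant flip.
    exact congrArg (tensor M M).lact (((flip_bicovariant hs).lTensor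
      (Bicomodule.regular k A)).twist γ.unit _).symm
  map_ract x a := by
    refine (deformTensor_bijective M γ).1 ?_
    rw [deformTensor_deformFlip, deformTensor_ract, deformTensor_ract, deformTensor_deformFlip]
    refine (flip_ract hs _).trans ?_
    exact congrArg (tensor M M).ract (((flip_bicovariant hs).rTensor
      (Bicomodule.regular k A)).twist γ.unit _).symm
  exchange ω hω η hη := by
    have hω' : ω ∈ M.leftInv := hω
    have hη' : η ∈ M.rightInv := hη
    refine (deformTensor_bijective M γ).1 ?_
    -- Both `ω ⊗ η` and `η ⊗ ω` are fixed by the twist, so only the plain flip remains.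
    rw [deformTensor_deformFlip, deformTensor_proj, deformTensor_proj,
      Bicomodule.twist_tmul_of_leftInv_rightInv _ _ _ hω' hη',
      Bicomodule.twist_tmul_of_rightInv_leftInv _ _ _ hη' hω']
    rfl

theorem deform_braiding_eq (hs : M.IsSymmetric) : braiding (M.deform γ) = deformFlip γ hs :=
  braiding_eq (deformFlip_isBraiding γ hs) (M.deform_leftInvMul_bijective γ).2
    (M.deform_rightInvMul_surjective γ)

variable (M) in
/-- The braiding of the deformed bimodule on `₀E ⊗ ₀E`: the flip, conjugated by `twist₀`. -/
def deformFlip₀ : Module.End k (M.leftInv ⊗[k] M.leftInv) :=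
  twistInv₀ M γ ∘ₗ (TensorProduct.comm k M.leftInv M.leftInv).toLinearMap ∘ₗ twist₀ M γ

variable (M) in
theorem twist₀_deformFlip₀ (t : M.leftInv ⊗[k] M.leftInv) :
    twist₀ M γ (deformFlip₀ M γ t) = TensorProduct.comm k _ _ (twist₀ M γ t) :=
  twist₀_twistInv₀ M γ _

theorem deformIncl_deformFlip₀ (hs : M.IsSymmetric) (t : M.leftInv ⊗[k] M.leftInv) :
    deformIncl M γ (deformFlip₀ M γ t) = braiding (M.deform γ) (deformIncl M γ t) := by
  rw [deform_braiding_eq γ hs]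
  refine (deformTensor_bijective M γ).1 ?_
  rw [deformTensor_deformFlip, deformTensor_deformIncl, deformTensor_deformIncl,
    twist₀_deformFlip₀]
  exact Bicomodule.lin_ext (incl M ∘ₗ (TensorProduct.comm k _ _).toLinearMap)
    (flip hs ∘ₗ incl M) (twist₀ M γ t) fun _ _ => rfl

theorem deform_braiding₀_eq (hs : M.IsSymmetric) : braiding₀ (M.deform γ) = deformFlip₀ M γ := by
  have h := deformIncl_deformFlip₀ γ hs
  exact braiding₀_eq (M.deform_leftInvMul_bijective γ) h

end Braiding

end BicovariantBimodule

/-- The retraction `r` is only linear: it cancels `S` inside the tensor products. Used to pass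
covariance from a connection to its restriction `conn₀`. -/
theorem Bicomodule.IsBicovariant.of_leftInverse {k : Type*} [CommRing k] {C : Type*}
    [AddCommGroup C] [Module k C] [Coalgebra k C] {V : Type*} [AddCommGroup V] [Module k V]
    {W : Type*} [AddCommGroup W] [Module k W] {U : Type*} [AddCommGroup U] [Module k U]
    {X : Bicomodule k C V} {Y : Bicomodule k C W} {Z : Bicomodule k C U}
    {S : W →ₗ[k] U} {T : V →ₗ[k] W} (hS : Y.IsBicovariant Z S) {r : U →ₗ[k] W}
    (hr : ∀ w, r (S w) = w) (h : X.IsBicovariant Z (S ∘ₗ T)) : X.IsBicovariant Y T := by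
  have hr' : r ∘ₗ S = LinearMap.id := LinearMap.ext hr
  constructor <;> intro v
  · have h1 := congrArg (r.lTensor C) ((h.1 v).trans (hS.1 (T v)).symm)
    rw [LinearMap.lTensor_comp_apply, ← LinearMap.lTensor_comp_apply _ r,
      ← LinearMap.lTensor_comp_apply _ r, hr'] at h1
    simpa using h1
  · have h1 := congrArg (r.rTensor C) ((h.2 v).trans (hS.2 (T v)).symm)
    rw [LinearMap.rTensor_comp_apply, ← LinearMap.rTensor_comp_apply _ r,
      ← LinearMap.rTensor_comp_apply _ r, hr'] at h1
    simpa using h1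

namespace BicovariantBimodule

variable {k : Type*} [Field k] {A : Type*} [CommRing A] [HopfAlgebra k A]
  {E : Type*} [AddCommGroup E] [Module k E] {M : BicovariantBimodule k A E} {γ : TwoCocycle k A}

/-! ### Metric and connection carried back to the undeformed side. -/

section Metric

variable (g : TensorOver (M.deform γ) (M.deform γ) →ₗ[k] CocycleTwist γ)

/-- The metric on `₀E ⊗ ₀E` which corresponds to a metric on the deformed bimodule. -/
def untwistMetric : M.leftInv ⊗[k] M.leftInv →ₗ[k] A :=
  (show TensorOver (M.deform γ) (M.deform γ) →ₗ[k] A from g) ∘ₗ deformIncl M γ ∘ₗ twistInv₀ M γ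

theorem untwistMetric_twist₀ (t : M.leftInv ⊗[k] M.leftInv) :
    untwistMetric g (twist₀ M γ t) = g (deformIncl M γ t) :=
  congrArg (fun z => g (deformIncl M γ z)) (twistInv₀_twist₀ M γ t)

/-- Conjugation by `twist₀` turns the braiding into the flip, so `g ∘ σ = g` becomes ordinary
symmetry. -/
theorem untwistMetric_comm (hs : M.IsSymmetric) (hg : IsLeftMetric (M.deform γ) g)
    (t : M.leftInv ⊗[k] M.leftInv) :
    untwistMetric g (TensorProduct.comm k _ _ t) = untwistMetric g t := by
  rw [← twist₀_twistInv₀ M γ t, ← twist₀_deformFlip₀, untwistMetric_twist₀,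
    untwistMetric_twist₀, deformIncl_deformFlip₀ γ hs, hg.map_braiding]

/-- The deformed codiagonal coaction uses the deformed product; `twist₀` intertwines it with the
undeformed one, as the conclusion requires. -/
theorem untwistMetric_bicovariant (hg : IsBiinvariant (M.deform γ) g) :
    (M.leftInvBicomodule.codiag M.leftInvBicomodule).IsBicovariant (Bicomodule.regular k A)
      (untwistMetric g) := by
  have h : ((M.leftInvBicomodule.codiag M.leftInvBicomodule).toTwist γ).IsBicovariant
      ((Bicomodule.regular k A).toTwist γ) (untwistMetric g) := by
    refine (twist₀_bicovariant M γ).of_surjective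
      (fun t => ⟨twistInv₀ M γ t, twist₀_twistInv₀ M γ t⟩) ?_
    have h1 : untwistMetric g ∘ₗ twist₀ M γ =
        (show TensorOver (M.deform γ) (M.deform γ) →ₗ[k] A from g) ∘ₗ deformIncl M γ :=
      LinearMap.ext (untwistMetric_twist₀ g)
    rw [h1]
    exact hg.bicovariant.comp (deformIncl_bicovariant M γ)
  -- `toTwist` keeps the coactions and the coalgebra, so covariance over either algebra is the same
  -- statement.
  exact h

end Metric

section Connection

variable (conn : E →ₗ[k] TensorOver (M.deform γ) (M.deform γ))

/-- The connection `₀E → ₀E ⊗ ₀E` which corresponds to a connection on the deformed bimodule. -/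
def untwistConn : M.leftInv →ₗ[k] M.leftInv ⊗[k] M.leftInv :=
  twist₀ M γ ∘ₗ (show M.leftInv →ₗ[k] M.leftInv ⊗[k] M.leftInv from conn₀ (M.deform γ) conn)

/-- `conn₀` is covariant for the deformed codiagonal coactions because `conn` and the inclusions
are, and `twist₀` then leads to the undeformed ones. -/
theorem untwistConn_bicovariant
    (hconn : (M.deform γ).toBicomodule.IsBicovariant
      (tensor (M.deform γ) (M.deform γ)).toBicomodule conn) :
    M.leftInvBicomodule.IsBicovariant (M.leftInvBicomodule.codiag M.leftInvBicomodule)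
      (untwistConn conn) := by
  let c : M.leftInv →ₗ[k] M.leftInv ⊗[k] M.leftInv := conn₀ (M.deform γ) conn
  have hι : (M.leftInvBicomodule.toTwist γ).IsBicovariant (M.toBicomodule.toTwist γ)
    M.leftInv.subtype := M.leftInv_subtype_bicovariant
  have hc : deformIncl M γ ∘ₗ c = conn ∘ₗ M.leftInv.subtype :=
    LinearMap.ext (incl_conn₀ (M.deform_leftInvMul_bijective γ) hconn.1)
  obtain ⟨r, hr, -⟩ := exists_incl_retraction (M.deform_leftInvMul_bijective γ)
  have h1 : (M.leftInvBicomodule.toTwist γ).IsBicovariant ((M.leftInvBicomodule.toTwist γ).codiag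
      (M.leftInvBicomodule.toTwist γ)) c := by
    refine (deformIncl_bicovariant M γ).of_leftInverse (r := r) hr ?_
    rw [hc]
    exact hconn.comp hι
  have h2 : (M.leftInvBicomodule.toTwist γ).IsBicovariant
      ((M.leftInvBicomodule.codiag M.leftInvBicomodule).toTwist γ) (untwistConn conn) :=
    (twist₀_bicovariant M γ).comp h1
  exact h2

end Connection

/-! ### The two halves of the compatibility condition in undeformed terms. -/

section Formulas

variable {g : TensorOver (M.deform γ) (M.deform γ) →ₗ[k] CocycleTwist γ}
  {conn : E →ₗ[k] TensorOver (M.deform γ) (M.deform γ)}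

/-- An instance of `deform_assoc`, hence of the cocycle identity: twisting the last two factors,
contracting, then acting equals twisting the first two factors, then the pair against the third, and
contracting without deformation. -/
theorem metricRight_assoc (hg : IsBiinvariant (M.deform γ) g) (x : M.leftInv ⊗[k] M.leftInv)
    (u : M.leftInv) : metricRight (M.deform γ) g (TensorProduct.assoc k _ _ _ (x ⊗ₜ u)) =
      M.ract (TensorProduct.map M.leftInv.subtype (untwistMetric g) (TensorProduct.assoc k _ _ _
        (((M.leftInvBicomodule.codiag M.leftInvBicomodule).tensor M.leftInvBicomodule).twist γ.unit
          (twist₀ M γ x ⊗ₜ u)))) := by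
  let ν : M.leftInv ⊗[k] A →ₗ[k] E := M.ract ∘ₗ M.leftInv.subtype.rTensor A
  let μ : M.leftInv ⊗[k] M.leftInv ⊗[k] M.leftInv →ₗ[k] E :=
    M.ract ∘ₗ TensorProduct.map M.leftInv.subtype (untwistMetric g) ∘ₗ
      (TensorProduct.assoc k _ _ _).toLinearMap
  have hν : ∀ (v : M.leftInv) (a : A), γ.deform M.leftInvBicomodule (Bicomodule.regular k A) ν
      (v ⊗ₜ a) = M.deformRact γ ((v : E) ⊗ₜ a) := fun v a =>
    congrArg M.ract ((M.leftInv_subtype_bicovariant.rTensor (Bicomodule.regular k A)).twist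
      γ.unit (v ⊗ₜ a)).symm
  refine Bicomodule.lin_ext ((show M.leftInv ⊗[k] (M.leftInv ⊗[k] M.leftInv) →ₗ[k] E from
      metricRight (M.deform γ) g) ∘ₗ (TensorProduct.assoc k _ _ _).toLinearMap ∘ₗ
        (TensorProduct.mk k _ _).flip u)
    (γ.deform (M.leftInvBicomodule.codiag M.leftInvBicomodule) M.leftInvBicomodule μ ∘ₗ
      (TensorProduct.mk k _ _).flip u ∘ₗ twist₀ M γ) x fun v w => ?_
  -- The two inner products are the identity on `v ⊗ w` and the metric on `w ⊗ u`; `μ` and `ν` are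
  -- chosen so that the undeformed associativity holds by definition.
  have h := γ.deform_assoc (id_bicovariant M) (untwistMetric_bicovariant g hg) (μ' := μ)
    (ν' := ν) (fun _ _ _ => rfl) v w u
  refine Eq.trans ?_ h.symm
  refine Eq.trans ?_ (hν _ _).symm
  exact congrArg (fun z => M.deformRact γ ((v : E) ⊗ₜ z)) (untwistMetric_twist₀ g (w ⊗ₜ u)).symm

theorem metricLeft_assoc (hg : IsBiinvariant (M.deform γ) g) (v : M.leftInv)
    (x : M.leftInv ⊗[k] M.leftInv) :
    metricLeft (M.deform γ) g ((TensorProduct.assoc k _ _ _).symm (v ⊗ₜ x)) =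
      M.lact (TensorProduct.map (untwistMetric g) M.leftInv.subtype
        ((TensorProduct.assoc k _ _ _).symm
          ((M.leftInvBicomodule.tensor (M.leftInvBicomodule.codiag M.leftInvBicomodule)).twist
            γ.unit (v ⊗ₜ twist₀ M γ x)))) := by
  let μ : A ⊗[k] M.leftInv →ₗ[k] E := M.lact ∘ₗ M.leftInv.subtype.lTensor A
  let ν : M.leftInv ⊗[k] (M.leftInv ⊗[k] M.leftInv) →ₗ[k] E :=
    M.lact ∘ₗ TensorProduct.map (untwistMetric g) M.leftInv.subtype ∘ₗ
      (TensorProduct.assoc k _ _ _).symm.toLinearMap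
  have hμ : ∀ (a : A) (v : M.leftInv), γ.deform (Bicomodule.regular k A) M.leftInvBicomodule μ
      (a ⊗ₜ v) = M.deformLact γ (a ⊗ₜ (v : E)) := fun a v =>
    congrArg M.lact ((M.leftInv_subtype_bicovariant.lTensor (Bicomodule.regular k A)).twist
      γ.unit (a ⊗ₜ v)).symm
  refine Bicomodule.lin_ext ((show M.leftInv ⊗[k] M.leftInv ⊗[k] M.leftInv →ₗ[k] E from
      metricLeft (M.deform γ) g) ∘ₗ (TensorProduct.assoc k _ _ _).symm.toLinearMap ∘ₗ
        TensorProduct.mk k _ _ v)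
    (γ.deform M.leftInvBicomodule (M.leftInvBicomodule.codiag M.leftInvBicomodule) ν ∘ₗ
      TensorProduct.mk k _ _ v ∘ₗ twist₀ M γ) x fun w u => ?_
  have h := γ.deform_assoc (untwistMetric_bicovariant g hg) (id_bicovariant M) (μ' := μ)
    (ν' := ν) (fun _ _ _ => rfl) v w u
  refine Eq.trans ?_ h
  refine Eq.trans ?_ (hμ _ _).symm
  exact congrArg (fun z => M.deformLact γ (z ⊗ₜ (u : E))) (untwistMetric_twist₀ g (v ⊗ₜ w)).symm

/-- By bicovariance of `untwistConn` the outer twist left by `metricRight_assoc` slides past it and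
becomes `twist₀` on the argument. -/
theorem connLeft_eq (hg : IsBiinvariant (M.deform γ) g)
    (hconn : (M.deform γ).toBicomodule.IsBicovariant
      (tensor (M.deform γ) (M.deform γ)).toBicomodule conn) (t : M.leftInv ⊗[k] M.leftInv) :
    connLeft (M.deform γ) g conn t =
      M.ract (TensorProduct.map M.leftInv.subtype (untwistMetric g) (TensorProduct.assoc k _ _ _
        ((untwistConn conn).rTensor M.leftInv (twist₀ M γ t)))) := by
  have h := (untwistConn_bicovariant conn hconn).rTensor M.leftInvBicomodule
  rw [twist₀, ← h.twist]
  refine Bicomodule.lin_ext (show M.leftInv ⊗[k] M.leftInv →ₗ[k] E from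
    connLeft (M.deform γ) g conn) (M.ract ∘ₗ TensorProduct.map M.leftInv.subtype
      (untwistMetric g) ∘ₗ (TensorProduct.assoc k _ _ _).toLinearMap ∘ₗ
        ((M.leftInvBicomodule.codiag M.leftInvBicomodule).tensor M.leftInvBicomodule).twist
          γ.unit ∘ₗ (untwistConn conn).rTensor M.leftInv) t fun v u => ?_
  exact metricRight_assoc hg (show M.leftInv ⊗[k] M.leftInv from conn₀ (M.deform γ) conn v) u

/-- As for `connLeft_eq`, with one more map to pass: the flip, bicovariant because `A` is
commutative. -/
theorem connRight_eq (hs : M.IsSymmetric) (hg : IsBiinvariant (M.deform γ) g)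
    (hconn : (M.deform γ).toBicomodule.IsBicovariant
      (tensor (M.deform γ) (M.deform γ)).toBicomodule conn) (t : M.leftInv ⊗[k] M.leftInv) :
    connRight (M.deform γ) g conn t =
      M.lact (TensorProduct.map (untwistMetric g) M.leftInv.subtype
        ((TensorProduct.assoc k _ _ _).symm (((TensorProduct.comm k _ _).toLinearMap ∘ₗ
          untwistConn conn).lTensor M.leftInv (twist₀ M γ t)))) := by
  have h := ((Bicomodule.codiag_comm M.leftInvBicomodule M.leftInvBicomodule).comp
    (untwistConn_bicovariant conn hconn)).lTensor M.leftInvBicomodule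
  rw [twist₀, ← h.twist]
  refine Bicomodule.lin_ext (show M.leftInv ⊗[k] M.leftInv →ₗ[k] E from
    connRight (M.deform γ) g conn) (M.lact ∘ₗ TensorProduct.map (untwistMetric g)
      M.leftInv.subtype ∘ₗ (TensorProduct.assoc k _ _ _).symm.toLinearMap ∘ₗ
        (M.leftInvBicomodule.tensor (M.leftInvBicomodule.codiag M.leftInvBicomodule)).twist
          γ.unit ∘ₗ ((TensorProduct.comm k _ _).toLinearMap ∘ₗ
            untwistConn conn).lTensor M.leftInv) t fun v u => ?_
  let c : M.leftInv →ₗ[k] M.leftInv ⊗[k] M.leftInv := conn₀ (M.deform γ) conn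
  have h1 : connRight (M.deform γ) g conn (v ⊗ₜ u) = metricLeft (M.deform γ) g
      ((TensorProduct.assoc k _ _ _).symm (v ⊗ₜ deformFlip₀ M γ (c u))) := by
    rw [← deform_braiding₀_eq γ hs]
    rfl
  refine h1.trans ((metricLeft_assoc hg v _).trans ?_)
  -- The `twist₀` supplied by `metricLeft_assoc` cancels the outer half of the conjugated flip, and
  -- the inner half turns `conn₀` into `untwistConn`.
  rw [twist₀_deformFlip₀]
  rfl

/-- After untwisting this is the classical identity `p g(q ⊗ u) = g(u ⊗ q) p`, for the terms `p ⊗ q`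
of the untwisted connection at `v`. -/
theorem connLeft_eq_connRight_braiding₀ (hs : M.IsSymmetric) (hg : IsLeftMetric (M.deform γ) g)
    (hg' : IsBiinvariant (M.deform γ) g)
    (hconn : (M.deform γ).toBicomodule.IsBicovariant
      (tensor (M.deform γ) (M.deform γ)).toBicomodule conn) (t : M.leftInv ⊗[k] M.leftInv) :
    connLeft (M.deform γ) g conn t =
      connRight (M.deform γ) g conn (deformFlip₀ M γ t) := by
  refine (connLeft_eq hg' hconn t).trans (Eq.trans ?_ (connRight_eq hs hg' hconn _).symm)
  rw [twist₀_deformFlip₀]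
  generalize twist₀ M γ t = s
  refine Bicomodule.lin_ext (M.ract ∘ₗ TensorProduct.map M.leftInv.subtype (untwistMetric g) ∘ₗ
    (TensorProduct.assoc k _ _ _).toLinearMap ∘ₗ (untwistConn conn).rTensor M.leftInv)
    (M.lact ∘ₗ TensorProduct.map (untwistMetric g) M.leftInv.subtype ∘ₗ
      (TensorProduct.assoc k _ _ _).symm.toLinearMap ∘ₗ ((TensorProduct.comm k _ _).toLinearMap ∘ₗ
        untwistConn conn).lTensor M.leftInv ∘ₗ (TensorProduct.comm k _ _).toLinearMap) s
    fun v u => ?_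
  refine Bicomodule.lin_ext (M.ract ∘ₗ TensorProduct.map M.leftInv.subtype (untwistMetric g) ∘ₗ
    (TensorProduct.assoc k _ _ _).toLinearMap ∘ₗ (TensorProduct.mk k _ _).flip u)
    (M.lact ∘ₗ TensorProduct.map (untwistMetric g) M.leftInv.subtype ∘ₗ
      (TensorProduct.assoc k _ _ _).symm.toLinearMap ∘ₗ TensorProduct.mk k _ _ u ∘ₗ
        (TensorProduct.comm k _ _).toLinearMap) (untwistConn conn v) fun p q => ?_
  refine (hs (untwistMetric g (q ⊗ₜ u)) p).trans ?_
  exact congrArg (fun z => M.lact (z ⊗ₜ (p : E))) (untwistMetric_comm g hs hg (q ⊗ₜ u)).symm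

theorem deformFlip₀_deformFlip₀ (t : M.leftInv ⊗[k] M.leftInv) :
    deformFlip₀ M γ (deformFlip₀ M γ t) = t := by
  have h : twist₀ M γ (deformFlip₀ M γ (deformFlip₀ M γ t)) = twist₀ M γ t := by
    rw [twist₀_deformFlip₀, twist₀_deformFlip₀, TensorProduct.comm_comm]
  rw [← twistInv₀_twist₀ M γ (deformFlip₀ M γ (deformFlip₀ M γ t)), h, twistInv₀_twist₀]

end Formulas

end BicovariantBimodule

/-- For a cocycle deformation of a calculus with symmetric bimodule structure over a commutative
Hopf algebra, the two notions of metric compatibility agree. -/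
theorem BicovariantCalculus.deform_compatible_iff {k : Type*} [Field k] (h2 : (2 : k) ≠ 0)
    {A : Type*} [CommRing A] [HopfAlgebra k A] {E : Type*} [AddCommGroup E] [Module k E]
    (C : BicovariantCalculus k A E) (hs : C.toBicovariantBimodule.IsSymmetric)
    {γ : TwoCocycle k A} {g : (C.deform γ).Square →ₗ[k] CocycleTwist γ}
    (hg : BicovariantBimodule.IsLeftMetric (C.deform γ).toBicovariantBimodule g)
    (hg' : BicovariantBimodule.IsBiinvariant (C.deform γ).toBicovariantBimodule g)
    {conn : E →ₗ[k] (C.deform γ).Square}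
    (hconn : (C.deform γ).toBicomodule.IsBicovariant (C.deform γ).square.toBicomodule conn) :
    (C.deform γ).Compatible g conn ↔
      BicovariantBimodule.HSCompatible (C.deform γ).toBicovariantBimodule g conn := by
  have hσ : BicovariantBimodule.braiding₀ (C.toBicovariantBimodule.deform γ) =
      BicovariantBimodule.deformFlip₀ C.toBicovariantBimodule γ :=
    BicovariantBimodule.deform_braiding₀_eq γ hs
  -- The invariants are written with the undeformed bimodule so that `hσ` rewrites; they are
  -- definitionally those of the deformed one.
  have hinv : ∀ t : C.toBicovariantBimodule.leftInv ⊗[k] C.toBicovariantBimodule.leftInv,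
      BicovariantBimodule.braiding₀ (C.toBicovariantBimodule.deform γ)
        (BicovariantBimodule.braiding₀ (C.toBicovariantBimodule.deform γ) t) = t := by
    rw [hσ]
    exact BicovariantBimodule.deformFlip₀_deformFlip₀
  have hlr : ∀ t : C.toBicovariantBimodule.leftInv ⊗[k] C.toBicovariantBimodule.leftInv,
      BicovariantBimodule.connLeft (C.toBicovariantBimodule.deform γ) g conn t =
        BicovariantBimodule.connRight (C.toBicovariantBimodule.deform γ) g conn
          (BicovariantBimodule.braiding₀ (C.toBicovariantBimodule.deform γ) t) := by
    rw [hσ]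
    exact BicovariantBimodule.connLeft_eq_connRight_braiding₀ hs hg hg' hconn
  have hM : Function.Bijective (C.toBicovariantBimodule.deform γ).leftInvMul :=
    C.toBicovariantBimodule.deform_leftInvMul_bijective γ
  exact (C.deform γ).compatible_iff_of_connLeft_eq h2 hM hg hg' hinv hlr

end

end BicovCalc

theorem mainTheorem11 {A : Type*} [CommRing A] [HopfAlgebra ℂ A] [Algebra.FiniteType ℂ A]
    (γ : TwoCocycle ℂ A)
    (g : ((classicalCalculus ℂ A).deform γ).Square →ₗ[ℂ] CocycleTwist γ)
    (hg : BicovariantBimodule.IsLeftMetric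
      ((classicalCalculus ℂ A).deform γ).toBicovariantBimodule g)
    (hg' : BicovariantBimodule.IsBiinvariant
      ((classicalCalculus ℂ A).deform γ).toBicovariantBimodule g)
    (conn : Ω[A⁄ℂ] →ₗ[ℂ] ((classicalCalculus ℂ A).deform γ).Square)
    (hconn : ((classicalCalculus ℂ A).deform γ).IsLeftConnection conn)
    (hconn' : ((classicalCalculus ℂ A).deform γ).toBicomodule.IsBicovariant
      ((classicalCalculus ℂ A).deform γ).square.toBicomodule conn) :
    ((classicalCalculus ℂ A).deform γ).Compatible g conn ↔
      BicovariantBimodule.HSCompatible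
        ((classicalCalculus ℂ A).deform γ).toBicovariantBimodule g conn := by
  exact BicovariantCalculus.deform_compatible_iff two_ne_zero (classicalCalculus ℂ A)
    -- Symmetry holds by definition: the classical right action is the left action after the flip.
    (fun _ _ => rfl) hg hg' hconn'
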